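/- Let $D\subset\mathbb{CP}^3$ be a domain (a non-empty connected open set) that covers a compact complex threefold $X$: that is, $X$ is a compact (Hausdorff) complex manifold of complex dimension $3$, and there is a surjective covering map $D\to X$ that is locally biholomorphic. Put $\Lambda=\mathbb{CP}^3\setminus D$. By a line we mean a complex projective line in $\mathbb{CP}^3$. We say that $\Lambda$ is locally a finite union of $k$-dimensional submanifolds if every point of $\Lambda$ has an open neighbourhood $U$ in $\mathbb{CP}^3$ such that $\Lambda\cap U$ is a union of finitely many embedded $C^\infty$ real submanifolds of $U$ of real dimension $k$, each closed in $U$. Case 1. If $\Lambda$ is locally a finite union of $2$-dimensional submanifolds, then $\Lambda$ is a union of finitely many lines. Case 2. If $\Lambda$ is locally a finite union of $3$-dimensional submanifolds, then $\Lambda$ is foliated by lines, in the following sense. Through every point of $\Lambda$ there passes a line contained in $\Lambda$; and every embedded $C^\infty$ real $3$-dimensional submanifold $M\subset\Lambda$ is smoothly foliated by open pieces of lines contained in $\Lambda$. The latter means that for every $x\in M$: (a) there is exactly one line $L\subset\Lambda$ through $x$ with $L\cap V\subset M$ for some neighbourhood $V$ of $x$; and (b) there are a $C^\infty$ chart $\varphi\colon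 V\to\mathbb R^6$ of $\mathbb{CP}^3$ on an open neighbourhood $V$ of $x$ and real linear subspaces $T\subset W\subset\mathbb R^6$ of dimensions $2$ and $3$ such that $M\cap V=\varphi^{-1}(W)$ and, for each $y\in M\cap V$, the plaque $\{z\in M\cap V:\varphi(z)-\varphi(y)\in T\}$ is contained in a line that is contained in $\Lambda$. (In particular, if $\Lambda$ itself is a submanifold, it is a disjoint union of lines.) -/

import Mathlib

open Set Topology
open scoped Manifold ContDiff

/-- The model space `ℂ³`. -/
abbrev C3 : Type := Fin 3 → ℂ

/-- The complex projective space `ℂℙ³`: the nonzero vectors of `ℂ⁴` up to complex scalars. -/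
abbrev CP3 : Type := Projectivization ℂ (Fin 4 → ℂ)

namespace CP3

/-- The quotient topology. -/
instance instTopologicalSpace : TopologicalSpace CP3 :=
  inferInstanceAs (TopologicalSpace (Quotient (projectivizationSetoid ℂ (Fin 4 → ℂ))))

theorem continuous_mk' :
    Continuous (fun v : {v : Fin 4 → ℂ // v ≠ 0} => Projectivization.mk ℂ v.1 v.2) :=
  continuous_quotient_mk'

theorem isQuotientMap_mk' :
    IsQuotientMap (fun v : {v : Fin 4 → ℂ // v ≠ 0} => Projectivization.mk ℂ v.1 v.2) :=
  isQuotientMap_quotient_mk'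

/-- The domain `{[v] : v i ≠ 0}` of the `i`-th affine chart. -/
def chartDomain (i : Fin 4) : Set CP3 :=
  {p | Projectivization.lift (fun v : {v : Fin 4 → ℂ // v ≠ 0} => v.1 i ≠ 0) (by
    rintro ⟨a, ha⟩ ⟨b, hb⟩ t (rfl : a = t • b)
    have ht : t ≠ 0 := by rintro rfl; simp at ha
    simp [ht]) p}

@[simp] theorem mk_mem_chartDomain (i : Fin 4) (v : Fin 4 → ℂ) (hv : v ≠ 0) :
    Projectivization.mk ℂ v hv ∈ chartDomain i ↔ v i ≠ 0 := Iff.rfl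

/-- The affine coordinates `[v] ↦ (v j / v i)_{j ≠ i}`. -/
noncomputable def affineCoord (i : Fin 4) : CP3 → C3 :=
  Projectivization.lift
    (fun v : {v : Fin 4 → ℂ // v ≠ 0} => fun j => v.1 (i.succAbove j) / v.1 i) (by
    rintro ⟨a, ha⟩ ⟨b, hb⟩ t (rfl : a = t • b)
    have ht : t ≠ 0 := by rintro rfl; simp at ha
    funext j
    simp [mul_div_mul_left _ _ ht])

@[simp] theorem affineCoord_mk (i : Fin 4) (v : Fin 4 → ℂ) (hv : v ≠ 0) :
    affineCoord i (Projectivization.mk ℂ v hv) = fun j => v (i.succAbove j) / v i := rfl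

theorem insertNth_one_ne_zero (i : Fin 4) (z : C3) :
    (i.insertNth (1 : ℂ) z : Fin 4 → ℂ) ≠ 0 := by
  intro h
  have := congrFun h i
  simp at this

/-- The inverse of the affine coordinates: put the homogeneous coordinate `1` at place `i`. -/
noncomputable def affinePoint (i : Fin 4) (z : C3) : CP3 :=
  Projectivization.mk ℂ (i.insertNth (1 : ℂ) z : Fin 4 → ℂ) (insertNth_one_ne_zero i z)

theorem isOpen_chartDomain (i : Fin 4) : IsOpen (chartDomain i) := by
  rw [← isQuotientMap_mk'.isOpen_preimage]
  exact isOpen_ne_fun ((continuous_apply i).comp continuous_subtype_val) continuous_const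

theorem affinePoint_mem (i : Fin 4) (z : C3) : affinePoint i z ∈ chartDomain i := by
  simp [affinePoint]

theorem affineCoord_affinePoint (i : Fin 4) (z : C3) :
    affineCoord i (affinePoint i z) = z := by
  funext j
  simp [affinePoint]

theorem affinePoint_affineCoord (i : Fin 4) {p : CP3} (hp : p ∈ chartDomain i) :
    affinePoint i (affineCoord i p) = p := by
  induction p using Projectivization.ind with
  | h v hv =>
    have hi : v i ≠ 0 := hp
    rw [affinePoint, Projectivization.mk_eq_mk_iff']
    refine ⟨(v i)⁻¹, ?_⟩
    funext k
    refine Fin.succAboveCases i ?_ (fun j => ?_) k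
    · simp [hi]
    · simp [div_eq_inv_mul]

theorem continuous_affinePoint (i : Fin 4) : Continuous (affinePoint i) := by
  have h : Continuous fun z : C3 => (i.insertNth (1 : ℂ) z : Fin 4 → ℂ) :=
    Continuous.finInsertNth i continuous_const continuous_id
  exact continuous_mk'.comp (h.subtype_mk (insertNth_one_ne_zero i))

theorem continuousOn_affineCoord (i : Fin 4) :
    ContinuousOn (affineCoord i) (chartDomain i) := by
  rw [isQuotientMap_mk'.continuousOn_isOpen_iff (isOpen_chartDomain i)]
  refine continuousOn_pi.2 fun j => ContinuousOn.div ?_ ?_ fun v hv => hv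
  · exact ((continuous_apply _).comp continuous_subtype_val).continuousOn
  · exact ((continuous_apply _).comp continuous_subtype_val).continuousOn

/-- The `i`-th affine chart of `ℂℙ³`. -/
noncomputable def affineChart (i : Fin 4) : OpenPartialHomeomorph CP3 C3 where
  toFun := affineCoord i
  invFun := affinePoint i
  source := chartDomain i
  target := univ
  map_source' _ _ := mem_univ _
  map_target' z _ := affinePoint_mem i z
  left_inv' _ hp := affinePoint_affineCoord i hp
  right_inv' z _ := affineCoord_affinePoint i z
  open_source := isOpen_chartDomain i
  open_target := isOpen_univ
  continuousOn_toFun := continuousOn_affineCoord i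
  continuousOn_invFun := (continuous_affinePoint i).continuousOn

theorem exists_mem_chartDomain (p : CP3) : ∃ i, p ∈ chartDomain i := by
  induction p using Projectivization.ind with
  | h v hv => exact Function.ne_iff.mp hv

/-- The standard manifold structure on `ℂℙ³`, by its four affine charts. -/
noncomputable instance instChartedSpace : ChartedSpace C3 CP3 where
  atlas := range affineChart
  chartAt p := affineChart (exists_mem_chartDomain p).choose
  mem_chart_source p := (exists_mem_chartDomain p).choose_spec
  chart_mem_atlas _ := mem_range_self _

theorem contDiffOn_transition (i j : Fin 4) :
    ContDiffOn ℂ ω (affineCoord j ∘ affinePoint i) (affinePoint i ⁻¹' chartDomain j) := by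
  have key : ∀ k : Fin 4, ContDiff ℂ ω (fun z : C3 => (i.insertNth (1 : ℂ) z : Fin 4 → ℂ) k) := by
    intro k
    refine Fin.succAboveCases i ?_ (fun l => ?_) k
    · simpa using contDiff_const
    · simpa using contDiff_apply ℂ ℂ l
  refine contDiffOn_pi.2 fun l => ?_
  exact (key _).contDiffOn.div (key j).contDiffOn fun z hz => hz

/-- `ℂℙ³` is a complex (analytic) manifold. -/
instance instIsManifold : IsManifold 𝓘(ℂ, C3) ω CP3 :=
  isManifold_of_contDiffOn 𝓘(ℂ, C3) ω CP3 (by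
    rintro _ _ ⟨i, rfl⟩ ⟨j, rfl⟩
    refine (contDiffOn_transition i j).congr_mono (fun _ _ => rfl) ?_
    rintro z ⟨hz, -⟩
    exact hz.2)

/-- `ℂℙ³` is a real smooth manifold (of real dimension six). -/
instance instIsManifoldReal : IsManifold 𝓘(ℝ, C3) ∞ CP3 :=
  isManifold_of_contDiffOn 𝓘(ℝ, C3) ∞ CP3 (by
    rintro _ _ ⟨i, rfl⟩ ⟨j, rfl⟩
    refine (((contDiffOn_transition i j).restrict_scalars ℝ).of_le (by simp)).congr_mono
      (fun _ _ => rfl) ?_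
    rintro z ⟨hz, -⟩
    exact hz.2)

/-- A (complex projective) line: the set of points of `ℂℙ³` that lie in a two-dimensional complex
linear subspace of `ℂ⁴`. -/
def IsLine (L : Set CP3) : Prop :=
  ∃ W : Submodule ℂ (Fin 4 → ℂ), Module.finrank ℂ W = 2 ∧ L = {p : CP3 | p.submodule ≤ W}

/-- `φ` is a real smooth chart of `ℂℙ³`, defined near `x`, that flattens `M` onto the real linear
subspace `W` of `ℂ³ = ℝ⁶`. -/
def IsSliceChart (M : Set CP3) (x : CP3) (φ : OpenPartialHomeomorph CP3 C3)
    (W : Submodule ℝ C3) : Prop :=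
  φ ∈ IsManifold.maximalAtlas 𝓘(ℝ, C3) ∞ CP3 ∧ x ∈ φ.source ∧ ∀ y ∈ φ.source, y ∈ M ↔ φ y ∈ W

/-- `M` is an embedded smooth real submanifold of `ℂℙ³` of real dimension `k` (not necessarily
closed or connected). -/
def IsRealSubmanifold (k : ℕ) (M : Set CP3) : Prop :=
  ∀ x ∈ M, ∃ (φ : OpenPartialHomeomorph CP3 C3) (W : Submodule ℝ C3),
    IsSliceChart M x φ W ∧ Module.finrank ℝ W = k

/-- `Λ` is locally a finite union of real `k`-dimensional submanifolds: every point of `Λ` has an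
open neighbourhood `U` in which `Λ` is the union of finitely many embedded `k`-dimensional
submanifolds of `U`, each of them closed in `U`. -/
def IsLocallyFiniteUnionOfSubmanifolds (k : ℕ) (Λ : Set CP3) : Prop :=
  ∀ x ∈ Λ, ∃ U : Set CP3, IsOpen U ∧ x ∈ U ∧ ∃ 𝓜 : Set (Set CP3), 𝓜.Finite ∧
    (∀ M ∈ 𝓜, IsRealSubmanifold k M ∧ M ⊆ U ∧ closure M ∩ U ⊆ M) ∧ Λ ∩ U = ⋃₀ 𝓜

/-- `Λ` is foliated by lines. Through every point of `Λ` there is a line contained in `Λ`, and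
every three-dimensional submanifold `M` contained in `Λ` is smoothly foliated by open pieces of
lines contained in `Λ`: for each `x ∈ M`

* exactly one of the lines contained in `Λ` passes through `x` and lies in `M` near `x`
  (so if `Λ` itself is a submanifold, it is a disjoint union of lines);
* there is a foliated chart: a slice chart `φ` for `M` at `x` and a two-dimensional subspace `T`
  of the three-dimensional subspace `W = φ(M)` such that each plaque (the points of `M` in the
  domain of `φ` whose images lie in one translate of `T`) lies on a line contained in `Λ`. -/
def IsFoliatedByLines (Λ : Set CP3) : Prop :=
  (∀ x ∈ Λ, ∃ L, IsLine L ∧ x ∈ L ∧ L ⊆ Λ) ∧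
  ∀ M : Set CP3, IsRealSubmanifold 3 M → M ⊆ Λ → ∀ x ∈ M,
    (∃! L, IsLine L ∧ L ⊆ Λ ∧ x ∈ L ∧ ∀ᶠ y in 𝓝 x, y ∈ L → y ∈ M) ∧
    ∃ (φ : OpenPartialHomeomorph CP3 C3) (W T : Submodule ℝ C3),
      IsSliceChart M x φ W ∧ Module.finrank ℝ W = 3 ∧ T ≤ W ∧ Module.finrank ℝ T = 2 ∧
      ∀ y ∈ M ∩ φ.source, ∃ L, IsLine L ∧ L ⊆ Λ ∧
        ∀ z ∈ M ∩ φ.source, φ z - φ y ∈ T → z ∈ L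

/-- The open set `D ⊆ ℂℙ³` covers the complex threefold `X`: there is a holomorphic covering map,
that is, a surjective covering map `D → X` that is locally biholomorphic. -/
def Covers (D : TopologicalSpace.Opens CP3) (X : Type*) [TopologicalSpace X]
    [ChartedSpace C3 X] : Prop :=
  ∃ π : D → X, IsCoveringMap π ∧ Function.Surjective π ∧
    IsLocalDiffeomorph 𝓘(ℂ, C3) 𝓘(ℂ, C3) ω π

end CP3

/-! The covering transports lines. Let π : D → X be the covering and k < 4 the dimension of the
pieces of Λ. The planes through v₀ and 0 that meet the cone over Λ sweep out a subset of ℂ⁴ of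
Hausdorff dimension at most k + 4 < 8. Hence D is dense and each of its points lies on a line inside
D (`exists_line_subset`).

A line ℓ ⊂ D is simply connected, so π restricted to ℓ lifts to D starting at any point of the fibre
(`exists_lift_line`). The lift is again a line (`lift_line_eq`). Indeed it is given locally by
biholomorphisms g with π ∘ g = π, and such a g lifts to a homogeneous map Γ of ℂ⁴ with Jacobian
determinant one, whose derivative is unique up to a fourth root of unity. The entries of dΓ have
degree zero, so their products of degree four are well-defined holomorphic functions on ℓ ≅ ℂℙ¹,
hence constant by Liouville. Thus dΓ is constant along ℓ up to scalars, and Euler's identity Γ(u) =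
dΓ_u(u) makes g projective-linear on ℓ.

Now let points n of D tend to x ∈ Λ. By compactness of X, π(n) accumulates at some π(p'). Fix a line
in D through p'; the lines near it lie in D too and lift to lines through the points n, which
accumulate at a line through x. If that limit line met D, the lifts would converge in D there, and
by connectedness everywhere, also at the points n, although x ∉ D. So the limit line lies in Λ
(`exists_direction_compl`).

The rest is real differential geometry. A k-dimensional submanifold M ⊂ Λ contains all of Λ near a
dense set of its points, and there the lines of Λ run inside M
(`IsLocallyFiniteUnion.hasDenseLines`). For k = 2, M is locally the graph of a function that is
affine near a dense set of points; its second derivative vanishes identically, so M is locally a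
line, and compactness of Λ leaves finitely many. For k = 3, M is a graph of some U over ℂ × ℝ, and
the direction of the line is an explicit smooth function of dU. Its defining identities extend from
the dense set by continuity; a Grönwall estimate then keeps the direction constant along each line,
and the lines issuing from a transversal give the foliated chart (`IsSubmanifold.exists_foliation`).
-/

namespace CP3

open Filter

/-! ### Homogeneous coordinates and the Hausdorff property of ℂℙ³. -/

/-- The class of a vector of `ℂ⁴` (with a junk value at `0`). -/
noncomputable def pt (v : Fin 4 → ℂ) : CP3 :=
  open Classical in
  if h : v ≠ 0 then Projectivization.mk ℂ v h else
    Projectivization.mk ℂ (Fin.insertNth 0 (1 : ℂ) 0) (insertNth_one_ne_zero 0 0)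

theorem pt_of_ne {v : Fin 4 → ℂ} (h : v ≠ 0) : pt v = Projectivization.mk ℂ v h := dif_pos h

theorem pt_smul {c : ℂ} (hc : c ≠ 0) (v : Fin 4 → ℂ) : pt (c • v) = pt v := by
  by_cases h : v = 0
  · simp [h]
  · rw [pt_of_ne h, pt_of_ne (smul_ne_zero hc h), Projectivization.mk_eq_mk_iff']
    exact ⟨c, rfl⟩

theorem exists_pt_eq (p : CP3) : ∃ v, v ≠ 0 ∧ pt v = p := by
  induction p using Projectivization.ind with
  | h v hv => exact ⟨v, hv, pt_of_ne hv⟩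

theorem pt_eq_pt_iff {v w : Fin 4 → ℂ} (hv : v ≠ 0) (hw : w ≠ 0) :
    pt v = pt w ↔ ∃ c : ℂ, c ≠ 0 ∧ v = c • w := by
  rw [pt_of_ne hv, pt_of_ne hw, Projectivization.mk_eq_mk_iff']
  constructor
  · rintro ⟨c, rfl⟩
    exact ⟨c, by rintro rfl; simp at hv, rfl⟩
  · rintro ⟨c, -, rfl⟩
    exact ⟨c, rfl⟩

theorem continuousOn_pt : ContinuousOn pt {0}ᶜ := by
  rw [continuousOn_iff_continuous_domRestrict]
  have : (({0}ᶜ : Set (Fin 4 → ℂ)).domRestrict pt) =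
      (fun v : {v : Fin 4 → ℂ // v ≠ 0} => Projectivization.mk ℂ v.1 v.2) := by
    funext v
    exact pt_of_ne v.2
  rw [this]
  exact continuous_mk'

theorem continuousAt_pt {v : Fin 4 → ℂ} (h : v ≠ 0) : ContinuousAt pt v :=
  continuousOn_pt.continuousAt (isOpen_compl_singleton.mem_nhds h)

theorem affinePoint_eq_pt (i : Fin 4) (z : C3) :
    affinePoint i z = pt (i.insertNth (1 : ℂ) z : Fin 4 → ℂ) :=
  (pt_of_ne (insertNth_one_ne_zero i z)).symm

theorem pt_mem_chartDomain {i : Fin 4} {v : Fin 4 → ℂ} (hv : v i ≠ 0) : pt v ∈ chartDomain i := by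
  rw [pt_of_ne (fun h => hv (by simp [h]))]
  exact hv

theorem affineCoord_pt {i : Fin 4} {v : Fin 4 → ℂ} (hv : v ≠ 0) :
    affineCoord i (pt v) = fun j => v (i.succAbove j) / v i := by
  rw [pt_of_ne hv, affineCoord_mk]

theorem pt_mem_chartDomain_iff {i : Fin 4} {v : Fin 4 → ℂ} (h : v ≠ 0) :
    pt v ∈ chartDomain i ↔ v i ≠ 0 := by
  rw [pt_of_ne h]; rfl

/-- The Hermitian projection matrices separate the points. -/
noncomputable def projMatrix : CP3 → (Fin 4 → Fin 4 → ℂ) :=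
  Projectivization.lift
    (fun v : {v : Fin 4 → ℂ // v ≠ 0} => fun i j =>
      v.1 i * (starRingEnd ℂ) (v.1 j) / (∑ k, v.1 k * (starRingEnd ℂ) (v.1 k))) (by
    rintro ⟨a, ha⟩ ⟨b, hb⟩ t (rfl : a = t • b)
    have ht : t ≠ 0 := by rintro rfl; simp at ha
    have ht' : (starRingEnd ℂ) t ≠ 0 := by simpa using ht
    funext i j
    have : ∀ k l, (t • b) k * (starRingEnd ℂ) ((t • b) l) =
      (t * (starRingEnd ℂ) t) * (b k * (starRingEnd ℂ) (b l)) := by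
      intro k l
      simp only [Pi.smul_apply, smul_eq_mul, map_mul]
      ring
    simp only [this, ← Finset.mul_sum]
    rw [mul_div_mul_left _ _ (mul_ne_zero ht ht')])

theorem sum_mul_conj_ne_zero {v : Fin 4 → ℂ} (hv : v ≠ 0) :
    (∑ k, v k * (starRingEnd ℂ) (v k)) ≠ 0 := by
  have h : (∑ k, v k * (starRingEnd ℂ) (v k)) = ((∑ k, ‖v k‖ ^ 2 : ℝ) : ℂ) := by
    push_cast
    exact Finset.sum_congr rfl fun k _ => Complex.mul_conj' (v k)
  rw [h]
  obtain ⟨k, hk⟩ := Function.ne_iff.1 hv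
  have : 0 < ∑ k, ‖v k‖ ^ 2 :=
    Finset.sum_pos' (fun _ _ => by positivity) ⟨k, Finset.mem_univ _, by
      have := norm_pos_iff.2 hk
      positivity⟩
  exact_mod_cast this.ne'

theorem continuous_projMatrix : Continuous projMatrix := by
  rw [isQuotientMap_mk'.continuous_iff]
  refine continuous_pi fun i => continuous_pi fun j => ?_
  refine Continuous.div ?_ ?_ fun v => sum_mul_conj_ne_zero v.2
  · exact ((continuous_apply i).comp continuous_subtype_val).mul
      (Complex.continuous_conj.comp ((continuous_apply j).comp continuous_subtype_val))
  · exact continuous_finsetSum _ fun k _ => ((continuous_apply k).comp continuous_subtype_val).mul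
      (Complex.continuous_conj.comp ((continuous_apply k).comp continuous_subtype_val))

/-- A column of v v*/|v|² with v j ≠ 0 is a nonzero multiple of v, so the matrix determines the
point. -/
theorem injective_projMatrix : Function.Injective projMatrix := by
  intro p q h
  induction p using Projectivization.ind with
  | h v hv =>
  induction q using Projectivization.ind with
  | h w hw =>
    have h' : ∀ i j, v i * (starRingEnd ℂ) (v j) / (∑ k, v k * (starRingEnd ℂ) (v k)) =
        w i * (starRingEnd ℂ) (w j) / (∑ k, w k * (starRingEnd ℂ) (w k)) :=
      fun i j => congrFun (congrFun h i) j
    obtain ⟨j, hj⟩ := Function.ne_iff.1 hv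
    have hj' : (starRingEnd ℂ) (v j) ≠ 0 := by simpa using hj
    rw [Projectivization.mk_eq_mk_iff']
    refine ⟨(starRingEnd ℂ) (w j) / (∑ k, w k * (starRingEnd ℂ) (w k)) *
      (∑ k, v k * (starRingEnd ℂ) (v k)) / (starRingEnd ℂ) (v j), ?_⟩
    funext i
    have h1 := h' i j
    have hs := sum_mul_conj_ne_zero hv
    have hs' := sum_mul_conj_ne_zero hw
    simp only [Pi.smul_apply, smul_eq_mul]
    rw [div_eq_iff hs] at h1
    rw [div_mul_eq_mul_div, div_eq_iff hj', h1]
    ring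

instance instT2Space : T2Space CP3 :=
  T2Space.of_injective_continuous injective_projMatrix continuous_projMatrix

theorem contMDiffAt_affineCoord {i : Fin 4} {p : CP3} (hp : p ∈ chartDomain i) :
    ContMDiffAt 𝓘(ℂ, C3) 𝓘(ℂ, C3) ω (affineCoord i) p :=
  contMDiffAt_of_mem_maximalAtlas (e := affineChart i)
    (IsManifold.subset_maximalAtlas (mem_range_self i)) hp

theorem contMDiffAt_affinePoint (i : Fin 4) (z : C3) :
    ContMDiffAt 𝓘(ℂ, C3) 𝓘(ℂ, C3) ω (affinePoint i) z :=
  contMDiffAt_symm_of_mem_maximalAtlas (e := affineChart i)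
    (IsManifold.subset_maximalAtlas (mem_range_self i)) (mem_univ _)

/-! ### Local biholomorphisms commuting with the covering. -/

section Rel

variable {D : TopologicalSpace.Opens CP3} {X : Type*}

/-- Two points of `D` with the same image. -/
def Rel (π : D → X) (p q : CP3) : Prop := ∃ (hp : p ∈ D) (hq : q ∈ D), π ⟨p, hp⟩ = π ⟨q, hq⟩

theorem Rel.symm {π : D → X} {p q : CP3} (h : Rel π p q) : Rel π q p :=
  ⟨h.2.1, h.1, h.2.2.symm⟩

theorem Rel.trans {π : D → X} {p q r : CP3} (h : Rel π p q) (h' : Rel π q r) : Rel π p r :=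
  ⟨h.1, h'.2.1, h.2.2.trans h'.2.2⟩

theorem Rel.left_mem {π : D → X} {p q : CP3} (h : Rel π p q) : p ∈ D := h.1

theorem Rel.right_mem {π : D → X} {p q : CP3} (h : Rel π p q) : q ∈ D := h.2.1

variable [TopologicalSpace X]

/-- The uniqueness principle used throughout: two points of one fibre that are both close to `q`
coincide. -/
theorem exists_nhds_rel_eq {π : D → X} (hπ : IsLocalHomeomorph π) {q : CP3} (hq : q ∈ D) :
    ∃ N ∈ 𝓝 q, ∀ a ∈ N, ∀ b ∈ N, Rel π a b → a = b := by
  obtain ⟨e, hqe, rfl⟩ := hπ ⟨q, hq⟩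
  refine ⟨Subtype.val '' e.source,
    (D.isOpen.isOpenEmbedding_subtypeVal.isOpenMap _ e.open_source).mem_nhds ⟨_, hqe, rfl⟩, ?_⟩
  rintro _ ⟨a, ha, rfl⟩ _ ⟨b, hb, rfl⟩ ⟨_, _, h⟩
  exact congrArg _ (e.injOn ha hb h)

variable [ChartedSpace C3 X]

/-- The germ is the local inverse of π at `q`, composed with π. Its value off `D` is irrelevant
because `D` is open. -/
theorem exists_local_section {π : D → X} (hπ : IsLocalDiffeomorph 𝓘(ℂ, C3) 𝓘(ℂ, C3) ω π)
    {p q : CP3} (h : Rel π p q) :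
    ∃ g : CP3 → CP3, ContMDiffAt 𝓘(ℂ, C3) 𝓘(ℂ, C3) ω g p ∧ g p = q ∧
      ∀ᶠ a in 𝓝 p, Rel π a (g a) := by
  classical
  obtain ⟨hp, hq, hpq⟩ := h
  have hloc := hπ ⟨q, hq⟩
  refine ⟨fun a => if ha : a ∈ D then (hloc.localInverse (π ⟨a, ha⟩)).1 else a, ?_, ?_, ?_⟩
  · have : ContMDiffAt 𝓘(ℂ, C3) 𝓘(ℂ, C3) ω (fun a : D => (hloc.localInverse (π a)).1) ⟨p, hp⟩ := by
      refine ContMDiffAt.comp _ (contMDiff_subtype_val.contMDiffAt) ?_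
      refine ContMDiffAt.comp _ ?_ (hπ.contMDiff.contMDiffAt)
      rw [hpq]
      exact hloc.localInverse_contMDiffAt
    rw [← contMDiffAt_subtype_iff (U := D) (x := ⟨p, hp⟩)]
    refine this.congr_of_eventuallyEq (Eventually.of_forall fun a => ?_)
    simp
  · simp only [hp, dif_pos]
    rw [hpq, hloc.localInverse_left_inv hloc.localInverse_mem_target]
  · have h1 : ∀ᶠ a : D in 𝓝 ⟨p, hp⟩, π a ∈ hloc.localInverse.source := by
      refine hπ.contMDiff.continuous.continuousAt.eventually ?_
      refine hloc.localInverse.open_source.mem_nhds ?_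
      rw [hpq]
      exact hloc.localInverse_mem_source
    rw [← map_nhds_subtype_coe_eq_nhds hp (D.isOpen.mem_nhds hp), eventually_map]
    filter_upwards [h1] with a ha
    simp only [a.2, dif_pos]
    exact ⟨a.2, Subtype.coe_prop _, (hloc.localInverse_right_inv ha).symm⟩

theorem exists_analytic_section {π : D → X} (hπ : IsLocalDiffeomorph 𝓘(ℂ, C3) 𝓘(ℂ, C3) ω π)
    {j i : Fin 4} {z w : C3} (h : Rel π (affinePoint j z) (affinePoint i w)) :
    ∃ G : C3 → C3, AnalyticAt ℂ G z ∧ G z = w ∧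
      ∀ᶠ a in 𝓝 z, Rel π (affinePoint j a) (affinePoint i (G a)) := by
  obtain ⟨g, hg, hgp, hrel⟩ := exists_local_section hπ h
  have hcont : ContinuousAt (fun a => g (affinePoint j a)) z :=
    hg.continuousAt.comp (continuous_affinePoint j).continuousAt
  have hmem : ∀ᶠ a in 𝓝 z, g (affinePoint j a) ∈ chartDomain i := by
    refine hcont.eventually ((isOpen_chartDomain i).mem_nhds ?_)
    simp only [hgp]
    exact affinePoint_mem i w
  refine ⟨fun a => affineCoord i (g (affinePoint j a)), ?_, ?_, ?_⟩
  · have : ContMDiffAt 𝓘(ℂ, C3) 𝓘(ℂ, C3) ω (fun a => affineCoord i (g (affinePoint j a))) z := by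
      refine ContMDiffAt.comp (g := affineCoord i) z (contMDiffAt_affineCoord hmem.self_of_nhds) ?_
      exact ContMDiffAt.comp (g := g) z hg (contMDiffAt_affinePoint j z)
    rw [contMDiffAt_iff_contDiffAt] at this
    exact this.analyticAt
  · simp only [hgp, affineCoord_affinePoint]
  · filter_upwards [hmem, (continuous_affinePoint j).continuousAt.eventually hrel] with a ha hr
    rw [affinePoint_affineCoord i ha]
    exact hr

end Rel

end CP3

namespace CP3

open Filter

/-- The vector space `ℂ⁴`. -/
abbrev C4 : Type := Fin 4 → ℂ

/-! ### Homogeneous maps of ℂ⁴ and their Jacobians. -/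

section Homogeneous

/-- Homogeneity of degree one. -/
def IsHomogeneousMap (Γ : C4 → C4) : Prop := ∀ μ : ℂ, μ ≠ 0 → ∀ u, Γ (μ • u) = μ • Γ u

theorem IsHomogeneousMap.hasFDerivAt_smul {Γ : C4 → C4} (h : IsHomogeneousMap Γ) {μ : ℂ}
    (hμ : μ ≠ 0) {u : C4} {A : C4 →L[ℂ] C4} (hA : HasFDerivAt Γ A u) :
    HasFDerivAt Γ A (μ • u) := by
  have h1 : Γ = fun x => μ • Γ (μ⁻¹ • x) := by
    funext x
    rw [← h μ hμ, smul_inv_smul₀ hμ]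
  have h2 : HasFDerivAt (fun x : C4 => μ⁻¹ • x) (μ⁻¹ • ContinuousLinearMap.id ℂ C4) (μ • u) :=
    (μ⁻¹ • ContinuousLinearMap.id ℂ C4).hasFDerivAt
  have h3 : HasFDerivAt Γ A ((fun x : C4 => μ⁻¹ • x) (μ • u)) := by
    simpa [inv_smul_smul₀ hμ] using hA
  have h4 := (h3.comp (μ • u) h2).const_smul μ
  refine (h4.congr_fderiv ?_).congr_of_eventuallyEq (Eventually.of_forall fun x => congrFun h1 x)
  ext x
  simp [hμ]

theorem IsHomogeneousMap.fderiv_smul {Γ : C4 → C4} (h : IsHomogeneousMap Γ) {μ : ℂ}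
    (hμ : μ ≠ 0) (u : C4) : fderiv ℂ Γ (μ • u) = fderiv ℂ Γ u := by
  by_cases hd : DifferentiableAt ℂ Γ u
  · exact (h.hasFDerivAt_smul hμ hd.hasFDerivAt).fderiv
  · rw [fderiv_zero_of_not_differentiableAt hd, fderiv_zero_of_not_differentiableAt]
    intro hd'
    apply hd
    have := (h.hasFDerivAt_smul (inv_ne_zero hμ) hd'.hasFDerivAt).differentiableAt
    rwa [inv_smul_smul₀ hμ] at this

theorem hasDerivAt_smul_left (u : C4) (t : ℂ) : HasDerivAt (fun μ : ℂ => μ • u) u t := by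
  simpa using (hasDerivAt_id t).smul_const u

/-- Euler's identity: differentiate Γ(μu) = μΓ(u) at μ = 1. It recovers Γ from its derivative. -/
theorem IsHomogeneousMap.fderiv_self {Γ : C4 → C4} (h : IsHomogeneousMap Γ) {u : C4}
    (hd : DifferentiableAt ℂ Γ u) : fderiv ℂ Γ u u = Γ u := by
  have h1 : HasDerivAt (fun μ : ℂ => Γ (μ • u)) (fderiv ℂ Γ u u) 1 := by
    have h3 : HasFDerivAt Γ (fderiv ℂ Γ u) ((1 : ℂ) • u) := by simpa using hd.hasFDerivAt
    exact h3.comp_hasDerivAt (1 : ℂ) (hasDerivAt_smul_left u 1)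
  have h2 : HasDerivAt (fun μ : ℂ => Γ (μ • u)) (Γ u) 1 := by
    refine (hasDerivAt_smul_left (Γ u) 1).congr_of_eventuallyEq ?_
    filter_upwards [isOpen_ne.mem_nhds (one_ne_zero (α := ℂ))] with μ hμ
    exact h μ hμ u
  exact h1.unique h2

theorem fderiv_self_eq_zero {c : C4 → ℂ} (h : ∀ μ : ℂ, μ ≠ 0 → ∀ u, c (μ • u) = c u) {u : C4}
    (hd : DifferentiableAt ℂ c u) : fderiv ℂ c u u = 0 := by
  have h1 : HasDerivAt (fun μ : ℂ => c (μ • u)) (fderiv ℂ c u u) 1 := by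
    have h3 : HasFDerivAt c (fderiv ℂ c u) ((1 : ℂ) • u) := by simpa using hd.hasFDerivAt
    exact h3.comp_hasDerivAt (1 : ℂ) (hasDerivAt_smul_left u 1)
  have h2 : HasDerivAt (fun μ : ℂ => c (μ • u)) 0 1 := by
    refine (hasDerivAt_const (1 : ℂ) (c u)).congr_of_eventuallyEq ?_
    filter_upwards [isOpen_ne.mem_nhds (one_ne_zero (α := ℂ))] with μ hμ
    exact h μ hμ u
  exact h1.unique h2

/-- The map is c times a transvection, and `f u = 0` gives the latter determinant one. The exponent
is the dimension of ℂ⁴ and is the origin of the fourth roots of unity below. -/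
theorem det_smul_add_smulRight {c : ℂ} (hc : c ≠ 0) (f : C4 →L[ℂ] ℂ) (u : C4) (hf : f u = 0) :
    LinearMap.det ((c • ContinuousLinearMap.id ℂ C4 + f.smulRight u : C4 →L[ℂ] C4) : C4 →ₗ[ℂ] C4)
      = c ^ 4 := by
  have : ((c • ContinuousLinearMap.id ℂ C4 + f.smulRight u : C4 →L[ℂ] C4) : C4 →ₗ[ℂ] C4) =
      c • LinearMap.transvection (c⁻¹ • (f : C4 →ₗ[ℂ] ℂ)) u := by
    ext x
    simp [LinearMap.transvection, mul_add]
    field_simp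
  rw [this, LinearMap.det_smul, LinearMap.transvection.det]
  simp [hf]

/-- The Jacobian determinant of `Γ`. -/
noncomputable def jac (Γ : C4 → C4) (u : C4) : ℂ := LinearMap.det (fderiv ℂ Γ u : C4 →ₗ[ℂ] C4)

theorem IsHomogeneousMap.fderiv_smul_fun {Γ : C4 → C4} (h : IsHomogeneousMap Γ) {c : C4 → ℂ}
    {u : C4} (hd : DifferentiableAt ℂ Γ u) (hc : DifferentiableAt ℂ c u) :
    fderiv ℂ (fun x => c x • Γ x) u =
      (fderiv ℂ Γ u).comp (c u • ContinuousLinearMap.id ℂ C4 + (fderiv ℂ c u).smulRight u) := by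
  rw [fderiv_fun_smul hc hd]
  ext1 x
  simp [h.fderiv_self hd]

/-- No derivative of `c` survives, since a function of degree zero is constant in the direction `u`.
Hence a fourth root of the inverse Jacobian normalises the Jacobian to one. -/
theorem IsHomogeneousMap.jac_smul_fun {Γ : C4 → C4} (h : IsHomogeneousMap Γ) {c : C4 → ℂ}
    {u : C4} (hd : DifferentiableAt ℂ Γ u) (hc : DifferentiableAt ℂ c u) (hcu : c u ≠ 0)
    (hom : ∀ μ : ℂ, μ ≠ 0 → ∀ u, c (μ • u) = c u) :
    jac (fun x => c x • Γ x) u = c u ^ 4 * jac Γ u := by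
  rw [jac, h.fderiv_smul_fun hd hc, ContinuousLinearMap.toLinearMap_comp, LinearMap.det_comp,
    det_smul_add_smulRight hcu _ _ (fderiv_self_eq_zero hom hc), mul_comm, jac]

theorem analyticAt_jac {Γ : C4 → C4} {w : C4} (h : AnalyticAt ℂ Γ w) :
    AnalyticAt ℂ (jac Γ) w := by
  have h1 : jac Γ = fun u => ∑ σ : Equiv.Perm (Fin 4), ((Equiv.Perm.sign σ : ℤ) : ℂ) *
      ∏ i, fderiv ℂ Γ u (Pi.single i 1) (σ i) := by
    funext u
    rw [jac, ← LinearMap.det_toMatrix', Matrix.det_apply']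
    refine Finset.sum_congr rfl fun σ _ => ?_
    simp [LinearMap.toMatrix'_apply]
  rw [h1]
  refine Finset.analyticAt_fun_sum _ fun σ _ => analyticAt_const.mul ?_
  refine Finset.analyticAt_fun_prod _ fun i _ => ?_
  have h2 : AnalyticAt ℂ (fun u => (ContinuousLinearMap.proj (R := ℂ) (φ := fun _ : Fin 4 => ℂ)
      (σ i)).comp (ContinuousLinearMap.apply ℂ C4 (Pi.single i 1)) (fderiv ℂ Γ u)) w :=
    (ContinuousLinearMap.analyticAt _ _).comp h.fderiv
  exact h2

end Homogeneous

/-! ### Unimodular lifts and their uniqueness. -/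

section Lift

variable {D : TopologicalSpace.Opens CP3} {X : Type*}

/-- `Γ` is homogeneous and of Jacobian determinant one near `w`, and lifts to `ℂ⁴` a local map
`g` of `ℂℙ³` with `π ∘ g = π` and `g [w] = q`. -/
structure IsUnimodularLift (π : D → X) (w : C4) (q : CP3) (Γ : C4 → C4) : Prop where
  homog : IsHomogeneousMap Γ
  analytic : AnalyticAt ℂ Γ w
  ne_zero : Γ w ≠ 0
  rel : ∀ᶠ u in 𝓝 w, Rel π (pt u) (pt (Γ u))
  jac_eq : ∀ᶠ u in 𝓝 w, jac Γ u = 1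
  pt_eq : pt (Γ w) = q

variable {π : D → X} {w : C4} {q : CP3} {Γ Γ' : C4 → C4}

theorem IsUnimodularLift.eventually (h : IsUnimodularLift π w q Γ) :
    ∀ᶠ u in 𝓝 w, IsUnimodularLift π u (pt (Γ u)) Γ := by
  filter_upwards [h.analytic.eventually_analyticAt,
    h.analytic.continuousAt.eventually_ne h.ne_zero, h.rel.eventually_nhds,
    h.jac_eq.eventually_nhds] with u h1 h2 h3 h4
  exact ⟨h.homog, h1, h2, h3, h4, rfl⟩

theorem IsUnimodularLift.smul (h : IsUnimodularLift π w q Γ) {μ : ℂ} (hμ : μ ≠ 0) :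
    IsUnimodularLift π (μ • w) q Γ := by
  have hcont : Tendsto (fun u : C4 => μ⁻¹ • u) (𝓝 (μ • w)) (𝓝 w) := by
    have : ContinuousAt (fun u : C4 => μ⁻¹ • u) (μ • w) := by fun_prop
    rw [ContinuousAt, inv_smul_smul₀ hμ] at this
    exact this
  have hΓ : ∀ u, Γ u = μ • Γ (μ⁻¹ • u) := fun u => by
    rw [← h.homog μ hμ, smul_inv_smul₀ hμ]
  refine ⟨h.homog, ?_, ?_, ?_, ?_, ?_⟩
  · have h1 : AnalyticAt ℂ (fun u => μ • Γ (μ⁻¹ • u)) (μ • w) := by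
      have h2 : AnalyticAt ℂ Γ ((μ⁻¹ • ContinuousLinearMap.id ℂ C4) (μ • w)) := by
        simpa [smul_inv_smul₀ hμ, inv_smul_smul₀ hμ] using h.analytic
      exact (h2.comp ((μ⁻¹ • ContinuousLinearMap.id ℂ C4).analyticAt _)).const_smul (c := μ)
    exact h1.congr (Eventually.of_forall fun u => (hΓ u).symm)
  · rw [h.homog μ hμ]
    exact smul_ne_zero hμ h.ne_zero
  · filter_upwards [hcont.eventually h.rel] with u hu
    rw [hΓ u, pt_smul hμ]
    rwa [pt_smul (inv_ne_zero hμ)] at hu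
  · filter_upwards [hcont.eventually h.jac_eq] with u hu
    rw [← hu, jac, jac, h.homog.fderiv_smul (inv_ne_zero hμ)]
  · rw [h.homog μ hμ, pt_smul hμ, h.pt_eq]

theorem IsUnimodularLift.injective (h : IsUnimodularLift π w q Γ) :
    Function.Injective (fderiv ℂ Γ w) := by
  have h1 : LinearMap.det (fderiv ℂ Γ w : C4 →ₗ[ℂ] C4) ≠ 0 := by
    rw [show LinearMap.det (fderiv ℂ Γ w : C4 →ₗ[ℂ] C4) = 1 from h.jac_eq.self_of_nhds]
    exact one_ne_zero
  exact LinearEquiv.injective (LinearMap.equivOfDetNeZero _ h1)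

/-- Both lifts represent the same germ of ℂℙ³, hence differ by a scalar function `c` of degree zero.
Comparing Jacobians gives c⁴ = 1 near `w`, so `c` does not contribute to the derivative. -/
theorem IsUnimodularLift.fderiv_eq [TopologicalSpace X] (hπ : IsLocalHomeomorph π)
    (h : IsUnimodularLift π w q Γ)
    (h' : IsUnimodularLift π w q Γ') :
    ∃ c : ℂ, c ^ 4 = 1 ∧ fderiv ℂ Γ' w = c • fderiv ℂ Γ w := by
  have hqD : q ∈ D := by
    have := h.rel.self_of_nhds.right_mem
    rwa [h.pt_eq] at this
  obtain ⟨N, hN, hNinj⟩ := exists_nhds_rel_eq hπ hqD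
  obtain ⟨a, ha⟩ := Function.ne_iff.1 h.ne_zero
  have ha' : ∀ᶠ u in 𝓝 w, Γ u a ≠ 0 :=
    ((continuous_apply a).continuousAt.comp h.analytic.continuousAt).eventually_ne ha
  have hpt : ∀ {F : C4 → C4}, IsUnimodularLift π w q F → ∀ᶠ u in 𝓝 w, pt (F u) ∈ N := by
    intro F hF
    have : ContinuousAt (fun u => pt (F u)) w := (continuousAt_pt hF.ne_zero).comp hF.analytic.continuousAt
    refine this.eventually ?_
    simp only [hF.pt_eq]
    exact hN
  set c : C4 → ℂ := fun u => Γ' u a / Γ u a with hc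
  have hhom : ∀ μ : ℂ, μ ≠ 0 → ∀ u, c (μ • u) = c u := by
    intro μ hμ u
    simp only [hc, h.homog μ hμ, h'.homog μ hμ, Pi.smul_apply, smul_eq_mul,
      mul_div_mul_left _ _ hμ]
  have heq : ∀ᶠ u in 𝓝 w, Γ' u = c u • Γ u ∧ c u ≠ 0 := by
    filter_upwards [hpt h, hpt h', h.rel, h'.rel, ha',
      h.analytic.continuousAt.eventually_ne h.ne_zero,
      h'.analytic.continuousAt.eventually_ne h'.ne_zero] with u h1 h2 h3 h4 h5 h6 h7
    have h8 := hNinj _ h2 _ h1 (h4.symm.trans h3)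
    obtain ⟨d, hd0, hd⟩ := (pt_eq_pt_iff h7 h6).1 h8
    have : c u = d := by
      simp only [hc, hd, Pi.smul_apply, smul_eq_mul]
      field_simp
    rw [this]
    exact ⟨hd, hd0⟩
  have hproj : ∀ {F : C4 → C4}, IsUnimodularLift π w q F → AnalyticAt ℂ (fun u => F u a) w := by
    intro F hF
    exact ((ContinuousLinearMap.proj (R := ℂ) (φ := fun _ : Fin 4 => ℂ) a).analyticAt _).comp
      hF.analytic
  have hcan : AnalyticAt ℂ c w := (hproj h').div (hproj h) ha
  have hc4 : ∀ᶠ u in 𝓝 w, c u ^ 4 = 1 := by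
    filter_upwards [heq.eventually_nhds, h.jac_eq, h'.jac_eq, hcan.eventually_analyticAt,
      h.analytic.eventually_analyticAt] with u h1 h2 h3 h4 h5
    have h6 : fderiv ℂ Γ' u = fderiv ℂ (fun x => c x • Γ x) u :=
      Filter.EventuallyEq.fderiv_eq (h1.mono fun x hx => hx.1)
    have h7 := h.homog.jac_smul_fun h5.differentiableAt h4.differentiableAt
      h1.self_of_nhds.2 hhom
    rw [jac, ← h6] at h7
    rw [jac] at h3
    rw [h3, h2, mul_one] at h7
    exact h7.symm
  -- The derivative 4c³ dc of the constant function c⁴ vanishes, while c ≠ 0.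
  have hdc : fderiv ℂ c w = 0 := by
    have h1 : HasFDerivAt (fun u => c u ^ 4) ((4 * c w ^ 3) • fderiv ℂ c w) w := by
      have := hcan.differentiableAt.hasFDerivAt.pow 4
      simpa using this
    have h2 : HasFDerivAt (fun u => c u ^ 4) (0 : C4 →L[ℂ] ℂ) w :=
      (hasFDerivAt_const (1 : ℂ) w).congr_of_eventuallyEq hc4
    have h3 := h1.unique h2
    have h4 : (4 * c w ^ 3) ≠ 0 := by
      exact mul_ne_zero (by norm_num) (pow_ne_zero _ heq.self_of_nhds.2)
    exact (smul_eq_zero.1 h3).resolve_left h4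
  refine ⟨c w, hc4.self_of_nhds, ?_⟩
  have h6 : fderiv ℂ Γ' w = fderiv ℂ (fun x => c x • Γ x) w :=
      Filter.EventuallyEq.fderiv_eq (heq.mono fun x hx => hx.1)
  rw [h6, h.homog.fderiv_smul_fun h.analytic.differentiableAt hcan.differentiableAt, hdc]
  ext1 x
  simp

end Lift

end CP3

namespace CP3

open Filter

/-! ### Existence of unimodular lifts. -/

section Existence

variable {D : TopologicalSpace.Opens CP3} {X : Type*}

/-- The affine coordinates of a vector. -/
noncomputable def aff (j : Fin 4) (u : C4) : C3 := fun l => u (j.succAbove l) / u j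

theorem aff_smul (j : Fin 4) {μ : ℂ} (hμ : μ ≠ 0) (u : C4) : aff j (μ • u) = aff j u := by
  funext l
  simp [aff, mul_div_mul_left _ _ hμ]

theorem affinePoint_aff {j : Fin 4} {u : C4} (hu : u j ≠ 0) : affinePoint j (aff j u) = pt u := by
  have h0 : u ≠ 0 := fun h => hu (by simp [h])
  have := affinePoint_affineCoord j (pt_mem_chartDomain hu)
  rwa [affineCoord_pt h0] at this

theorem analyticAt_apply (a : Fin 4) (w : C4) : AnalyticAt ℂ (fun u : C4 => u a) w :=
  (ContinuousLinearMap.proj (R := ℂ) (φ := fun _ : Fin 4 => ℂ) a).analyticAt w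

theorem hasFDerivAt_apply_C4 (a : Fin 4) (w : C4) :
    HasFDerivAt (fun u : C4 => u a)
      (ContinuousLinearMap.proj (R := ℂ) (φ := fun _ : Fin 4 => ℂ) a) w :=
  (ContinuousLinearMap.proj (R := ℂ) (φ := fun _ : Fin 4 => ℂ) a).hasFDerivAt

theorem analyticAt_aff {j : Fin 4} {w : C4} (hw : w j ≠ 0) : AnalyticAt ℂ (aff j) w :=
  AnalyticAt.pi fun _ => (analyticAt_apply _ w).div (analyticAt_apply _ w) hw

/-- The homogeneous map of `ℂ⁴` given by a map `G` in affine coordinates. -/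
noncomputable def homogenize (j i : Fin 4) (G : C3 → C3) (u : C4) : C4 :=
  u j • (i.insertNth (1 : ℂ) (G (aff j u)) : C4)

theorem isHomogeneousMap_homogenize (j i : Fin 4) (G : C3 → C3) :
    IsHomogeneousMap (homogenize j i G) := by
  intro μ hμ u
  simp [homogenize, aff_smul j hμ, mul_smul]

theorem pt_homogenize {j i : Fin 4} {G : C3 → C3} {u : C4} (hu : u j ≠ 0) :
    pt (homogenize j i G u) = affinePoint i (G (aff j u)) := by
  rw [homogenize, pt_smul hu, affinePoint_eq_pt]

theorem analyticAt_homogenize {j i : Fin 4} {G : C3 → C3} {w : C4} (hw : w j ≠ 0)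
    (hG : AnalyticAt ℂ G (aff j w)) : AnalyticAt ℂ (homogenize j i G) w := by
  have h1 : AnalyticAt ℂ (fun u => G (aff j u)) w := hG.comp (analyticAt_aff hw)
  refine AnalyticAt.pi fun a => ?_
  refine Fin.succAboveCases i ?_ (fun l => ?_) a
  · simpa [homogenize] using analyticAt_apply j w
  · have h2 : AnalyticAt ℂ (fun u => G (aff j u) l) w :=
      ((ContinuousLinearMap.proj (R := ℂ) (φ := fun _ : Fin 3 => ℂ) l).analyticAt _).comp h1
    exact ((analyticAt_apply j w).mul h2).congr
      (Eventually.of_forall fun u => by simp [homogenize])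

/-- The homogenization carries u_j in slot `i` and u_j·G in the others, so a kernel vector has zero
`j`-th entry, then is killed by the derivative of G ∘ `aff j`, then of `aff j`. -/
theorem injective_fderiv_homogenize {j i : Fin 4} {G : C3 → C3} {w : C4} (hw : w j ≠ 0)
    (hG : AnalyticAt ℂ G (aff j w)) (hinj : Function.Injective (fderiv ℂ G (aff j w))) :
    Function.Injective (fderiv ℂ (homogenize j i G) w) := by
  have h1 : HasFDerivAt (fun u => G (aff j u))
      ((fderiv ℂ G (aff j w)).comp (fderiv ℂ (aff j) w)) w :=
    hG.differentiableAt.hasFDerivAt.comp w (analyticAt_aff hw).differentiableAt.hasFDerivAt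
  have hΓ := (analyticAt_homogenize (i := i) hw hG).differentiableAt.hasFDerivAt
  rw [injective_iff_map_eq_zero]
  intro x hx
  have hi : x j = 0 := by
    have h2 := (hasFDerivAt_pi'.1 hΓ i).unique
      ((hasFDerivAt_apply_C4 j w).congr_of_eventuallyEq
        (Eventually.of_forall fun u => by simp [homogenize]))
    have h3 := DFunLike.congr_fun h2 x
    simpa [hx] using h3.symm
  have hG0 : fderiv ℂ G (aff j w) (fderiv ℂ (aff j) w x) = 0 := by
    funext l
    have h2 := (hasFDerivAt_pi'.1 hΓ (i.succAbove l)).unique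
      (((hasFDerivAt_apply_C4 j w).mul (hasFDerivAt_pi'.1 h1 l)).congr_of_eventuallyEq
        (Eventually.of_forall fun u => by simp [homogenize]))
    have h3 := DFunLike.congr_fun h2 x
    simpa [hx, hi, hw] using h3
  have haff : fderiv ℂ (aff j) w x = 0 := by
    rw [injective_iff_map_eq_zero] at hinj
    exact hinj _ hG0
  funext a
  refine Fin.succAboveCases j hi (fun l => ?_) a
  have h4 := (analyticAt_aff hw).differentiableAt.hasFDerivAt
  have h2 := (hasFDerivAt_apply_C4 (j.succAbove l) w).unique
      (((hasFDerivAt_apply_C4 j w).mul (hasFDerivAt_pi'.1 h4 l)).congr_of_eventuallyEq (by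
        filter_upwards [(analyticAt_apply j w).continuousAt.eventually_ne hw] with u hu
        simp [aff, mul_div_cancel₀ _ hu]))
  have h3 := DFunLike.congr_fun h2 x
  simpa [haff, hi] using h3

variable [TopologicalSpace X] [ChartedSpace C3 X]

theorem exists_isUnimodularLift {π : D → X} (hπ : IsLocalDiffeomorph 𝓘(ℂ, C3) 𝓘(ℂ, C3) ω π)
    {w : C4} (hw : w ≠ 0) {q : CP3} (h : Rel π (pt w) q) : ∃ Γ, IsUnimodularLift π w q Γ := by
  obtain ⟨j, hj⟩ : ∃ j, w j ≠ 0 := Function.ne_iff.1 hw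
  obtain ⟨i, hi⟩ := exists_mem_chartDomain q
  have hq := affinePoint_affineCoord i hi
  rw [← affinePoint_aff hj, ← hq] at h
  obtain ⟨G, hG, hGz, hGrel⟩ := exists_analytic_section hπ h
  obtain ⟨G', hG', hGz', hGrel'⟩ := exists_analytic_section hπ h.symm
  obtain ⟨N, hN, hNinj⟩ := exists_nhds_rel_eq hπ.isLocalHomeomorph h.left_mem
  have hcG : Tendsto G (𝓝 (aff j w)) (𝓝 (affineCoord i q)) := by
    have := hG.continuousAt
    rwa [ContinuousAt, hGz] at this
  have hcG' : Tendsto (fun a => G' (G a)) (𝓝 (aff j w)) (𝓝 (aff j w)) := by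
    have := hG'.continuousAt
    rw [ContinuousAt, hGz'] at this
    exact this.comp hcG
  -- G' ∘ G stays in the fibre and close to the starting point, so it is the identity.
  have hid : (fun a => G' (G a)) =ᶠ[𝓝 (aff j w)] id := by
    have hcp : Tendsto (affinePoint j) (𝓝 (aff j w)) (𝓝 (affinePoint j (aff j w))) :=
      (continuous_affinePoint j).continuousAt
    filter_upwards [hcG.eventually hGrel', hGrel, hcp.eventually hN,
      (hcp.comp hcG').eventually hN] with a h1 h2 h3 h4
    have := hNinj _ h4 _ h3 (h2.trans h1).symm
    have h5 := congrArg (affineCoord j) this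
    simpa [affineCoord_affinePoint] using h5
  have hinj : Function.Injective (fderiv ℂ G (aff j w)) := by
    have h1 : HasFDerivAt G' (fderiv ℂ G' (G (aff j w))) (G (aff j w)) := by
      rw [hGz]
      exact hG'.differentiableAt.hasFDerivAt
    have h2 := h1.comp _ hG.differentiableAt.hasFDerivAt
    have h3 := h2.unique ((hasFDerivAt_id _).congr_of_eventuallyEq hid)
    have h4 : ∀ x, fderiv ℂ G' (G (aff j w)) (fderiv ℂ G (aff j w) x) = x :=
      fun x => DFunLike.congr_fun h3 x
    exact Function.LeftInverse.injective h4
  set Γ := homogenize j i G with hΓdef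
  have hΓhom : IsHomogeneousMap Γ := isHomogeneousMap_homogenize j i G
  have hΓan : AnalyticAt ℂ Γ w := analyticAt_homogenize hj hG
  have hjac : jac Γ w ≠ 0 := by
    have h1 := injective_fderiv_homogenize (i := i) hj hG hinj
    intro h0
    have h2 := LinearMap.bot_lt_ker_of_det_eq_zero h0
    rw [LinearMap.ker_eq_bot.2 h1] at h2
    exact lt_irrefl _ h2
  set κ : ℂ := (jac Γ w)⁻¹ ^ (1 / 4 : ℂ) with hκ
  have hκ4 : κ ^ 4 = (jac Γ w)⁻¹ := by
    rw [hκ, ← Complex.cpow_mul_nat]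
    norm_num
  have hκ0 : κ ≠ 0 := by
    intro h0
    rw [h0] at hκ4
    exact inv_ne_zero hjac (by rw [← hκ4]; norm_num)
  -- Dividing by the value at `w` keeps the base of the power near 1, where the principal branch is
  -- analytic; κ supplies the fourth root at `w` itself.
  set c : C4 → ℂ := fun u => κ * (jac Γ u / jac Γ w) ^ (-1 / 4 : ℂ) with hc
  have hchom : ∀ μ : ℂ, μ ≠ 0 → ∀ u, c (μ • u) = c u := by
    intro μ hμ u
    simp only [hc, jac, hΓhom.fderiv_smul hμ]
  have hjan : AnalyticAt ℂ (fun u => jac Γ u / jac Γ w) w := (analyticAt_jac hΓan).div_const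
  have hcan : AnalyticAt ℂ c w := by
    refine analyticAt_const.mul (hjan.cpow analyticAt_const ?_)
    simp [hjac]
  have hj0 : ∀ᶠ u in 𝓝 w, jac Γ u ≠ 0 := (analyticAt_jac hΓan).continuousAt.eventually_ne hjac
  have hc4 : ∀ u, jac Γ u ≠ 0 → c u ^ 4 = (jac Γ u)⁻¹ := by
    intro u hu
    rw [hc]
    simp only [mul_pow]
    rw [hκ4, ← Complex.cpow_mul_nat, show (-1 / 4 : ℂ) * (4 : ℕ) = -1 by norm_num,
      Complex.cpow_neg_one]
    field_simp
  have hc0 : ∀ u, jac Γ u ≠ 0 → c u ≠ 0 := by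
    intro u hu h0
    have := hc4 u hu
    rw [h0] at this
    exact inv_ne_zero hu (by rw [← this]; norm_num)
  have hjne : ∀ᶠ u : C4 in 𝓝 w, u j ≠ 0 := (analyticAt_apply j w).continuousAt.eventually_ne hj
  have hpt : ∀ u, u j ≠ 0 → jac Γ u ≠ 0 →
      pt (c u • Γ u) = affinePoint i (G (aff j u)) := by
    intro u hu hu'
    rw [pt_smul (hc0 u hu'), hΓdef, pt_homogenize hu]
  refine ⟨fun u => c u • Γ u, ⟨?_, hcan.smul hΓan, ?_, ?_, ?_, ?_⟩⟩
  · intro μ hμ u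
    simp only [hchom μ hμ, hΓhom μ hμ, smul_comm μ]
  · refine smul_ne_zero (hc0 w hjac) (smul_ne_zero hj (insertNth_one_ne_zero _ _))
  · filter_upwards [hj0, hjne, (analyticAt_aff hj).continuousAt.eventually hGrel] with u h1 h2 h3
    rw [hpt u h2 h1, ← affinePoint_aff h2]
    exact h3
  · filter_upwards [hj0, hcan.eventually_analyticAt, hΓan.eventually_analyticAt] with u h1 h2 h3
    rw [hΓhom.jac_smul_fun h3.differentiableAt h2.differentiableAt (hc0 u h1) hchom, hc4 u h1,
      inv_mul_cancel₀ h1]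
  · rw [hpt w hj hjac, hGz, hq]

end Existence

end CP3

namespace CP3

open Filter

/-! ### Lifts of lines through the covering are lines. -/

section Lines

/-- The point of the plane spanned by `v` and `b` with coordinates `o`. -/
def lin (v b : C4) (o : ℂ × ℂ) : C4 := o.1 • v + o.2 • b

theorem continuous_lin (v b : C4) : Continuous (lin v b) := by
  unfold lin
  fun_prop

theorem lin_smul (v b : C4) (μ : ℂ) (o : ℂ × ℂ) : lin v b (μ • o) = μ • lin v b o := by
  simp [lin, mul_smul]

theorem map_lin (T : C4 →L[ℂ] C4) (v b : C4) (o : ℂ × ℂ) :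
    T (lin v b o) = lin (T v) (T b) o := by
  simp [lin]

variable {D : TopologicalSpace.Opens CP3} {X : Type*} [TopologicalSpace X]

theorem exists_lift_complex {π : D → X} (hπ : IsCoveringMap π) (f : C(ℂ, D)) (a : ℂ) (x : D)
    (hx : π x = π (f a)) : ∃ h : C(ℂ, D), h a = x ∧ ∀ s, π (h s) = π (f s) := by
  obtain ⟨h, ⟨h1, h2⟩, -⟩ := hπ.existsUnique_continuousMap_lifts
    ((⟨π, hπ.continuous⟩ : C(D, X)).comp f) a x hx
  exact ⟨h, h1, fun s => congrFun h2 s⟩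

/-- The two affine pieces s ↦ (1, s) and s ↦ (s, 1) of the projective line are lifted separately, as
ℂ is simply connected, and then glued. -/
theorem exists_lift_line {π : D → X} (hπ : IsCoveringMap π) {v b : C4}
    (hD : ∀ o, o ≠ 0 → lin v b o ≠ 0 ∧ pt (lin v b o) ∈ D) {x : CP3} (hx : Rel π (pt v) x) :
    ∃ H : ℂ × ℂ → D, ContinuousOn H {0}ᶜ ∧ (H (1, 0)).1 = x ∧
      (∀ o, o ≠ 0 → Rel π (pt (lin v b o)) (H o).1) ∧
      ∀ μ : ℂ, μ ≠ 0 → ∀ o, o ≠ 0 → H (μ • o) = H o := by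
  have hc : ∀ {g : ℂ → ℂ × ℂ} (hg : Continuous g) (h0 : ∀ s, g s ≠ 0),
      Continuous fun s => (⟨pt (lin v b (g s)), (hD _ (h0 s)).2⟩ : D) := by
    intro g hg h0
    refine Continuous.subtype_mk ?_ _
    exact continuousOn_pt.comp_continuous ((continuous_lin v b).comp hg) fun s => (hD _ (h0 s)).1
  have hn0 : ∀ s : ℂ, ((1, s) : ℂ × ℂ) ≠ 0 := fun s h => one_ne_zero (congrArg Prod.fst h)
  have hn1 : ∀ s : ℂ, ((s, 1) : ℂ × ℂ) ≠ 0 := fun s h => one_ne_zero (congrArg Prod.snd h)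
  let f0 : C(ℂ, D) := ⟨_, hc (g := fun s => (1, s)) (by fun_prop) hn0⟩
  let f1 : C(ℂ, D) := ⟨_, hc (g := fun s => (s, 1)) (by fun_prop) hn1⟩
  obtain ⟨h0, h00, h0π⟩ := exists_lift_complex hπ f0 0 ⟨x, hx.right_mem⟩ (by
    obtain ⟨_, _, h⟩ := hx
    rw [← h]
    congr 2
    simp [lin])
  have hf : ∀ s : ℂ, s ≠ 0 → f1 s⁻¹ = f0 s := by
    intro s hs
    apply Subtype.ext
    change pt (lin v b (s⁻¹, 1)) = pt (lin v b (1, s))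
    rw [show ((s⁻¹, 1) : ℂ × ℂ) = s⁻¹ • (1, s) by simp [hs], lin_smul, pt_smul (inv_ne_zero hs)]
  obtain ⟨h1, h11, h1π⟩ := exists_lift_complex hπ f1 1 (h0 1) (by
    rw [h0π, ← hf 1 one_ne_zero, inv_one])
  -- The overlap ℂ \ {0} is connected, so two lifts that agree at s = 1 agree on all of it.
  have hglue : ∀ s : ℂ, s ≠ 0 → h1 s⁻¹ = h0 s := by
    have hpre : IsPreconnected ({0}ᶜ : Set ℂ) :=
      (isConnected_compl_singleton_of_one_lt_rank (by simp) (0 : ℂ)).isPreconnected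
    have := hπ.eqOn_of_comp_eqOn (g₁ := fun s => h1 s⁻¹) (g₂ := h0) hpre
      (h1.continuous.comp_continuousOn (continuousOn_inv₀)) h0.continuous.continuousOn
      (fun s hs => by
        simp only [Function.comp]
        rw [h1π, h0π, hf s hs]) (a := 1) (by simp) (by simp [h11])
    exact this
  classical
  set H : ℂ × ℂ → D := fun o => if o.1 = 0 then h1 0 else h0 (o.2 / o.1) with hH
  have hH0 : ∀ o : ℂ × ℂ, o.1 ≠ 0 → H o = h0 (o.2 / o.1) := fun o h => by simp [hH, h]
  have hH1 : ∀ o : ℂ × ℂ, o.2 ≠ 0 → H o = h1 (o.1 / o.2) := by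
    intro o h
    by_cases h' : o.1 = 0
    · simp [hH, h']
    · rw [hH0 o h', ← hglue _ (div_ne_zero h h'), inv_div]
  have hor : ∀ o : ℂ × ℂ, o ≠ 0 → o.1 ≠ 0 ∨ o.2 ≠ 0 := by
    intro o h
    by_contra! h'
    exact h (Prod.ext h'.1 h'.2)
  refine ⟨H, ?_, ?_, ?_, ?_⟩
  · intro o ho
    refine ContinuousAt.continuousWithinAt ?_
    rcases hor o ho with h | h
    · have h2 : ContinuousAt (fun o : ℂ × ℂ => h0 (o.2 / o.1)) o := by
        have h3 : ContinuousAt (fun o : ℂ × ℂ => o.2 / o.1) o :=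
          continuousAt_snd.div continuousAt_fst h
        exact h0.continuous.continuousAt.comp h3
      refine h2.congr ?_
      filter_upwards [continuousAt_fst.eventually_ne h] with o' h'
      exact (hH0 o' h').symm
    · have h2 : ContinuousAt (fun o : ℂ × ℂ => h1 (o.1 / o.2)) o := by
        have h3 : ContinuousAt (fun o : ℂ × ℂ => o.1 / o.2) o :=
          continuousAt_fst.div continuousAt_snd h
        exact h1.continuous.continuousAt.comp h3
      refine h2.congr ?_
      filter_upwards [continuousAt_snd.eventually_ne h] with o' h'
      exact (hH1 o' h').symm
  · rw [hH0 _ (by simp)]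
    simp [h00]
  · intro o ho
    rcases hor o ho with h | h
    · rw [hH0 o h]
      have h2 : pt (lin v b o) = f0 (o.2 / o.1) := by
        change pt (lin v b o) = pt (lin v b (1, o.2 / o.1))
        rw [← pt_smul h (lin v b (1, _)), ← lin_smul]
        congr 2
        ext <;> simp [mul_div_cancel₀ _ h]
      exact ⟨(hD o ho).2, Subtype.coe_prop _, by simp only [h2]; exact (h0π _).symm⟩
    · rw [hH1 o h]
      have h2 : pt (lin v b o) = f1 (o.1 / o.2) := by
        change pt (lin v b o) = pt (lin v b (o.1 / o.2, 1))
        rw [← pt_smul h (lin v b (_, 1)), ← lin_smul]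
        congr 2
        ext <;> simp [mul_div_cancel₀ _ h]
      exact ⟨(hD o ho).2, Subtype.coe_prop _, by simp only [h2]; exact (h1π _).symm⟩
  · intro μ hμ o ho
    simp [hH, hμ, mul_div_mul_left _ _ hμ]

variable [ChartedSpace C3 X]

/-- Only the derivatives of the unimodular lifts matter: up to scalars they form a holomorphic
matrix-valued function of degree zero on the projective line, hence a constant matrix, and this
matrix carries the old line to the new one. -/
theorem lift_line_eq {π : D → X} (hπ : IsLocalDiffeomorph 𝓘(ℂ, C3) 𝓘(ℂ, C3) ω π) {v b : C4}
    (hD : ∀ o, o ≠ 0 → lin v b o ≠ 0 ∧ pt (lin v b o) ∈ D) {H : ℂ × ℂ → CP3}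
    (hH : ContinuousOn H {0}ᶜ) (hHr : ∀ o, o ≠ 0 → Rel π (pt (lin v b o)) (H o))
    (hHs : ∀ μ : ℂ, μ ≠ 0 → ∀ o, o ≠ 0 → H (μ • o) = H o) :
    ∃ A B : C4, ∀ o, o ≠ 0 → lin A B o ≠ 0 ∧ H o = pt (lin A B o) := by
  have hex : ∀ o : ℂ × ℂ, ∃ Γ, o ≠ 0 → IsUnimodularLift π (lin v b o) (H o) Γ := by
    intro o
    by_cases ho : o = 0
    · exact ⟨id, fun h => absurd ho h⟩
    · obtain ⟨Γ, hΓ⟩ := exists_isUnimodularLift hπ (hD o ho).1 (hHr o ho)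
      exact ⟨Γ, fun _ => hΓ⟩
  choose Γ hΓ using hex
  have hne : ∀ o : ℂ × ℂ, o ≠ 0 → ∀ᶠ o' in 𝓝 o, o' ≠ 0 := fun o ho => isOpen_ne.mem_nhds ho
  -- The lift chosen at `o` also serves the nearby parameters: it and `H` give nearby points of the
  -- same fibre.
  have hloc : ∀ o, o ≠ 0 → ∀ᶠ o' in 𝓝 o, IsUnimodularLift π (lin v b o') (H o') (Γ o) := by
    intro o ho
    have h := hΓ o ho
    obtain ⟨N, hN, hNinj⟩ := exists_nhds_rel_eq hπ.isLocalHomeomorph (hHr o ho).right_mem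
    have hlin : ContinuousAt (lin v b) o := (continuous_lin v b).continuousAt
    have hpt : ContinuousAt (fun u => pt (Γ o u)) (lin v b o) :=
      (continuousAt_pt h.ne_zero).comp h.analytic.continuousAt
    have hpt' : ContinuousAt (fun o' => pt (Γ o (lin v b o'))) o := hpt.comp hlin
    have hHc : ContinuousAt H o := hH.continuousAt (isOpen_compl_singleton.mem_nhds ho)
    have hN' : N ∈ 𝓝 (pt (Γ o (lin v b o))) := by rwa [h.pt_eq]
    filter_upwards [hlin.eventually h.eventually, hpt'.eventually hN', hHc.eventually hN,
      hne o ho] with o' h1 h2 h3 h4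
    have h5 := hNinj _ h2 _ h3 (h1.rel.self_of_nhds.symm.trans (hHr o' h4))
    rwa [h5] at h1
  set T : ℂ × ℂ → C4 →L[ℂ] C4 := fun o => fderiv ℂ (Γ o) (lin v b o) with hT
  -- Changing the lift multiplies all entries by ζ with ζ⁴ = 1, which a product of four entries does
  -- not see. The form cube times entry also lets ratios of entries be recovered.
  have hTeq : ∀ {o : ℂ × ℂ} {F : C4 → C4}, o ≠ 0 → IsUnimodularLift π (lin v b o) (H o) F →
      ∀ (x y : C4) (a c : Fin 4), (T o x a) ^ 3 * T o y c =
        (fderiv ℂ F (lin v b o) x a) ^ 3 * fderiv ℂ F (lin v b o) y c := by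
    intro o F ho hF x y a c
    obtain ⟨ζ, hζ, h⟩ := hF.fderiv_eq hπ.isLocalHomeomorph (hΓ o ho)
    simp only [hT, h, smul_apply, Pi.smul_apply, smul_eq_mul]
    linear_combination (fderiv ℂ F (lin v b o) x a) ^ 3 * fderiv ℂ F (lin v b o) y c * hζ
  have hconst : ∀ (x y : C4) (a c : Fin 4) (o : ℂ × ℂ), o ≠ 0 →
      (T o x a) ^ 3 * T o y c = (T (1, 0) x a) ^ 3 * T (1, 0) y c := by
    intro x y a c
    set e : ℂ × ℂ → ℂ := fun o => (T o x a) ^ 3 * T o y c with he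
    have hloc' : ∀ o, o ≠ 0 → DifferentiableAt ℂ e o := by
      intro o ho
      have h1 : AnalyticAt ℂ (fun u => fderiv ℂ (Γ o) u) (lin v b o) := (hΓ o ho).analytic.fderiv
      have h2 : ∀ (x : C4) (a : Fin 4),
          DifferentiableAt ℂ (fun o' => fderiv ℂ (Γ o) (lin v b o') x a) o := by
        intro x a
        have h3 : DifferentiableAt ℂ (fun o' => fderiv ℂ (Γ o) (lin v b o')) o := by
          refine DifferentiableAt.comp (g := fun u => fderiv ℂ (Γ o) u) o h1.differentiableAt ?_
          unfold lin
          fun_prop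
        exact ((ContinuousLinearMap.proj (R := ℂ) (φ := fun _ : Fin 4 => ℂ)
          a).comp (ContinuousLinearMap.apply ℂ C4 x)).differentiableAt.comp o h3
      refine (((h2 x a).pow 3).mul (h2 y c)).congr_of_eventuallyEq ?_
      filter_upwards [hloc o ho, hne o ho] with o' h3 h4
      exact hTeq h4 h3 x y a c
    have hes : ∀ μ : ℂ, μ ≠ 0 → ∀ o, o ≠ 0 → e (μ • o) = e o := by
      intro μ hμ o ho
      have h1 := (hΓ o ho).smul hμ
      rw [← lin_smul, ← hHs μ hμ o ho] at h1
      have h2 := hTeq (smul_ne_zero hμ ho) h1 x y a c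
      rw [lin_smul, (hΓ o ho).homog.fderiv_smul hμ] at h2
      exact h2
    have hn0 : ∀ s : ℂ, ((1, s) : ℂ × ℂ) ≠ 0 := fun s h => one_ne_zero (congrArg Prod.fst h)
    have hn1 : ∀ s : ℂ, ((s, 1) : ℂ × ℂ) ≠ 0 := fun s h => one_ne_zero (congrArg Prod.snd h)
    have hdiff : Differentiable ℂ fun s => e (1, s) := by
      intro s
      exact DifferentiableAt.comp (g := e) s (hloc' (1, s) (hn0 s)) (by fun_prop)
    -- By homogeneity e(1, s) = e(1/s, 1), so the entire function has a limit at infinity and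
    -- Liouville applies.
    have hlim : Tendsto (fun s => e (1, s)) (cocompact ℂ) (𝓝 (e (0, 1))) := by
      have h1 : Tendsto (fun s : ℂ => ((s⁻¹, 1) : ℂ × ℂ)) (cocompact ℂ) (𝓝 (0, 1)) := by
        rw [← Metric.cobounded_eq_cocompact]
        exact tendsto_inv₀_cobounded.prodMk_nhds tendsto_const_nhds
      have h2 := (hloc' (0, 1) (hn1 0)).continuousAt.tendsto.comp h1
      refine h2.congr' ?_
      have h3 : ∀ᶠ s in cocompact ℂ, s ≠ (0 : ℂ) := by
        have := (isCompact_singleton (x := (0 : ℂ))).compl_mem_cocompact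
        filter_upwards [this] with s hs using hs
      filter_upwards [h3] with s hs
      simp only [Function.comp]
      rw [← hes s⁻¹ (inv_ne_zero hs) _ (hn0 s)]
      simp [hs]
    have hcon := hdiff.eq_const_of_tendsto_cocompact hlim
    have h10 : e (1, 0) = e (0, 1) := congrFun hcon 0
    intro o ho
    change e o = e (1, 0)
    by_cases h : o.1 = 0
    · have h2 : o.2 ≠ 0 := fun h2 => ho (Prod.ext h h2)
      rw [h10, ← hes o.2 h2 _ (hn1 0)]
      congr 1
      ext <;> simp [h]
    · have h3 : e (1, o.2 / o.1) = e (0, 1) := congrFun hcon _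
      rw [h10, ← h3, ← hes o.1 h _ (hn0 _)]
      congr 1
      ext <;> simp [mul_div_cancel₀ _ h]
  have h10 : ((1, 0) : ℂ × ℂ) ≠ 0 := by simp
  have hinj : Function.Injective (T (1, 0)) := (hΓ _ h10).injective
  obtain ⟨y, c, hyc⟩ : ∃ y c, T (1, 0) y c ≠ 0 := by
    have h1 : T (1, 0) (Pi.single 0 1) ≠ 0 := by
      intro h
      have := hinj (h.trans (map_zero _).symm)
      simp at this
    exact ⟨_, Function.ne_iff.1 h1⟩
  refine ⟨T (1, 0) v, T (1, 0) b, fun o ho => ⟨?_, ?_⟩⟩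
  · rw [← map_lin]
    exact fun h => (hD o ho).1 (hinj (h.trans (map_zero _).symm))
  · have ht : T o y c ≠ 0 := by
      intro h
      have h2 := hconst y y c c o ho
      rw [h] at h2
      have : T (1, 0) y c ^ 4 = 0 := by linear_combination -h2
      exact hyc (pow_eq_zero_iff (by norm_num) |>.1 this)
    -- Constancy of (T y c)³·(T x a) and of (T y c)⁴ makes every ratio of entries independent of
    -- `o`.
    have hTo : ∀ x, T o x = (T o y c / T (1, 0) y c) • T (1, 0) x := by
      intro x
      funext a
      have h1 := hconst y x c a o ho
      have h2 := hconst y y c c o ho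
      simp only [Pi.smul_apply, smul_eq_mul]
      rw [div_mul_eq_mul_div, eq_div_iff hyc]
      have h3 : (T (1, 0) y c) ^ 3 * (T o x a * T (1, 0) y c - T o y c * T (1, 0) x a) = 0 := by
        linear_combination T o y c * h1 - T o x a * h2
      exact sub_eq_zero.1 ((mul_eq_zero.1 h3).resolve_left (pow_ne_zero _ hyc))
    have h3 := (hΓ o ho).homog.fderiv_self (hΓ o ho).analytic.differentiableAt
    rw [← (hΓ o ho).pt_eq, ← h3, ← map_lin]
    change pt (T o (lin v b o)) = _
    rw [hTo, pt_smul (div_ne_zero ht hyc)]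

end Lines

end CP3

namespace CP3

open Filter

/-! ### Limits of lifted lines. -/

section Limit

variable {D : TopologicalSpace.Opens CP3} {X : Type*} [TopologicalSpace X]

/-- One evenly covered `U` serves all points over it. This uniformity matters because the lifts may
run through infinitely many sheets. -/
theorem exists_uniform_sections {π : D → X} (hπ : IsCoveringMap π) (x : X) :
    ∃ U : Set X, IsOpen U ∧ x ∈ U ∧ ∀ q, π q ∈ U →
      ∃ σ : X → D, ContinuousOn σ U ∧ (∀ a ∈ U, π (σ a) = a) ∧ σ (π q) = q := by
  classical
  obtain ⟨_, U, hx, hU, _, E, hE⟩ := hπ x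
  refine ⟨U, hU, hx, fun q hq => ?_⟩
  refine ⟨fun a => if h : a ∈ U then (E.symm (⟨a, h⟩, (E ⟨q, hq⟩).2)).1 else q, ?_, ?_, ?_⟩
  · rw [continuousOn_iff_continuous_domRestrict]
    have : Continuous fun a : U => (E.symm (a, (E ⟨q, hq⟩).2)).1 := by fun_prop
    refine this.congr fun a => ?_
    simp
  · intro a ha
    simp only [ha, dif_pos]
    rw [← hE]
    simp
  · simp only [hq, dif_pos]
    have : E.symm (⟨π q, hq⟩, (E ⟨q, hq⟩).2) = ⟨q, hq⟩ := by
      rw [Homeomorph.symm_apply_eq]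
      refine Prod.ext (Subtype.ext ?_) rfl
      exact (hE ⟨q, hq⟩).symm
    rw [this]

theorem isOpen_cone {S : Set D} (hS : IsOpen S) :
    IsOpen {u : C4 | u ≠ 0 ∧ ∃ h : pt u ∈ D, (⟨pt u, h⟩ : D) ∈ S} := by
  have h1 : IsOpen (Subtype.val '' S : Set CP3) := D.isOpen.isOpenEmbedding_subtypeVal.isOpenMap _ hS
  have h2 := continuousOn_pt.isOpen_inter_preimage isOpen_compl_singleton h1
  convert h2 using 1
  ext u
  simp

theorem tendsto_of_rel {ι : Type*} {l : Filter ι} {π : D → X} (hπ : Continuous π) {p : ι → CP3}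
    {h : ι → D} {p₀ : CP3} (h₀ : p₀ ∈ D) (hp : Tendsto p l (𝓝 p₀))
    (hr : ∀ᶠ n in l, Rel π (p n) (h n).1) :
    Tendsto (fun n => π (h n)) l (𝓝 (π ⟨p₀, h₀⟩)) := by
  refine tendsto_def.2 fun V hV => ?_
  have h1 : π ⁻¹' V ∈ 𝓝 (⟨p₀, h₀⟩ : D) := hπ.continuousAt hV
  have h2 := D.isOpen.isOpenEmbedding_subtypeVal.image_mem_nhds.2 h1
  filter_upwards [hp h2, hr] with n h3 h4
  obtain ⟨a, ha, hap⟩ := h3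
  obtain ⟨h5, _, h6⟩ := h4
  have h7 : a = ⟨p n, h5⟩ := Subtype.ext hap
  rw [mem_preimage, h7, h6] at ha
  exact ha

theorem tendsto_lin {ι : Type*} {l : Filter ι} {v : ι → C4} {v₀ : C4} (hv : Tendsto v l (𝓝 v₀))
    (b : C4) {s : ι → ℂ × ℂ} {o : ℂ × ℂ} (hs : Tendsto s l (𝓝 o)) :
    Tendsto (fun n => lin (v n) b (s n)) l (𝓝 (lin v₀ b o)) := by
  have h3 : Tendsto (fun n => (s n).1) l (𝓝 o.1) := (continuous_fst.tendsto o).comp hs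
  have h4 : Tendsto (fun n => (s n).2) l (𝓝 o.2) := (continuous_snd.tendsto o).comp hs
  exact (h3.smul hv).add (h4.smul tendsto_const_nhds)

variable [T2Space X]

/-- A family of maps `H n` lifting the lines spanned by `v n` and `b` along a limit: if the values
at one fixed point do not accumulate in `D`, then no values do. -/
theorem not_tendsto_of_lift {ι : Type*} {l : Filter ι} [NeBot l] {π : D → X}
    (hπ : IsCoveringMap π) {v : ι → C4} {v₀ b : C4} (hv : Tendsto v l (𝓝 v₀))
    (hD : ∀ o, o ≠ 0 → lin v₀ b o ≠ 0 ∧ pt (lin v₀ b o) ∈ D) {H : ι → ℂ × ℂ → D}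
    (hH : ∀ᶠ n in l, ContinuousOn (H n) {0}ᶜ ∧
      ∀ o, o ≠ 0 → Rel π (pt (lin (v n) b o)) (H n o).1)
    (h10 : ∀ q, ¬ Tendsto (fun n => H n (1, 0)) l (𝓝 q))
    {o : ℂ × ℂ} (ho : o ≠ 0) {s : ι → ℂ × ℂ} (hs : Tendsto s l (𝓝 o)) (q : D) :
    ¬ Tendsto (fun n => H n (s n)) l (𝓝 q) := by
  -- Convergence spreads over a fixed neighbourhood: once the values at `s n` approach `q`, the
  -- lifts follow the single sheet through `q` on the whole ball.
  have hloc : ∀ o : ℂ × ℂ, o ≠ 0 → ∃ N ∈ 𝓝 o, N ⊆ {0}ᶜ ∧ ∀ o₁ ∈ N, ∀ s : ι → ℂ × ℂ,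
      Tendsto s l (𝓝 o₁) → ∀ q, Tendsto (fun n => H n (s n)) l (𝓝 q) →
      ∀ o' ∈ N, ∃ q', Tendsto (fun n => H n o') l (𝓝 q') := by
    intro o ho
    obtain ⟨U, hU, hxU, hσ⟩ := exists_uniform_sections hπ (π ⟨_, (hD o ho).2⟩)
    set O := {u : C4 | u ≠ 0 ∧ ∃ h : pt u ∈ D, (⟨pt u, h⟩ : D) ∈ π ⁻¹' U} with hO
    have hOo : IsOpen O := isOpen_cone (hU.preimage hπ.continuous)
    have hlim : ∀ o, Tendsto (fun x : ι × (ℂ × ℂ) => lin (v x.1) b x.2) (l ×ˢ 𝓝 o)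
        (𝓝 (lin v₀ b o)) := by
      intro o
      exact tendsto_lin (hv.comp tendsto_fst) b tendsto_snd
    have hmem : lin v₀ b o ∈ O := ⟨(hD o ho).1, (hD o ho).2, hxU⟩
    have hev := (hlim o).eventually (hOo.mem_nhds hmem)
    obtain ⟨P1, hP1, P2, hP2, hP⟩ := eventually_prod_iff.1 hev
    have hev2 : ∀ᶠ o' in 𝓝 o, lin v₀ b o' ∈ O :=
      (continuous_lin v₀ b).continuousAt.eventually (hOo.mem_nhds hmem)
    obtain ⟨r, hr, hball⟩ := Metric.eventually_nhds_iff_ball.1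
      ((hP2.and hev2).and (isOpen_ne.mem_nhds ho))
    refine ⟨Metric.ball o r, Metric.ball_mem_nhds o hr, fun o' ho' => (hball o' ho').2, ?_⟩
    intro o₁ ho₁ s hs q hq o' ho'
    obtain ⟨h1, h1D, h1U⟩ := (hball o₁ ho₁).1.2
    have hpt : ∀ {o₁ : ℂ × ℂ} {s : ι → ℂ × ℂ}, lin v₀ b o₁ ∈ O → Tendsto s l (𝓝 o₁) →
        Tendsto (fun n => pt (lin (v n) b (s n))) l (𝓝 (pt (lin v₀ b o₁))) := by
      intro o₁ s h hs
      have h2 : lin v₀ b o₁ ≠ 0 := h.1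
      exact (continuousAt_pt h2).tendsto.comp (tendsto_lin hv b hs)
    have hX : ∀ {o₁ : ℂ × ℂ} {s : ι → ℂ × ℂ} (h : lin v₀ b o₁ ∈ O), Tendsto s l (𝓝 o₁) →
        (∀ᶠ n in l, s n ≠ 0) →
        Tendsto (fun n => π (H n (s n))) l (𝓝 (π ⟨pt (lin v₀ b o₁), h.2.1⟩)) := by
      intro o₁ s h hs hs0
      refine tendsto_of_rel hπ.continuous h.2.1 (hpt h hs) ?_
      filter_upwards [hH, hs0] with n h6 h7
      exact h6.2 _ h7
    have hsN : ∀ᶠ n in l, s n ∈ Metric.ball o r := hs (Metric.isOpen_ball.mem_nhds ho₁)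
    have hqπ : π q = π ⟨pt (lin v₀ b o₁), h1D⟩ := by
      refine tendsto_nhds_unique ((hπ.continuous.tendsto q).comp hq) ?_
      exact hX (hball o₁ ho₁).1.2 hs (hsN.mono fun n hn => (hball _ hn).2)
    obtain ⟨σ, hσc, hσπ, hσq⟩ := hσ q (by rw [hqπ]; exact h1U)
    obtain ⟨N, hN, hNinj⟩ := exists_nhds_rel_eq hπ.isLocalHomeomorph q.2
    have hN' : Subtype.val ⁻¹' N ∈ 𝓝 q := continuous_subtype_val.continuousAt hN
    have hqU : π q ∈ U := by rw [hqπ]; exact h1U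
    have hσat : Tendsto σ (𝓝 (π q)) (𝓝 q) := by
      have := hσc.continuousAt (hU.mem_nhds hqU)
      rwa [ContinuousAt, hσq] at this
    -- Both sides lift the same map on a connected ball. They agree at `s n`, where both values lie
    -- near `q` in one fibre.
    have hkey : ∀ᶠ n in l, ∀ o' ∈ Metric.ball o r, H n o' = σ (π (H n o')) := by
      filter_upwards [hP1, hH, hsN, hq hN',
        (hσat.comp ((hπ.continuous.tendsto q).comp hq)) hN',
        ((hπ.continuous.tendsto q).comp hq) (hU.mem_nhds hqU)] with n g1 g2 g3 g4 g5 g6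
      have hin : ∀ o' ∈ Metric.ball o r, π (H n o') ∈ U := by
        intro o' ho'
        obtain ⟨_, _, h⟩ := hP g1 (hball o' ho').1.1
        obtain ⟨_, _, h'⟩ := g2.2 o' (hball o' ho').2
        rw [← h']
        exact h
      have hcH : ContinuousOn (H n) (Metric.ball o r) := g2.1.mono fun o' ho' => (hball o' ho').2
      refine hπ.eqOn_of_comp_eqOn (convex_ball o r).isPreconnected hcH
        (hσc.comp (hπ.continuous.comp_continuousOn hcH) hin) ?_ g3 ?_
      · intro o' ho'
        exact (hσπ _ (hin o' ho')).symm
      · refine Subtype.ext (hNinj _ g4 _ g5 ⟨Subtype.coe_prop _, Subtype.coe_prop _, ?_⟩)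
        exact (hσπ _ g6).symm
    refine ⟨σ (π ⟨pt (lin v₀ b o'), (hball o' ho').1.2.2.1⟩), ?_⟩
    have h5 := hX (hball o' ho').1.2 (s := fun _ => o') tendsto_const_nhds
      (Eventually.of_forall fun _ => (hball o' ho').2)
    have h6 := (hσc.continuousAt (hU.mem_nhds (hball o' ho').1.2.2.2)).tendsto.comp h5
    refine h6.congr' ?_
    filter_upwards [hkey] with n hn
    exact (hn o' ho').symm
  set good : ℂ × ℂ → Prop := fun o => ∃ q', Tendsto (fun n => H n o) l (𝓝 q') with hgood
  have hopen1 : IsOpen {o : ℂ × ℂ | o ≠ 0 ∧ ¬ good o} := by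
    rw [isOpen_iff_mem_nhds]
    rintro o ⟨ho, hng⟩
    obtain ⟨N, hN, hN0, h⟩ := hloc o ho
    refine mem_of_superset hN fun o' ho' => ⟨hN0 ho', fun ⟨q', hq'⟩ => hng ?_⟩
    exact h o' ho' (fun _ => o') tendsto_const_nhds q' hq' o (mem_of_mem_nhds hN)
  have hopen2 : IsOpen {o : ℂ × ℂ | o ≠ 0 ∧ good o} := by
    rw [isOpen_iff_mem_nhds]
    rintro o ⟨ho, q', hq'⟩
    obtain ⟨N, hN, hN0, h⟩ := hloc o ho
    refine mem_of_superset hN fun o' ho' => ⟨hN0 ho', ?_⟩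
    exact h o (mem_of_mem_nhds hN) (fun _ => o) tendsto_const_nhds q' hq' o' ho'
  -- Convergence and its failure are both open conditions on the connected set ℂ² \ {0}, and (1, 0)
  -- is a failure.
  have hpre : IsPreconnected ({0}ᶜ : Set (ℂ × ℂ)) := by
    refine (isConnected_compl_singleton_of_one_lt_rank ?_ 0).isPreconnected
    rw [rank_prod', Complex.rank_real_complex]
    norm_num
  have hall : ({0}ᶜ : Set (ℂ × ℂ)) ⊆ {o | o ≠ 0 ∧ ¬ good o} := by
    refine hpre.subset_left_of_subset_union hopen1 hopen2 ?_ ?_ ?_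
    · rw [disjoint_left]
      exact fun o h h' => h.2 h'.2
    · intro o ho
      by_cases h : good o
      · exact Or.inr ⟨ho, h⟩
      · exact Or.inl ⟨ho, h⟩
    · exact ⟨(1, 0), by simp, by simp, fun ⟨q', hq'⟩ => h10 q' hq'⟩
  intro hq
  obtain ⟨N, hN, hN0, h⟩ := hloc o ho
  exact (hall ho).2 (h o (mem_of_mem_nhds hN) s hs q hq o (mem_of_mem_nhds hN))

end Limit

/-! ### A line of Λ through every point of Λ. -/

section Direction

/-- The unit norm of the direction is what allows a nonzero limit direction to be extracted later.
-/
theorem exists_affine_direction {i : Fin 4} {A B : C4} (hAB : ∀ o, o ≠ 0 → lin A B o ≠ 0)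
    {y : C3} (hy : pt A = affinePoint i y) :
    ∃ c : C3, ‖c‖ = 1 ∧ ∀ t : ℂ, ∃ o, o ≠ 0 ∧ affinePoint i (y + t • c) = pt (lin A B o) := by
  have hA : A ≠ 0 := by simpa [lin] using hAB (1, 0) (by simp)
  obtain ⟨a, ha, hAa⟩ := (pt_eq_pt_iff hA (insertNth_one_ne_zero i y)).1
    (hy.trans (affinePoint_eq_pt i y))
  have hAi : A i = a := by simp [hAa]
  have hAl : ∀ l, A (i.succAbove l) = a * y l := fun l => by simp [hAa]
  -- Subtracting a multiple of `A` removes the `i`-th coordinate, so `B'` is a point at infinity of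
  -- the chart, that is, a direction.
  set B' : C4 := B - (B i / a) • A with hB'
  have hB'0 : B' ≠ 0 := by
    have := hAB (-(B i / a), 1) (by simp)
    rwa [lin, one_smul, neg_smul, neg_add_eq_sub] at this
  have hB'i : B' i = 0 := by simp [hB', hAi, ha]
  set c' : C3 := fun l => B' (i.succAbove l) with hc'
  have hc'0 : c' ≠ 0 := by
    intro h
    apply hB'0
    funext k
    exact Fin.succAboveCases i hB'i (fun l => congrFun h l) k
  have hn : (‖c'‖ : ℂ) ≠ 0 := by simpa using hc'0
  refine ⟨(‖c'‖ : ℂ)⁻¹ • c', by simp [norm_smul, hc'0], fun t => ?_⟩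
  -- The coefficients of (1/a) A + (t/‖c'‖) B' with respect to A and B.
  refine ⟨(1 / a - t / ‖c'‖ * (B i / a), t / ‖c'‖), ?_, ?_⟩
  · intro h
    have h2 : t / ‖c'‖ = 0 := congrArg Prod.snd h
    have h1 : 1 / a - t / ‖c'‖ * (B i / a) = 0 := congrArg Prod.fst h
    rw [h2] at h1
    simp [ha] at h1
  · rw [affinePoint_eq_pt]
    congr 1
    funext k
    refine Fin.succAboveCases i ?_ (fun l => ?_) k
    · simp only [Fin.insertNth_apply_same, lin, Pi.add_apply, Pi.smul_apply, smul_eq_mul, hAi]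
      field_simp
      ring
    · simp only [Fin.insertNth_apply_succAbove, lin, Pi.add_apply, Pi.smul_apply, smul_eq_mul, hAl,
        hc', hB', Pi.sub_apply]
      field_simp
      ring

variable {D : TopologicalSpace.Opens CP3} {X : Type*} [TopologicalSpace X] [T2Space X]
  [CompactSpace X] [ChartedSpace C3 X]

/-- An ultrafilter on `D` tending to the boundary point makes all compactness arguments
simultaneous: the image in X, the direction and the parameter all converge along it. -/
theorem exists_direction_compl {π : D → X} (hcov : IsCoveringMap π)
    (hsurj : Function.Surjective π) (hπ : IsLocalDiffeomorph 𝓘(ℂ, C3) 𝓘(ℂ, C3) ω π)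
    (hline : ∀ v, v ≠ 0 → pt v ∈ D → ∃ b, ∀ o, o ≠ 0 → lin v b o ≠ 0 ∧ pt (lin v b o) ∈ D)
    (hdense : Dense (D : Set CP3)) {i : Fin 4} {y : C3} (hy : affinePoint i y ∉ D) :
    ∃ c : C3, c ≠ 0 ∧ ∀ t : ℂ, affinePoint i (y + t • c) ∉ D := by
  set x := affinePoint i y with hx
  have hne : NeBot (comap (Subtype.val : D → CP3) (𝓝 x)) := by
    rw [comap_neBot_iff]
    intro V hV
    obtain ⟨p, hp, hpD⟩ := mem_closure_iff_nhds.1 (hdense x) V hV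
    exact ⟨⟨p, hpD⟩, hp⟩
  set l : Ultrafilter D := Ultrafilter.of (comap (Subtype.val : D → CP3) (𝓝 x)) with hl
  have hlx : Tendsto (Subtype.val : D → CP3) l (𝓝 x) :=
    tendsto_iff_comap.2 (Ultrafilter.of_le _)
  obtain ⟨p, -, hp⟩ := isCompact_univ.ultrafilter_le_nhds (l.map π) (by simp)
  have hlp : Tendsto π l (𝓝 p) := hp
  obtain ⟨p', rfl⟩ := hsurj p
  obtain ⟨j, hj⟩ := exists_mem_chartDomain p'.1
  obtain ⟨U, hU, hpU, hσ⟩ := exists_uniform_sections hcov (π p')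
  obtain ⟨σ, hσc, hσπ, hσp⟩ := hσ p' hpU
  have hσlim : Tendsto (fun n => (σ (π n)).1) l (𝓝 p'.1) := by
    have := (hσc.continuousAt (hU.mem_nhds hpU)).tendsto.comp hlp
    rw [hσp] at this
    exact (continuous_subtype_val.tendsto p').comp this
  set v : D → C4 := fun n => (j.insertNth (1 : ℂ) (affineCoord j (σ (π n)).1) : C4) with hv
  set v₀ : C4 := (j.insertNth (1 : ℂ) (affineCoord j p'.1) : C4) with hv₀
  have hvlim : Tendsto v l (𝓝 v₀) := by
    have h1 : Tendsto (fun n => affineCoord j (σ (π n)).1) l (𝓝 (affineCoord j p'.1)) :=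
      ((continuousOn_affineCoord j).continuousAt
        ((isOpen_chartDomain j).mem_nhds hj)).tendsto.comp hσlim
    have h2 : Continuous fun z : C3 => (j.insertNth (1 : ℂ) z : C4) :=
      Continuous.finInsertNth j continuous_const continuous_id
    exact (h2.tendsto _).comp h1
  have hv₀0 : v₀ ≠ 0 := insertNth_one_ne_zero _ _
  have hv₀pt : pt v₀ = p'.1 := by
    rw [hv₀, ← affinePoint_eq_pt, affinePoint_affineCoord j hj]
  have hvpt : ∀ᶠ n in (l : Filter D), Rel π (pt (v n)) n.1 := by
    filter_upwards [hσlim.eventually ((isOpen_chartDomain j).mem_nhds hj),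
      hlp.eventually (hU.mem_nhds hpU)] with n h1 h2
    have h3 : pt (v n) = (σ (π n)).1 := by
      rw [hv, ← affinePoint_eq_pt, affinePoint_affineCoord j h1]
    rw [h3]
    exact ⟨Subtype.coe_prop _, Subtype.coe_prop _, hσπ _ h2⟩
  obtain ⟨b, hb⟩ := hline v₀ hv₀0 (by rw [hv₀pt]; exact p'.2)
  set O := {u : C4 | u ≠ 0 ∧ ∃ h : pt u ∈ D, (⟨pt u, h⟩ : D) ∈ (univ : Set D)} with hO
  have hOo : IsOpen O := isOpen_cone isOpen_univ
  have hn : ∀ᶠ n in (l : Filter D), ∀ o, o ≠ 0 → lin (v n) b o ≠ 0 ∧ pt (lin (v n) b o) ∈ D := by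
    -- A line is compact and `D` is open, so nearby lines remain in `D`; by homogeneity the unit
    -- sphere of parameters suffices.
    have h1 : ∀ᶠ u in 𝓝 v₀, ∀ o ∈ Metric.sphere (0 : ℂ × ℂ) 1, lin u b o ∈ O := by
      refine (isCompact_sphere _ _).eventually_forall_of_forall_eventually fun o ho => ?_
      have h2 : Continuous fun z : C4 × (ℂ × ℂ) => lin z.1 b z.2 := by
        unfold lin
        fun_prop
      have ho0 : o ≠ 0 := by
        rintro rfl
        simp at ho
      exact h2.continuousAt.eventually
        (hOo.mem_nhds ⟨(hb o ho0).1, (hb o ho0).2, mem_univ _⟩)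
    filter_upwards [hvlim.eventually h1] with n h2 o ho
    have hnorm : (‖o‖ : ℂ) ≠ 0 := by simpa using ho
    have h3 := h2 ((‖o‖ : ℂ)⁻¹ • o) (by simp [norm_smul, ho])
    rw [lin_smul] at h3
    refine ⟨fun h => h3.1 (by simp [h]), ?_⟩
    have h4 := h3.2.1
    rwa [pt_smul (inv_ne_zero hnorm)] at h4
  have hex : ∀ n : D, ∃ (H : ℂ × ℂ → D) (A B : C4),
      (∀ o, o ≠ 0 → lin (v n) b o ≠ 0 ∧ pt (lin (v n) b o) ∈ D) → Rel π (pt (v n)) n.1 →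
      ContinuousOn H {0}ᶜ ∧ (H (1, 0)).1 = n.1 ∧
      (∀ o, o ≠ 0 → Rel π (pt (lin (v n) b o)) (H o).1) ∧
      ∀ o, o ≠ 0 → lin A B o ≠ 0 ∧ (H o).1 = pt (lin A B o) := by
    intro n
    by_cases h : (∀ o, o ≠ 0 → lin (v n) b o ≠ 0 ∧ pt (lin (v n) b o) ∈ D) ∧ Rel π (pt (v n)) n.1
    · obtain ⟨H, h1, h2, h3, h4⟩ := exists_lift_line hcov h.1 h.2
      obtain ⟨A, B, hAB⟩ := lift_line_eq hπ h.1 (H := fun o => (H o).1)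
        (continuous_subtype_val.comp_continuousOn h1) h3 (fun μ hμ o ho => by simp only [h4 μ hμ o ho])
      exact ⟨H, A, B, fun _ _ => ⟨h1, h2, h3, hAB⟩⟩
    · exact ⟨fun _ => n, 0, 0, fun h1 h2 => absurd ⟨h1, h2⟩ h⟩
  choose H A B hHAB using hex
  have hchart : ∀ᶠ n in (l : Filter D), n.1 ∈ chartDomain i :=
    hlx.eventually ((isOpen_chartDomain i).mem_nhds (affinePoint_mem i y))
  set yn : D → C3 := fun n => affineCoord i n.1 with hyn
  have hynlim : Tendsto yn l (𝓝 y) := by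
    have h1 : Tendsto (fun n : D => affineCoord i n.1) l (𝓝 (affineCoord i x)) :=
      ((continuousOn_affineCoord i).continuousAt
        ((isOpen_chartDomain i).mem_nhds (affinePoint_mem i y))).tendsto.comp hlx
    rwa [hx, affineCoord_affinePoint] at h1
  have hcex : ∀ n : D, ∃ c : C3, ‖c‖ = 1 ∧ ((∀ o, o ≠ 0 → lin (A n) (B n) o ≠ 0) →
      pt (A n) = affinePoint i (yn n) →
      ∀ t : ℂ, ∃ o, o ≠ 0 ∧ affinePoint i (yn n + t • c) = pt (lin (A n) (B n) o)) := by
    intro n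
    by_cases h : (∀ o, o ≠ 0 → lin (A n) (B n) o ≠ 0) ∧ pt (A n) = affinePoint i (yn n)
    · obtain ⟨c, h1, h2⟩ := exists_affine_direction h.1 h.2
      exact ⟨c, h1, fun _ _ => h2⟩
    · exact ⟨fun _ => 1, by simp, fun h1 h2 => absurd ⟨h1, h2⟩ h⟩
  choose c hc1 hc using hcex
  obtain ⟨c₀, hc₀, hclim'⟩ := (isCompact_sphere (0 : C3) 1).ultrafilter_le_nhds (l.map c) (by
    rw [le_principal_iff]
    exact Eventually.of_forall (f := (l : Filter D)) fun n => by simpa using hc1 n)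
  have hclim : Tendsto c l (𝓝 c₀) := hclim'
  refine ⟨c₀, by rintro rfl; simp at hc₀, fun t ht => ?_⟩
  -- Normalised parameters have a nonzero limit, as `not_tendsto_of_lift` requires.
  have hoex : ∀ n : D, ∃ o : ℂ × ℂ, ‖o‖ = 1 ∧ ((∀ o, o ≠ 0 → lin (A n) (B n) o ≠ 0) →
      pt (A n) = affinePoint i (yn n) →
      affinePoint i (yn n + t • c n) = pt (lin (A n) (B n) o)) := by
    intro n
    by_cases h : (∀ o, o ≠ 0 → lin (A n) (B n) o ≠ 0) ∧ pt (A n) = affinePoint i (yn n)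
    · obtain ⟨o, h1, h2⟩ := hc n h.1 h.2 t
      have hnorm : (‖o‖ : ℂ) ≠ 0 := by simpa using h1
      refine ⟨(‖o‖ : ℂ)⁻¹ • o, by simp [norm_smul, h1], fun _ _ => ?_⟩
      rw [h2, lin_smul, pt_smul (inv_ne_zero hnorm)]
    · exact ⟨(1, 0), by simp, fun h1 h2 => absurd ⟨h1, h2⟩ h⟩
  choose s hs1 hs using hoex
  obtain ⟨s₀, hs₀, hslim'⟩ := (isCompact_sphere (0 : ℂ × ℂ) 1).ultrafilter_le_nhds (l.map s) (by
    rw [le_principal_iff]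
    exact Eventually.of_forall (f := (l : Filter D)) fun n => by simpa using hs1 n)
  have hslim : Tendsto s l (𝓝 s₀) := hslim'
  have hs₀0 : s₀ ≠ 0 := by rintro rfl; simp at hs₀
  refine not_tendsto_of_lift (l := (l : Filter D)) hcov hvlim hb (H := H) ?_ ?_ hs₀0 hslim
    ⟨_, ht⟩ ?_
  · filter_upwards [hn, hvpt] with n h1 h2
    exact ⟨(hHAB n h1 h2).1, (hHAB n h1 h2).2.2.1⟩
  · intro q hq
    have h1 : Tendsto (fun n => (H n (1, 0)).1) l (𝓝 q.1) := (continuous_subtype_val.tendsto q).comp hq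
    have h2 : Tendsto (fun n => (H n (1, 0)).1) l (𝓝 x) := by
      refine hlx.congr' ?_
      filter_upwards [hn, hvpt] with n h1 h2
      exact (hHAB n h1 h2).2.1.symm
    have h3 := tendsto_nhds_unique h1 h2
    exact hy (h3 ▸ q.2)
  · rw [tendsto_subtype_rng]
    have h1 : Tendsto (fun n => affinePoint i (yn n + t • c n)) l
        (𝓝 (affinePoint i (y + t • c₀))) :=
      ((continuous_affinePoint i).tendsto _).comp (hynlim.add (hclim.const_smul t))
    refine h1.congr' ?_
    filter_upwards [hn, hvpt, hchart] with n h1 h2 h3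
    obtain ⟨_, g2, _, g4⟩ := hHAB n h1 h2
    have hs0 : s n ≠ 0 := by
      intro h
      have := hs1 n
      rw [h] at this
      simp at this
    rw [(g4 _ hs0).2]
    refine hs n (fun o ho => (g4 o ho).1) ?_
    rw [affinePoint_affineCoord i h3, ← g2, (g4 (1, 0) (by simp)).2]
    simp [lin]

end Direction

end CP3

namespace CP3

open Filter Module

/-! ### Submanifolds read in affine coordinates. -/

section Slices

/-- A smooth chart `e` of `ℂ³` near `a` that flattens `S` onto the real subspace `W`. -/
structure IsSlice (S : Set C3) (a : C3) (e : OpenPartialHomeomorph C3 C3)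
    (W : Submodule ℝ C3) : Prop where
  contDiffOn : ContDiffOn ℝ ∞ e e.source
  contDiffOn_symm : ContDiffOn ℝ ∞ e.symm e.target
  mem_source : a ∈ e.source
  mem_iff : ∀ y ∈ e.source, y ∈ S ↔ e y ∈ W

/-- A smooth real submanifold of `ℂ³` of dimension `k`. -/
def IsSubmanifold (k : ℕ) (S : Set C3) : Prop :=
  ∀ a ∈ S, ∃ e W, IsSlice S a e W ∧ finrank ℝ W = k

/-- Locally a finite union of relatively closed submanifolds of dimension `k`. -/
def IsLocallyFiniteUnion (k : ℕ) (Λ : Set C3) : Prop :=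
  ∀ x ∈ Λ, ∃ U : Set C3, IsOpen U ∧ x ∈ U ∧ ∃ 𝓜 : Set (Set C3), 𝓜.Finite ∧
    (∀ M ∈ 𝓜, IsSubmanifold k M ∧ closure M ∩ U ⊆ M) ∧ Λ ∩ U = ⋃₀ 𝓜

theorem affineChart_mem_maximalAtlas (i : Fin 4) :
    affineChart i ∈ IsManifold.maximalAtlas 𝓘(ℝ, C3) ∞ CP3 :=
  IsManifold.subset_maximalAtlas (mem_range_self i)

theorem IsSliceChart.preimage {M : Set CP3} {x : CP3} {φ : OpenPartialHomeomorph CP3 C3}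
    {W : Submodule ℝ C3} (h : IsSliceChart M x φ W) {i : Fin 4} {a : C3}
    (ha : affinePoint i a = x) :
    IsSlice (affinePoint i ⁻¹' M) a ((affineChart i).symm ≫ₕ φ) W := by
  obtain ⟨h1, h2, h3⟩ := h
  have hφ := contMDiffOn_of_mem_maximalAtlas h1
  have hφ' := contMDiffOn_symm_of_mem_maximalAtlas h1
  have hi := contMDiffOn_of_mem_maximalAtlas (affineChart_mem_maximalAtlas i)
  have hi' := contMDiffOn_symm_of_mem_maximalAtlas (affineChart_mem_maximalAtlas i)
  refine ⟨?_, ?_, ?_, ?_⟩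
  · rw [← contMDiffOn_iff_contDiffOn]
    exact hφ.comp (hi'.mono fun y hy => hy.1) fun y hy => hy.2
  · rw [← contMDiffOn_iff_contDiffOn]
    exact hi.comp (hφ'.mono fun y hy => hy.1) fun y hy => hy.2
  · exact ⟨mem_univ _, by rw [← ha] at h2; exact h2⟩
  · exact fun y hy => h3 _ hy.2

theorem IsRealSubmanifold.preimage {k : ℕ} {M : Set CP3} (h : IsRealSubmanifold k M) (i : Fin 4) :
    IsSubmanifold k (affinePoint i ⁻¹' M) := by
  intro a ha
  obtain ⟨φ, W, hφ, hW⟩ := h _ ha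
  exact ⟨_, W, hφ.preimage rfl, hW⟩

theorem IsLocallyFiniteUnionOfSubmanifolds.preimage {k : ℕ} {Λ : Set CP3}
    (h : IsLocallyFiniteUnionOfSubmanifolds k Λ) (i : Fin 4) :
    IsLocallyFiniteUnion k (affinePoint i ⁻¹' Λ) := by
  intro x hx
  obtain ⟨U, hU, hxU, 𝓜, h𝓜, hM, hΛ⟩ := h _ hx
  refine ⟨affinePoint i ⁻¹' U, hU.preimage (continuous_affinePoint i), hxU,
    (fun M => affinePoint i ⁻¹' M) '' 𝓜, h𝓜.image _, ?_, ?_⟩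
  · rintro _ ⟨M, hMm, rfl⟩
    obtain ⟨h1, -, h3⟩ := hM M hMm
    refine ⟨h1.preimage i, ?_⟩
    rintro y ⟨hy, hyU⟩
    exact h3 ⟨(continuous_affinePoint i).closure_preimage_subset M hy, hyU⟩
  · rw [← preimage_inter, hΛ, preimage_sUnion, sUnion_image]

end Slices

/-! ### Dimension count for lines that avoid Λ. -/

section Dimension

/-- The union of the planes through `0` and `v₀` that meet the cone over `S`. -/
def joinSet (i : Fin 4) (v₀ : C4) (S : Set C3) : Set C4 :=
  {b | ∃ (s μ : ℂ), ∃ z ∈ S, b = μ • (i.insertNth (1 : ℂ) z : C4) + s • v₀}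

theorem joinSet_mono {i : Fin 4} {v₀ : C4} {S T : Set C3} (h : S ⊆ T) :
    joinSet i v₀ S ⊆ joinSet i v₀ T := by
  rintro b ⟨s, μ, z, hz, rfl⟩
  exact ⟨s, μ, z, h hz, rfl⟩

theorem joinSet_biUnion {ι : Type*} {i : Fin 4} {v₀ : C4} {S : ι → Set C3} {t : Set ι} :
    joinSet i v₀ (⋃ x ∈ t, S x) = ⋃ x ∈ t, joinSet i v₀ (S x) := by
  ext b
  simp only [joinSet, mem_iUnion, mem_ofPred_eq, exists_prop]
  constructor
  · rintro ⟨s, μ, z, ⟨x, hx, hz⟩, rfl⟩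
    exact ⟨x, hx, s, μ, z, hz, rfl⟩
  · rintro ⟨x, hx, s, μ, z, hz, rfl⟩
    exact ⟨s, μ, z, ⟨x, hx, hz⟩, rfl⟩

/-- The local piece is a smooth image of a convex subset of W × ℂ × ℂ; the two complex scalars
account for the 4. -/
theorem IsSlice.dimH_joinSet_le {S : Set C3} {a : C3} {e : OpenPartialHomeomorph C3 C3}
    {W : Submodule ℝ C3} (h : IsSlice S a e W) (i : Fin 4) (v₀ : C4) :
    ∃ V ∈ 𝓝 a, dimH (joinSet i v₀ (S ∩ V)) ≤ (finrank ℝ W + 4 : ℕ) := by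
  obtain ⟨r, hr, hball⟩ := Metric.isOpen_iff.1 e.open_target (e a) (e.map_source h.mem_source)
  have hV : e.source ∩ e ⁻¹' Metric.ball (e a) r ∈ 𝓝 a :=
    inter_mem (e.open_source.mem_nhds h.mem_source)
      ((e.continuousAt h.mem_source) (Metric.ball_mem_nhds _ hr))
  refine ⟨_, hV, ?_⟩
  set f : W × ℂ × ℂ → C4 := fun x =>
    x.2.1 • (i.insertNth (1 : ℂ) (e.symm x.1) : C4) + x.2.2 • v₀ with hf
  set B : Set (W × ℂ × ℂ) := {x | (x.1 : C3) ∈ Metric.ball (e a) r} with hB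
  have hconv : Convex ℝ B := by
    have := (convex_ball (e a) r).linear_preimage (W.subtype ∘ₗ LinearMap.fst ℝ W (ℂ × ℂ))
    exact this
  have hsm : ContDiffOn ℝ 1 f B := by
    have h1 : ContDiffOn ℝ 1 (fun x : W × ℂ × ℂ => e.symm x.1) B := by
      refine ContDiffOn.comp (t := e.target) (h.contDiffOn_symm.of_le (by simp)) ?_
        fun x hx => hball hx
      exact (W.subtypeL.contDiff.comp contDiff_fst).contDiffOn
    have h2 : ContDiffOn ℝ 1 (fun x : W × ℂ × ℂ => (i.insertNth (1 : ℂ) (e.symm x.1) : C4)) B := by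
      refine contDiffOn_pi.2 fun k => ?_
      refine Fin.succAboveCases i ?_ (fun l => ?_) k
      · simpa using contDiffOn_const
      · simpa using contDiffOn_pi.1 h1 l
    refine ContDiffOn.add ?_ ?_
    · exact ContDiffOn.smul (contDiff_fst.comp contDiff_snd).contDiffOn h2
    · exact ContDiffOn.smul (contDiff_snd.comp contDiff_snd).contDiffOn contDiffOn_const
  have hsub : joinSet i v₀ (S ∩ (e.source ∩ e ⁻¹' Metric.ball (e a) r)) ⊆ f '' B := by
    rintro _ ⟨s, μ, z, ⟨hzS, hz, hzb⟩, rfl⟩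
    refine ⟨(⟨e z, (h.mem_iff z hz).1 hzS⟩, μ, s), hzb, ?_⟩
    simp [hf, e.left_inv hz]
  calc dimH (joinSet i v₀ (S ∩ (e.source ∩ e ⁻¹' Metric.ball (e a) r)))
      ≤ dimH (f '' B) := dimH_mono hsub
    _ ≤ dimH B := hsm.dimH_image_le hconv subset_rfl
    _ ≤ dimH (univ : Set (W × ℂ × ℂ)) := dimH_mono (subset_univ _)
    _ = (finrank ℝ (W × ℂ × ℂ) : ℕ) := Real.dimH_univ_eq_finrank _
    _ = (finrank ℝ W + 4 : ℕ) := by simp [Module.finrank_prod]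

theorem IsLocallyFiniteUnion.dimH_joinSet_le {k : ℕ} {Λ : Set C3} (h : IsLocallyFiniteUnion k Λ)
    (i : Fin 4) (v₀ : C4) : dimH (joinSet i v₀ Λ) ≤ (k + 4 : ℕ) := by
  have hloc : ∀ x : C3, ∃ V : Set C3, x ∈ Λ → V ∈ 𝓝[Λ] x ∧ dimH (joinSet i v₀ (Λ ∩ V)) ≤ (k + 4 : ℕ) := by
    intro x
    by_cases hx : x ∈ Λ
    · obtain ⟨U, hU, hxU, 𝓜, h𝓜, hM, hΛ⟩ := h x hx
      have h1 : ∀ M ∈ 𝓜, ∃ V ∈ 𝓝 x, dimH (joinSet i v₀ (M ∩ V)) ≤ (k + 4 : ℕ) := by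
        intro M hMm
        by_cases hxM : x ∈ M
        · obtain ⟨e, W, he, hW⟩ := (hM M hMm).1 x hxM
          rw [← hW]
          exact he.dimH_joinSet_le i v₀
        · refine ⟨(closure M)ᶜ, isClosed_closure.isOpen_compl.mem_nhds fun hc =>
            hxM ((hM M hMm).2 ⟨hc, hxU⟩), ?_⟩
          have : joinSet i v₀ (M ∩ (closure M)ᶜ) = ∅ := by
            rw [eq_empty_iff_forall_notMem]
            rintro _ ⟨s, μ, z, ⟨hz, hz'⟩, rfl⟩
            exact hz' (subset_closure hz)
          simp [this]
      choose! V hV hVd using h1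
      refine ⟨U ∩ ⋂ M ∈ 𝓜, V M, fun _ => ⟨mem_nhdsWithin_of_mem_nhds (inter_mem (hU.mem_nhds hxU)
        ((biInter_mem h𝓜).2 hV)), ?_⟩⟩
      have h2 : Λ ∩ (U ∩ ⋂ M ∈ 𝓜, V M) ⊆ ⋃ M ∈ 𝓜, M ∩ V M := by
        rintro z ⟨hz, hzU, hzV⟩
        have h3 : z ∈ ⋃₀ 𝓜 := by rw [← hΛ]; exact ⟨hz, hzU⟩
        obtain ⟨M, hMm, hzM⟩ := h3
        exact mem_biUnion hMm ⟨hzM, mem_iInter₂.1 hzV M hMm⟩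
      refine (dimH_mono (joinSet_mono h2)).trans ?_
      rw [joinSet_biUnion, dimH_bUnion h𝓜.countable]
      exact iSup₂_le fun M hMm => hVd M hMm
    · exact ⟨univ, fun h => absurd h hx⟩
  choose V hV using hloc
  obtain ⟨t, ht, htc, hcov⟩ := TopologicalSpace.countable_cover_nhdsWithin (s := Λ) (f := V)
    fun x hx => (hV x hx).1
  have h2 : Λ ⊆ ⋃ x ∈ t, Λ ∩ V x := by
    intro z hz
    obtain ⟨x, hx, hzx⟩ := mem_iUnion₂.1 (hcov hz)
    exact mem_biUnion hx ⟨hz, hzx⟩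
  refine (dimH_mono (joinSet_mono h2)).trans ?_
  rw [joinSet_biUnion, dimH_bUnion htc]
  exact iSup₂_le fun x hx => (hV x (ht hx)).2

/-- A bad `b` lies on a plane through `v₀` that meets the cone over the complement of `D`. These
planes fill dimension at most k + 4, less than the real dimension 8 of ℂ⁴. -/
theorem dense_setOf_line {k : ℕ} (hk : k < 4) {D : TopologicalSpace.Opens CP3}
    (h : IsLocallyFiniteUnionOfSubmanifolds k (D : Set CP3)ᶜ) {v₀ : C4} (hv₀ : pt v₀ ∈ D) :
    Dense {b : C4 | ∀ o, lin v₀ b o ≠ 0 → pt (lin v₀ b o) ∈ D} := by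
  have h1 : dimH (⋃ i : Fin 4, joinSet i v₀ (affinePoint i ⁻¹' (D : Set CP3)ᶜ)) <
      finrank ℝ C4 := by
    rw [dimH_iUnion]
    have h2 : ((k + 4 : ℕ) : ENNReal) < (finrank ℝ C4 : ℕ) := by
      have : finrank ℝ C4 = 8 := by simp [Module.finrank_pi_fintype]
      rw [this]
      exact_mod_cast (by omega : k + 4 < 8)
    exact (iSup_le fun i => (h.preimage i).dimH_joinSet_le i v₀).trans_lt h2
  refine (dense_compl_of_dimH_lt_finrank h1).mono ?_
  intro b hb o ho
  by_contra hD
  by_cases ho2 : o.2 = 0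
  · have ho1 : o.1 ≠ 0 := by
      intro h
      simp [lin, h, ho2] at ho
    apply hD
    simp only [lin, ho2, zero_smul, add_zero]
    rwa [pt_smul ho1]
  · obtain ⟨i, hi⟩ := exists_mem_chartDomain (pt (lin v₀ b o))
    apply hb
    -- Solve u = o₁v₀ + o₂b for b, where u represents a point of Λ.
    refine mem_iUnion.2 ⟨i, -(o.1 / o.2), lin v₀ b o i / o.2, aff i (lin v₀ b o), ?_, ?_⟩
    · rw [mem_preimage, affinePoint_aff ((pt_mem_chartDomain_iff ho).1 hi)]
      exact hD
    · have hi' := (pt_mem_chartDomain_iff ho).1 hi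
      have h3 : lin v₀ b o i • (i.insertNth (1 : ℂ) (aff i (lin v₀ b o)) : C4) = lin v₀ b o := by
        funext a
        refine Fin.succAboveCases i ?_ (fun l => ?_) a
        · simp
        · simp [aff, mul_div_cancel₀ _ hi']
      rw [div_eq_inv_mul, mul_smul, h3, lin, smul_add, smul_smul, smul_smul,
        inv_mul_cancel₀ ho2, one_smul, neg_smul, div_eq_inv_mul]
      abel

theorem exists_line_subset {k : ℕ} (hk : k < 4) {D : TopologicalSpace.Opens CP3}
    (h : IsLocallyFiniteUnionOfSubmanifolds k (D : Set CP3)ᶜ) {v₀ : C4} (hv : v₀ ≠ 0)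
    (hv₀ : pt v₀ ∈ D) : ∃ b, ∀ o, o ≠ 0 → lin v₀ b o ≠ 0 ∧ pt (lin v₀ b o) ∈ D := by
  obtain ⟨a, ha⟩ : ∃ a, v₀ a ≠ 0 := Function.ne_iff.1 hv
  obtain ⟨a', ha'⟩ : ∃ a' : Fin 4, a' ≠ a := exists_ne a
  -- A nonzero 2 × 2 minor makes `b` independent of `v₀`; this open condition is compatible with the
  -- dense one.
  have hopen : IsOpen {b : C4 | v₀ a * b a' - b a * v₀ a' ≠ 0} := by
    apply isOpen_ne_fun <;> fun_prop
  obtain ⟨b, hb1, hb2⟩ := (dense_setOf_line hk h hv₀).inter_open_nonempty _ hopen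
    ⟨Pi.single a' 1, by simp [ha, ha'.symm]⟩
  have hne : ∀ o : ℂ × ℂ, o ≠ 0 → lin v₀ b o ≠ 0 := by
    intro o ho h0
    have h1 : o.1 * v₀ a + o.2 * b a = 0 := congrFun h0 a
    have h2 : o.1 * v₀ a' + o.2 * b a' = 0 := congrFun h0 a'
    have h3 : o.2 * (v₀ a * b a' - b a * v₀ a') = 0 := by
      linear_combination v₀ a * h2 - v₀ a' * h1
    have h4 : o.2 = 0 := (mul_eq_zero.1 h3).resolve_right hb1
    rw [h4, zero_mul, add_zero] at h1
    exact ho (Prod.ext ((mul_eq_zero.1 h1).resolve_right ha) h4)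
  exact ⟨b, fun o ho => ⟨hne o ho, hb2 o (hne o ho)⟩⟩

theorem dense_of_isLocallyFiniteUnion {k : ℕ} (hk : k < 4) {D : TopologicalSpace.Opens CP3}
    (hD : (D : Set CP3).Nonempty)
    (h : IsLocallyFiniteUnionOfSubmanifolds k (D : Set CP3)ᶜ) : Dense (D : Set CP3) := by
  obtain ⟨p, hp⟩ := hD
  obtain ⟨v₀, hv0, rfl⟩ := exists_pt_eq p
  intro q
  obtain ⟨w, hw, rfl⟩ := exists_pt_eq q
  rw [mem_closure_iff_nhds]
  intro V hV
  have h1 : ∀ᶠ u in 𝓝 w, pt u ∈ V ∧ u ≠ 0 :=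
    ((continuousAt_pt hw).eventually hV).and (isOpen_ne.mem_nhds hw)
  obtain ⟨u, hu, hu'⟩ := mem_closure_iff_nhds.1 (dense_setOf_line hk h hp w) _ h1
  refine ⟨pt u, hu.1, ?_⟩
  have := hu' (0, 1)
  simp only [lin, zero_smul, one_smul, zero_add] at this
  exact this hu.2

theorem exists_direction_of_covers {k : ℕ} (hk : k < 4) {D : TopologicalSpace.Opens CP3}
    (hD : (D : Set CP3).Nonempty) {X : Type*} [TopologicalSpace X] [T2Space X] [CompactSpace X]
    [ChartedSpace C3 X] (hX : Covers D X)
    (h : IsLocallyFiniteUnionOfSubmanifolds k (D : Set CP3)ᶜ) {i : Fin 4} {y : C3}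
    (hy : affinePoint i y ∈ (D : Set CP3)ᶜ) :
    ∃ c : C3, c ≠ 0 ∧ ∀ t : ℂ, affinePoint i (y + t • c) ∈ (D : Set CP3)ᶜ := by
  obtain ⟨π, h1, h2, h3⟩ := hX
  exact exists_direction_compl h1 h2 h3 (fun v hv hv' => exists_line_subset hk h hv hv')
    (dense_of_isLocallyFiniteUnion hk hD h) hy

end Dimension

end CP3

namespace CP3

open Filter Module

/-! ### Smooth inverse functions. -/

section Calculus

/-- A continuous linear map with kernel `W`. -/
theorem exists_continuousLinearMap_ker (W : Submodule ℝ C3) :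
    ∃ R : C3 →L[ℝ] C3, ∀ y, y ∈ W ↔ R y = 0 := by
  obtain ⟨g, hg⟩ := W.subtype.exists_leftInverse_of_injective W.ker_subtype
  refine ⟨LinearMap.toContinuousLinearMap (LinearMap.id - W.subtype ∘ₗ g), fun y => ?_⟩
  constructor
  · intro hy
    have h1 : g y = ⟨y, hy⟩ := DFunLike.congr_fun hg ⟨y, hy⟩
    simp [h1]
  · intro hy
    have h1 : y - (g y : C3) = 0 := hy
    rw [sub_eq_zero.1 h1]
    exact (g y).2

theorem hasFDerivAt_mem {E : Type*} [NormedAddCommGroup E] [NormedSpace ℝ E] {W : Submodule ℝ C3}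
    {f : E → C3} {f' : E →L[ℝ] C3} {x : E} (h : HasFDerivAt f f' x) (hW : ∀ᶠ y in 𝓝 x, f y ∈ W)
    (v : E) : f' v ∈ W := by
  obtain ⟨R, hR⟩ := exists_continuousLinearMap_ker W
  rw [hR]
  have h1 := R.hasFDerivAt.comp x h
  have h2 := h1.unique ((hasFDerivAt_const (0 : C3) x).congr_of_eventuallyEq
    (hW.mono fun y hy => (hR _).1 hy))
  exact DFunLike.congr_fun h2 v

/-- The inverse function theorem, with the source cut down to points where the derivative is
invertible, so that the inverse is smooth on its whole domain. -/
theorem exists_smooth_openPartialHomeomorph {E F : Type*} [NormedAddCommGroup E] [NormedSpace ℝ E]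
    [FiniteDimensional ℝ E] [NormedAddCommGroup F] [NormedSpace ℝ F] [FiniteDimensional ℝ F]
    {f : E → F} {Ω : Set E} (hΩ : IsOpen Ω) {a : E} (ha : a ∈ Ω) (hf : ContDiffOn ℝ ∞ f Ω)
    (hinj : ∀ v, fderiv ℝ f a v = 0 → v = 0) (hdim : finrank ℝ E = finrank ℝ F) :
    ∃ Φ : OpenPartialHomeomorph E F, a ∈ Φ.source ∧ Φ.source ⊆ Ω ∧ ⇑Φ = f ∧
      ContDiffOn ℝ ∞ Φ Φ.source ∧ ContDiffOn ℝ ∞ Φ.symm Φ.target := by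
  have := FiniteDimensional.complete ℝ E
  have hker : LinearMap.ker (fderiv ℝ f a : E →ₗ[ℝ] F) = ⊥ := LinearMap.ker_eq_bot'.2 hinj
  let L : E ≃L[ℝ] F := (LinearEquiv.ofInjectiveOfFinrankEq (fderiv ℝ f a : E →ₗ[ℝ] F)
    (LinearMap.ker_eq_bot.1 hker) hdim).toContinuousLinearEquiv
  have hL : (L : E →L[ℝ] F) = fderiv ℝ f a := by
    ext v
    rfl
  have hfa : ContDiffAt ℝ ∞ f a := hf.contDiffAt (hΩ.mem_nhds ha)
  have hstrict : HasStrictFDerivAt f (L : E →L[ℝ] F) a := by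
    rw [hL]
    exact hfa.hasStrictFDerivAt (by simp)
  set s : Set E := Ω ∩ fderiv ℝ f ⁻¹' (range ((↑) : (E ≃L[ℝ] F) → E →L[ℝ] F)) with hs
  have hso : IsOpen s := (hf.continuousOn_fderiv_of_isOpen hΩ (by simp)).isOpen_inter_preimage hΩ
    ContinuousLinearEquiv.isOpen
  set Φ := (hstrict.toOpenPartialHomeomorph f).restrOpen s hso with hΦ
  have hsrc : Φ.source ⊆ s := fun x hx => hx.2
  refine ⟨Φ, ⟨hstrict.mem_toOpenPartialHomeomorph_source, ha, L, hL⟩,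
    fun x hx => (hsrc hx).1, rfl, hf.mono fun x hx => (hsrc hx).1, ?_⟩
  intro y hy
  obtain ⟨h1, L', hL'⟩ := hsrc (Φ.map_target hy)
  have h2 := hf.contDiffAt (hΩ.mem_nhds h1)
  refine (Φ.contDiffAt_symm (f₀' := L') hy ?_ h2).contDiffWithinAt
  rw [hL']
  exact (h2.differentiableAt (by simp)).hasFDerivAt

end Calculus

/-! ### Submanifolds of ℂ³: dense lines, complex tangents, graphs. -/

section Slices

variable {S : Set C3} {a : C3} {e : OpenPartialHomeomorph C3 C3} {W : Submodule ℝ C3}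

theorem IsSlice.hasFDerivAt (h : IsSlice S a e W) {z : C3} (hz : z ∈ e.source) :
    HasFDerivAt e (fderiv ℝ e z) z :=
  ((h.contDiffOn.contDiffAt (e.open_source.mem_nhds hz)).differentiableAt (by simp)).hasFDerivAt

theorem IsSlice.hasFDerivAt_symm (h : IsSlice S a e W) {w : C3} (hw : w ∈ e.target) :
    HasFDerivAt e.symm (fderiv ℝ e.symm w) w :=
  ((h.contDiffOn_symm.contDiffAt (e.open_target.mem_nhds hw)).differentiableAt
    (by simp)).hasFDerivAt

theorem IsSlice.fderiv_fderiv_symm (h : IsSlice S a e W) {z : C3} (hz : z ∈ e.source) (v : C3) :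
    fderiv ℝ e z (fderiv ℝ e.symm (e z) v) = v := by
  have h1 := h.hasFDerivAt_symm (e.map_source hz)
  have h2 : HasFDerivAt e (fderiv ℝ e z) (e.symm (e z)) := by
    rw [e.left_inv hz]
    exact h.hasFDerivAt hz
  have h3 := h2.comp _ h1
  have h4 := h3.unique ((hasFDerivAt_id _).congr_of_eventuallyEq (by
    filter_upwards [e.open_target.mem_nhds (e.map_source hz)] with w hw
    exact e.right_inv hw))
  exact DFunLike.congr_fun h4 v

/-- A submanifold of dimension `k` inside another one of the same dimension is open in it. -/
theorem IsSlice.eventually_mem_of_subset {A B : Set C3} {z : C3}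
    {eA eB : OpenPartialHomeomorph C3 C3} {WA WB : Submodule ℝ C3} (hA : IsSlice A z eA WA)
    (hB : IsSlice B z eB WB) (hdim : finrank ℝ WA = finrank ℝ WB) (hz : z ∈ A)
    (hAB : ∀ᶠ u in 𝓝 z, u ∈ A → u ∈ B) : ∀ᶠ u in 𝓝 z, u ∈ B → u ∈ A := by
  obtain ⟨g, hg⟩ := WB.subtype.exists_leftInverse_of_injective WB.ker_subtype
  set P : C3 →L[ℝ] WB := LinearMap.toContinuousLinearMap g with hP
  have hPW : ∀ y (hy : y ∈ WB), P y = ⟨y, hy⟩ := fun y hy => DFunLike.congr_fun hg ⟨y, hy⟩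
  set w₀ : WA := ⟨eA z, (hA.mem_iff z hA.mem_source).1 hz⟩ with hw₀
  have hw₀t : (w₀ : C3) ∈ eA.target := eA.map_source hA.mem_source
  have hw₀z : eA.symm w₀ = z := eA.left_inv hA.mem_source
  -- The inclusion of A in B, read in the two charts. Its derivative is injective into a space of
  -- equal dimension, hence onto, so the image of A is a neighbourhood in B.
  set F : WA → C3 := fun w => eB (eA.symm w) with hF
  have hcsymm : Tendsto (fun w : WA => eA.symm w) (𝓝 w₀) (𝓝 z) := by
    have h1 : ContinuousAt eA.symm (w₀ : C3) := eA.symm.continuousAt hw₀t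
    have h2 : ContinuousAt (fun w : WA => eA.symm w) w₀ :=
      ContinuousAt.comp (f := fun w : WA => (w : C3)) (x := w₀) h1 continuous_subtype_val.continuousAt
    rwa [ContinuousAt, hw₀z] at h2
  have hs : ∀ᶠ w : WA in 𝓝 w₀, (w : C3) ∈ eA.target ∧ eA.symm w ∈ eB.source ∧ eA.symm w ∈ A ∧
      F w ∈ WB := by
    have h1 : ∀ᶠ w : WA in 𝓝 w₀, (w : C3) ∈ eA.target :=
      continuous_subtype_val.continuousAt (eA.open_target.mem_nhds hw₀t)
    filter_upwards [h1, hcsymm (eB.open_source.mem_nhds hB.mem_source), hcsymm.eventually hAB]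
      with w h2 h3 h4
    have h5 : eA.symm w ∈ A := by
      rw [hA.mem_iff _ (eA.map_target h2), eA.right_inv h2]
      exact w.2
    exact ⟨h2, h3, h5, (hB.mem_iff _ h3).1 (h4 h5)⟩
  have hsm : ContDiffAt ℝ ∞ F w₀ := by
    have h1 : ContDiffAt ℝ ∞ (fun w : WA => eA.symm w) w₀ :=
      (hA.contDiffOn_symm.contDiffAt (eA.open_target.mem_nhds hw₀t)).comp w₀
        WA.subtypeL.contDiff.contDiffAt
    refine ContDiffAt.comp (g := eB) w₀ ?_ h1
    rw [hw₀z]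
    exact hB.contDiffOn.contDiffAt (eB.open_source.mem_nhds hB.mem_source)
  have hFd := (hsm.differentiableAt (by simp)).hasFDerivAt
  have hFW : ∀ v, fderiv ℝ F w₀ v ∈ WB := hasFDerivAt_mem hFd (hs.mono fun w hw => hw.2.2.2)
  have hFinj : ∀ v, fderiv ℝ F w₀ v = 0 → v = 0 := by
    intro v hv
    have h1 : HasFDerivAt F (((fderiv ℝ eB z).comp (fderiv ℝ eA.symm w₀)).comp WA.subtypeL) w₀ := by
      have h3 : HasFDerivAt eB (fderiv ℝ eB z) (eA.symm (w₀ : C3)) := by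
        rw [hw₀z]
        exact hB.hasFDerivAt hB.mem_source
      exact (h3.comp _ (hA.hasFDerivAt_symm hw₀t)).comp w₀ WA.subtypeL.hasFDerivAt
    rw [h1.fderiv] at hv
    have h4 : fderiv ℝ eB z (fderiv ℝ eA.symm w₀ v) = 0 := hv
    have h5 : HasFDerivAt eB.symm (fderiv ℝ eB.symm (eB z)) (eB z) :=
      hB.hasFDerivAt_symm (eB.map_source hB.mem_source)
    have h6 := (h5.comp z (hB.hasFDerivAt hB.mem_source)).unique
      ((hasFDerivAt_id z).congr_of_eventuallyEq (by
        filter_upwards [eB.open_source.mem_nhds hB.mem_source] with w hw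
        exact eB.left_inv hw))
    have h7 : fderiv ℝ eA.symm w₀ (v : C3) = 0 := by
      have := DFunLike.congr_fun h6 (fderiv ℝ eA.symm w₀ v)
      simp only [ContinuousLinearMap.comp_apply, h4, map_zero] at this
      exact this.symm
    have h8 := hA.fderiv_fderiv_symm hA.mem_source (v : C3)
    rw [show eA z = (w₀ : C3) from rfl, h7, map_zero] at h8
    exact Subtype.ext h8.symm
  have hstrict : HasStrictFDerivAt (fun w => P (F w)) (P.comp (fderiv ℝ F w₀)) w₀ :=
    P.hasStrictFDerivAt.comp w₀ (hsm.hasStrictFDerivAt (by simp))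
  have hinj : Function.Injective (P.comp (fderiv ℝ F w₀) : WA →ₗ[ℝ] WB) := by
    rw [← LinearMap.ker_eq_bot, LinearMap.ker_eq_bot']
    intro v hv
    apply hFinj
    have h1 : P (fderiv ℝ F w₀ v) = 0 := hv
    rw [hPW _ (hFW v)] at h1
    exact congrArg Subtype.val h1
  have hsurj : LinearMap.range (P.comp (fderiv ℝ F w₀) : WA →ₗ[ℝ] WB) = ⊤ :=
    LinearMap.range_eq_top.2
      ((LinearMap.injective_iff_surjective_of_finrank_eq_finrank hdim).1 hinj)
  have hmap := hstrict.map_nhds_eq_of_surj hsurj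
  have himg : (fun w => P (F w)) '' {w : WA | (w : C3) ∈ eA.target ∧ eA.symm w ∈ eB.source ∧
      eA.symm w ∈ A ∧ F w ∈ WB} ∈ 𝓝 (P (F w₀)) := by
    rw [← hmap]
    exact image_mem_map hs
  have hcB : Tendsto (fun u => P (eB u)) (𝓝 z) (𝓝 (P (F w₀))) := by
    have h1 : ContinuousAt (fun u => P (eB u)) z :=
      P.continuous.continuousAt.comp (eB.continuousAt hB.mem_source)
    have h2 : Tendsto (fun u => P (eB u)) (𝓝 z) (𝓝 (P (eB z))) := h1
    simpa only [hF, hw₀z] using h2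
  filter_upwards [hcB himg, eB.open_source.mem_nhds hB.mem_source] with u hu huB huM
  obtain ⟨w, ⟨hw1, hw2, hw3, hw4⟩, hw⟩ := hu
  have h1 := (hB.mem_iff u huB).1 huM
  have h2 : F w = eB u := by
    have h3 : P (F w) = P (eB u) := hw
    rw [hPW _ hw4, hPW _ h1] at h3
    exact congrArg Subtype.val h3
  have h4 : eA.symm w = u := eB.injOn hw2 huB h2
  rwa [← h4]

/-- The submanifold `M` contains, near a dense set of its points, lines that lie in `Λ`. -/
def HasDenseLines (M Λ : Set C3) : Prop :=
  ∀ y ∈ M, ∀ N ∈ 𝓝 y, ∃ z ∈ M, z ∈ N ∧ ∃ c : C3, c ≠ 0 ∧ (∀ t : ℂ, z + t • c ∈ Λ) ∧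
    ∀ᶠ t : ℂ in 𝓝 0, z + t • c ∈ M

theorem tendsto_add_smul (z c : C3) : Tendsto (fun t : ℂ => z + t • c) (𝓝 0) (𝓝 z) := by
  have : Continuous fun t : ℂ => z + t • c := by fun_prop
  simpa using this.tendsto 0

/-- At points of M where Λ reduces locally to M, the line of Λ cannot leave M. Such points are dense
because only finitely many pieces compete near each point. -/
theorem IsLocallyFiniteUnion.hasDenseLines {k : ℕ} {Λ M : Set C3} (h : IsLocallyFiniteUnion k Λ)
    (hP : ∀ a ∈ Λ, ∃ c : C3, c ≠ 0 ∧ ∀ t : ℂ, a + t • c ∈ Λ) (hM : IsSubmanifold k M)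
    (hMΛ : M ⊆ Λ) : HasDenseLines M Λ := by
  intro y hy N hN
  obtain ⟨U, hU, hyU, 𝓜, h𝓜, hM', hΛ⟩ := h y (hMΛ hy)
  obtain ⟨O, hON, hO, hyO⟩ := mem_nhds_iff.1 (inter_mem hN (hU.mem_nhds hyU))
  -- Treat the pieces one at a time: if `T` does not contain M near the current point, move to a
  -- point of M off `T` and shrink the neighbourhood away from it.
  have key : ∀ 𝓣 : Set (Set C3), 𝓣.Finite → 𝓣 ⊆ 𝓜 → ∃ O' ⊆ O, IsOpen O' ∧ ∃ z ∈ M, z ∈ O' ∧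
      ∀ T ∈ 𝓣, M ∩ O' ⊆ T ∨ Disjoint O' T := by
    intro 𝓣 h𝓣
    induction 𝓣, h𝓣 using Set.Finite.induction_on with
    | empty => exact fun _ => ⟨O, subset_rfl, hO, y, hy, hyO, by simp⟩
    | @insert T 𝓣 _ _ ih =>
      intro hsub
      obtain ⟨O', hO'O, hO', z, hz, hzO', hT⟩ := ih ((subset_insert _ _).trans hsub)
      by_cases hMT : M ∩ O' ⊆ T
      · refine ⟨O', hO'O, hO', z, hz, hzO', ?_⟩
        rintro T' (rfl | hT')
        · exact Or.inl hMT
        · exact hT T' hT'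
      · obtain ⟨z', ⟨hz'M, hz'O⟩, hz'T⟩ := not_subset.1 hMT
        have hcl : z' ∉ closure T := fun hc =>
          hz'T ((hM' T (hsub (mem_insert _ _))).2 ⟨hc, (hON (hO'O hz'O)).2⟩)
        refine ⟨O' ∩ (closure T)ᶜ, inter_subset_left.trans hO'O,
          hO'.inter isClosed_closure.isOpen_compl, z', hz'M, ⟨hz'O, hcl⟩, ?_⟩
        rintro T' (rfl | hT')
        · right
          rw [disjoint_left]
          exact fun u hu huT => hu.2 (subset_closure huT)
        · rcases hT T' hT' with h1 | h1
          · exact Or.inl fun u hu => h1 ⟨hu.1, hu.2.1⟩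
          · exact Or.inr (h1.mono_left inter_subset_left)
  obtain ⟨O', hO'O, hO', z, hz, hzO', hT⟩ := key 𝓜 h𝓜 subset_rfl
  have hnear : ∀ᶠ u in 𝓝 z, u ∈ Λ → u ∈ M := by
    have h1 : ∀ T ∈ 𝓜, ∀ᶠ u in 𝓝 z, u ∈ T → u ∈ M := by
      intro T hTm
      rcases hT T hTm with h1 | h1
      · obtain ⟨eA, WA, hA, hWA⟩ := hM z hz
        obtain ⟨eB, WB, hB, hWB⟩ := (hM' T hTm).1 z (h1 ⟨hz, hzO'⟩)
        refine hA.eventually_mem_of_subset hB (hWA.trans hWB.symm) hz ?_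
        filter_upwards [hO'.mem_nhds hzO'] with u hu hu'
        exact h1 ⟨hu', hu⟩
      · filter_upwards [hO'.mem_nhds hzO'] with u hu hu'
        exact absurd hu' (disjoint_left.1 h1 hu)
    filter_upwards [(biInter_mem h𝓜).2 h1, hO'.mem_nhds hzO'] with u hu huO huΛ
    have h2 : u ∈ ⋃₀ 𝓜 := by
      rw [← hΛ]
      exact ⟨huΛ, (hON (hO'O huO)).2⟩
    obtain ⟨T, hTm, huT⟩ := h2
    exact mem_iInter₂.1 hu T hTm huT
  obtain ⟨c, hc, hcΛ⟩ := hP z (hMΛ hz)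
  refine ⟨z, hz, (hON (hO'O hzO')).1, c, hc, hcΛ, ?_⟩
  filter_upwards [(tendsto_add_smul z c).eventually hnear] with t ht
  exact ht (hcΛ t)

theorem IsSlice.fderiv_smul_mem (h : IsSlice S a e W) {z c : C3} (hz : z ∈ e.source)
    (hc : ∀ᶠ t : ℂ in 𝓝 0, z + t • c ∈ S) (μ : ℂ) : fderiv ℝ e z (μ • c) ∈ W := by
  have h1 : HasFDerivAt (fun t : ℂ => z + t • c)
      ((ContinuousLinearMap.id ℝ ℂ).smulRight c) 0 :=
    (((ContinuousLinearMap.id ℝ ℂ).smulRight c).hasFDerivAt).const_add z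
  have h2 : HasFDerivAt e (fderiv ℝ e z) (z + (0 : ℂ) • c) := by
    simpa using h.hasFDerivAt hz
  have h3 := h2.comp (0 : ℂ) h1
  refine hasFDerivAt_mem (W := W) h3 ?_ μ
  filter_upwards [hc, (tendsto_add_smul z c) (e.open_source.mem_nhds hz)] with t h4 h5
  exact (h.mem_iff _ h5).1 h4

/-- Unit directions of lines at nearby points accumulate, and tangency to S is a closed condition.
-/
theorem IsSlice.exists_complex_tangent {Λ : Set C3} (h : IsSlice S a e W) (ha : a ∈ S)
    (hL : HasDenseLines S Λ) : ∃ b : C3, b ≠ 0 ∧ ∀ μ : ℂ, fderiv ℝ e a (μ • b) ∈ W := by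
  have h1 : ∀ n : ℕ, ∃ z b : C3, z ∈ e.source ∧ dist z a < 1 / (n + 1) ∧ ‖b‖ = 1 ∧
      ∀ μ : ℂ, fderiv ℝ e z (μ • b) ∈ W := by
    intro n
    obtain ⟨z, hz, ⟨hz1, hz2⟩, c, hc, -, hcS⟩ := hL a ha _
      (inter_mem (e.open_source.mem_nhds h.mem_source)
        (Metric.ball_mem_nhds a (Nat.one_div_pos_of_nat (n := n))))
    refine ⟨z, (‖c‖ : ℂ)⁻¹ • c, hz1, hz2, by simp [norm_smul, hc], fun μ => ?_⟩
    rw [smul_smul]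
    exact h.fderiv_smul_mem hz1 hcS _
  choose z b hz hza hb hW using h1
  have hzlim : Tendsto z atTop (𝓝 a) := by
    rw [tendsto_iff_dist_tendsto_zero]
    exact squeeze_zero (fun _ => dist_nonneg) (fun n => (hza n).le)
      tendsto_one_div_add_atTop_nhds_zero_nat
  obtain ⟨b₀, hb₀, φ, hφ, hlim⟩ := (isCompact_sphere (0 : C3) 1).tendsto_subseq
    (x := b) fun n => by simpa using hb n
  refine ⟨b₀, by rintro rfl; simp at hb₀, fun μ => ?_⟩
  have hcont : ContinuousAt (fderiv ℝ e) a :=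
    (h.contDiffOn.continuousOn_fderiv_of_isOpen e.open_source (by simp)).continuousAt
      (e.open_source.mem_nhds h.mem_source)
  have h2 : Tendsto (fun n => fderiv ℝ e (z (φ n)) (μ • b (φ n))) atTop
      (𝓝 (fderiv ℝ e a (μ • b₀))) := by
    have h3 : Tendsto (fun n => fderiv ℝ e (z (φ n))) atTop (𝓝 (fderiv ℝ e a)) :=
      hcont.tendsto.comp (hzlim.comp hφ.tendsto_atTop)
    have h4 : Tendsto (fun n => μ • b (φ n)) atTop (𝓝 (μ • b₀)) := hlim.const_smul μ
    exact ((isBoundedBilinearMap_apply (𝕜 := ℝ) (E := C3) (F := C3)).continuous.tendsto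
      (fderiv ℝ e a, μ • b₀)).comp (h3.prodMk_nhds h4)
  exact W.closed_of_finiteDimensional.mem_of_tendsto h2 (Eventually.of_forall fun n => hW _ μ)

/-- A submanifold is a graph over every space onto which its tangent space projects
isomorphically. -/
theorem IsSlice.exists_graph {F : Type*} [NormedAddCommGroup F] [NormedSpace ℝ F]
    [FiniteDimensional ℝ F] (h : IsSlice S a e W) (ha : a ∈ S) (pr : C3 →L[ℝ] F)
    (hinj : ∀ v, fderiv ℝ e a v ∈ W → pr v = 0 → v = 0) (hdim : finrank ℝ W = finrank ℝ F) :
    ∃ (U : F → C3) (Ω : Set F), IsOpen Ω ∧ pr a ∈ Ω ∧ ContDiffOn ℝ ∞ U Ω ∧ U (pr a) = a ∧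
      (∀ f ∈ Ω, U f ∈ S ∧ pr (U f) = f) ∧ ∀ᶠ y in 𝓝 a, y ∈ S → U (pr y) = y := by
  set w₀ : W := ⟨e a, (h.mem_iff a h.mem_source).1 ha⟩ with hw₀
  have hw₀t : (w₀ : C3) ∈ e.target := e.map_source h.mem_source
  have hw₀a : e.symm w₀ = a := e.left_inv h.mem_source
  set Ω₀ : Set W := Subtype.val ⁻¹' e.target with hΩ₀
  have hΩ₀o : IsOpen Ω₀ := e.open_target.preimage continuous_subtype_val
  have hsm : ContDiffOn ℝ ∞ (fun w : W => e.symm w) Ω₀ :=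
    h.contDiffOn_symm.comp W.subtypeL.contDiff.contDiffOn fun w hw => hw
  have hsm' : ContDiffOn ℝ ∞ (fun w : W => pr (e.symm w)) Ω₀ := pr.contDiff.comp_contDiffOn hsm
  have hd : HasFDerivAt (fun w : W => pr (e.symm w))
      (pr.comp ((fderiv ℝ e.symm w₀).comp W.subtypeL)) w₀ :=
    pr.hasFDerivAt.comp w₀ ((h.hasFDerivAt_symm hw₀t).comp w₀ W.subtypeL.hasFDerivAt)
  obtain ⟨Φ, hΦ1, hΦ2, hΦ3, hΦ4, hΦ5⟩ := exists_smooth_openPartialHomeomorph hΩ₀o (a := w₀) hw₀t hsm'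
    (fun v hv => by
      rw [hd.fderiv] at hv
      have h1 := h.fderiv_fderiv_symm h.mem_source (v : C3)
      have h2 : fderiv ℝ e.symm (e a) (v : C3) = 0 := hinj _ (by rw [h1]; exact v.2) hv
      rw [h2, map_zero] at h1
      exact Subtype.ext h1.symm) hdim
  have hΦw : Φ w₀ = pr a := by rw [hΦ3]; simp only [hw₀a]
  have hΦsymm : ∀ f ∈ Φ.target, ((Φ.symm f : W) : C3) ∈ e.target := fun f hf =>
    hΦ2 (Φ.map_target hf)
  refine ⟨fun f => e.symm (Φ.symm f), Φ.target, Φ.open_target, by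
    rw [← hΦw]; exact Φ.map_source hΦ1, hsm.comp hΦ5 hΦsymm, ?_, ?_, ?_⟩
  · change e.symm (Φ.symm (pr a)) = a
    rw [← hΦw, Φ.left_inv hΦ1, hw₀a]
  · intro f hf
    refine ⟨?_, ?_⟩
    · rw [h.mem_iff _ (e.map_target (hΦsymm f hf)), e.right_inv (hΦsymm f hf)]
      exact (Φ.symm f).2
    · have := Φ.right_inv hf
      rwa [hΦ3] at this
  · have h1 : ∀ᶠ w in 𝓝 w₀, w ∈ Φ.source := Φ.open_source.mem_nhds hΦ1
    rw [nhds_subtype_eq_comap, eventually_comap] at h1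
    filter_upwards [(e.continuousAt h.mem_source).eventually h1,
      e.open_source.mem_nhds h.mem_source] with y hy hye hyS
    have h2 := hy ⟨e y, (h.mem_iff y hye).1 hyS⟩ rfl
    have h3 : Φ ⟨e y, (h.mem_iff y hye).1 hyS⟩ = pr y := by
      rw [hΦ3]
      simp only [e.left_inv hye]
    rw [← h3, Φ.left_inv h2]
    exact e.left_inv hye

end Slices

end CP3

namespace CP3

open Filter Module

/-! ### Graphs containing many lines; the two-dimensional case. -/

section Graphs

variable {S Λ : Set C3} {a : C3} {e : OpenPartialHomeomorph C3 C3} {W : Submodule ℝ C3}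

theorem IsSlice.fderiv_injective (h : IsSlice S a e W) : Function.Injective (fderiv ℝ e a) := by
  have h1 : Function.Surjective (fderiv ℝ e a : C3 →ₗ[ℝ] C3) := fun v =>
    ⟨_, h.fderiv_fderiv_symm h.mem_source v⟩
  exact LinearMap.injective_iff_surjective.2 h1

/-- Carries identities from the points known to lie on lines to the entire graph. -/
theorem eq_zero_of_dense {E F : Type*} [TopologicalSpace E] [TopologicalSpace F] [T1Space F] [Zero F]
    {B : Set E} (hB : IsOpen B) {f : E → F} (hf : ContinuousOn f B)
    (hd : ∀ z ∈ B, ∀ N ∈ 𝓝 z, ∃ z' ∈ B, z' ∈ N ∧ f z' = 0) : ∀ z ∈ B, f z = 0 := by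
  intro z hz
  by_contra h
  have h1 : ∀ᶠ z' in 𝓝 z, f z' ≠ 0 := (hf.continuousAt (hB.mem_nhds hz)).eventually_ne h
  obtain ⟨z', -, hz', h0⟩ := hd z hz _ h1
  exact hz' h0

/-- A graph of a function `U` over a ball, with lines inside the graph through a dense set of its
points. -/
structure IsLinedGraph {F : Type*} [NormedAddCommGroup F] [NormedSpace ℝ F] (S Λ : Set C3)
    (a : C3) (pr : C3 →L[ℝ] F) (U : F → C3) (r : ℝ) : Prop where
  pos : 0 < r
  contDiffOn : ContDiffOn ℝ ∞ U (Metric.ball (pr a) r)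
  map_center : U (pr a) = a
  mem : ∀ f ∈ Metric.ball (pr a) r, U f ∈ S
  pr_eq : ∀ f ∈ Metric.ball (pr a) r, pr (U f) = f
  eventually_eq : ∀ f ∈ Metric.ball (pr a) r, ∀ᶠ y in 𝓝 (U f), y ∈ S → U (pr y) = y
  dense : ∀ f ∈ Metric.ball (pr a) r, ∀ N ∈ 𝓝 f, ∃ f' ∈ Metric.ball (pr a) r, f' ∈ N ∧
    ∃ c : C3, c ≠ 0 ∧ (∀ t : ℂ, U f' + t • c ∈ Λ) ∧
      ∀ᶠ t : ℂ in 𝓝 0, U (f' + pr (t • c)) = U f' + t • c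

theorem IsLinedGraph.eventually_line {F : Type*} [NormedAddCommGroup F] [NormedSpace ℝ F]
    {pr : C3 →L[ℝ] F} {U : F → C3} {r : ℝ} (h : IsLinedGraph S Λ a pr U r) {f : F}
    (hf : f ∈ Metric.ball (pr a) r) {c : C3} (hc : ∀ᶠ t : ℂ in 𝓝 0, U f + t • c ∈ S) :
    ∀ᶠ t : ℂ in 𝓝 0, U (f + pr (t • c)) = U f + t • c := by
  filter_upwards [hc, (tendsto_add_smul (U f) c).eventually (h.eventually_eq f hf)] with t h1 h2
  have := h2 h1
  rwa [map_add, h.pr_eq f hf] at this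

/-- The ball is small enough that, near every point of the graph, S has no points off it; so lines
inside S become lines inside the graph. -/
theorem IsSlice.exists_isLinedGraph {F : Type*} [NormedAddCommGroup F] [NormedSpace ℝ F]
    [FiniteDimensional ℝ F] (h : IsSlice S a e W) (ha : a ∈ S) (hL : HasDenseLines S Λ)
    (pr : C3 →L[ℝ] F) (hinj : ∀ v, fderiv ℝ e a v ∈ W → pr v = 0 → v = 0)
    (hdim : finrank ℝ W = finrank ℝ F) : ∃ U r, IsLinedGraph S Λ a pr U r := by
  obtain ⟨U, Ω, hΩ, haΩ, hU, hUa, hUS, hev⟩ := h.exists_graph ha pr hinj hdim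
  obtain ⟨G, hG, hGo, haG⟩ := eventually_nhds_iff.1 hev
  have hUat : ∀ f ∈ Ω, ContinuousAt U f := fun f hf => hU.continuousOn.continuousAt (hΩ.mem_nhds hf)
  have h1 : ∀ᶠ f in 𝓝 (pr a), f ∈ Ω ∧ U f ∈ G := by
    have h2 : G ∈ 𝓝 (U (pr a)) := hGo.mem_nhds (by rwa [hUa])
    filter_upwards [hΩ.mem_nhds haΩ, (hUat _ haΩ).eventually h2] with f h3 h4 using ⟨h3, h4⟩
  obtain ⟨r, hr, hball⟩ := Metric.eventually_nhds_iff_ball.1 h1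
  have hlocal : ∀ f ∈ Metric.ball (pr a) r, ∀ᶠ y in 𝓝 (U f), y ∈ S → U (pr y) = y := by
    intro f hf
    filter_upwards [hGo.mem_nhds (hball f hf).2] with y hy using hG y hy
  refine ⟨U, r, hr, hU.mono fun f hf => (hball f hf).1, hUa, fun f hf => (hUS f (hball f hf).1).1,
    fun f hf => (hUS f (hball f hf).1).2, hlocal, ?_⟩
  intro f hf N hN
  have hf' := hUS f (hball f hf).1
  have hprc : ContinuousAt pr (U f) := pr.continuous.continuousAt
  have hN' : pr ⁻¹' (N ∩ Metric.ball (pr a) r) ∈ 𝓝 (U f) := by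
    apply hprc
    rw [hf'.2]
    exact inter_mem hN (Metric.isOpen_ball.mem_nhds hf)
  obtain ⟨z, hzS, ⟨⟨hzN, hzb⟩, hzG⟩, c, hc, hcΛ, hcS⟩ := hL (U f) hf'.1 _
    (inter_mem hN' (hGo.mem_nhds (hball f hf).2))
  have hUz : U (pr z) = z := hG z hzG hzS
  refine ⟨pr z, hzb, hzN, c, hc, by rwa [hUz], ?_⟩
  filter_upwards [hcS, (tendsto_add_smul z c).eventually (hGo.mem_nhds hzG)] with t h3 h4
  rw [hUz, ← map_add]
  exact hG _ h4 h3

/-- A submanifold of real dimension two with dense lines is locally a line. -/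
theorem IsSubmanifold.exists_line_of_dim_two (hS : IsSubmanifold 2 S) (hL : HasDenseLines S Λ)
    (ha : a ∈ S) : ∃ c : C3, c ≠ 0 ∧ (∀ t : ℂ, a + t • c ∈ Λ) ∧
      ∀ᶠ y in 𝓝 a, y ∈ S → ∃ t : ℂ, y = a + t • c := by
  obtain ⟨e, W, h, hW⟩ := hS a ha
  obtain ⟨b, hb, hbW⟩ := h.exists_complex_tangent ha hL
  obtain ⟨l, hl⟩ := Function.ne_iff.1 hb
  set pr : C3 →L[ℝ] ℂ := ContinuousLinearMap.proj (R := ℝ) (φ := fun _ : Fin 3 => ℂ) l with hpr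
  have hprs : ∀ (t : ℂ) (v : C3), pr (t • v) = t * pr v := fun t v => rfl
  -- Otherwise ℂb ⊕ ℝv would be three real dimensions inside a two-dimensional tangent space.
  have hinj : ∀ v, fderiv ℝ e a v ∈ W → pr v = 0 → v = 0 := by
    intro v hv hv0
    by_contra hne
    let T : ℂ × ℝ →ₗ[ℝ] W :=
      { toFun := fun x => ⟨fderiv ℝ e a (x.1 • b + x.2 • v), by
          rw [map_add, (fderiv ℝ e a).map_smul x.2 v]
          exact W.add_mem (hbW _) (W.smul_mem _ hv)⟩
        map_add' := fun x y => by
          apply Subtype.ext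
          simp only [Prod.fst_add, Prod.snd_add, add_smul, map_add, Submodule.coe_add]
          abel
        map_smul' := fun s x => by
          apply Subtype.ext
          simp only [Prod.smul_fst, Prod.smul_snd, smul_assoc, ← smul_add, map_smul, RingHom.id_apply,
            Submodule.coe_smul] }
    have hT : Function.Injective T := by
      rw [← LinearMap.ker_eq_bot, LinearMap.ker_eq_bot']
      rintro ⟨μ, s⟩ hx
      have h1 : fderiv ℝ e a (μ • b + s • v) = 0 := congrArg Subtype.val hx
      have h2 : μ • b + s • v = 0 := h.fderiv_injective (h1.trans (map_zero _).symm)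
      have h3 := congrArg pr h2
      rw [map_add, pr.map_smul s v, hv0, smul_zero, add_zero, map_zero, hprs] at h3
      have h4 : μ = 0 := (mul_eq_zero.1 h3).resolve_right hl
      rw [h4, zero_smul, zero_add] at h2
      rw [h4, (smul_eq_zero.1 h2).resolve_right hne]
      rfl
    have := LinearMap.finrank_le_finrank_of_injective hT
    rw [hW, Module.finrank_prod, Complex.finrank_real_complex] at this
    simp at this
  obtain ⟨U, r, hU⟩ := h.exists_isLinedGraph ha hL pr hinj (by rw [hW, Complex.finrank_real_complex])
  set B := Metric.ball (pr a) r with hB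
  have hBo : IsOpen B := Metric.isOpen_ball
  have hline : ∀ f ∈ B, ∀ N ∈ 𝓝 f, ∃ f' ∈ B, f' ∈ N ∧ ∃ c : C3, c ≠ 0 ∧
      (∀ t : ℂ, U f' + t • c ∈ Λ) ∧ U =ᶠ[𝓝 f'] fun g => U f' + (g - f') • c := by
    intro f hf N hN
    obtain ⟨f', hf', hfN, c, hc, hcΛ, hcU⟩ := hU.dense f hf N hN
    -- A vertical line would give several points of the graph over one base point.
    have hpc : pr c ≠ 0 := by
      intro h0
      have h1 : ∀ᶠ t : ℂ in 𝓝 0, t = 0 := by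
        filter_upwards [hcU] with t ht
        rw [hprs, h0, mul_zero, add_zero, left_eq_add] at ht
        exact (smul_eq_zero.1 ht).resolve_right hc
      obtain ⟨t, ht, ht0⟩ := ((frequently_nhdsWithin_iff (s := {(0 : ℂ)}ᶜ)).1
        ((h1.filter_mono nhdsWithin_le_nhds).frequently)).exists
      exact ht0 ht
    refine ⟨f', hf', hfN, (pr c)⁻¹ • c, by simp [hpc, hc], fun t => ?_, ?_⟩
    · rw [smul_smul]
      exact hcΛ _
    · have h1 : Tendsto (fun g : ℂ => (g - f') * (pr c)⁻¹) (𝓝 f') (𝓝 0) := by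
        have : Continuous fun g : ℂ => (g - f') * (pr c)⁻¹ := by fun_prop
        simpa using this.tendsto f'
      filter_upwards [h1.eventually hcU] with g hg
      rw [hprs, mul_assoc, inv_mul_cancel₀ hpc, mul_one, add_sub_cancel] at hg
      rw [hg, smul_smul]
  have hd1 : ContDiffOn ℝ 1 (fderiv ℝ U) B :=
    hU.contDiffOn.fderiv_of_isOpen hBo (by norm_cast)
  have hd2 : ContinuousOn (fderiv ℝ (fderiv ℝ U)) B :=
    hd1.continuousOn_fderiv_of_isOpen hBo le_rfl
  have hDaff : ∀ (p : C3) (f' : ℂ) (c : C3) (g : ℂ), HasFDerivAt (𝕜 := ℝ)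
      (fun g : ℂ => p + (g - f') • c) ((ContinuousLinearMap.id ℝ ℂ).smulRight c) g := by
    intro p f' c g
    have h1 : HasFDerivAt (𝕜 := ℝ) (fun g : ℂ => g - f') (ContinuousLinearMap.id ℝ ℂ) g :=
      (hasFDerivAt_id g).sub_const f'
    exact ((((ContinuousLinearMap.id ℝ ℂ).smulRight c).hasFDerivAt).comp g h1).const_add p
  -- U is affine near a dense set of points, and the second derivative is continuous.
  have hzero : ∀ f ∈ B, fderiv ℝ (fderiv ℝ U) f = 0 := by
    refine eq_zero_of_dense hBo hd2 fun f hf N hN => ?_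
    obtain ⟨f', hf', hfN, c, hc, -, hcU⟩ := hline f hf N hN
    refine ⟨f', hf', hfN, ?_⟩
    have h1 : fderiv ℝ U =ᶠ[𝓝 f'] fun _ => (ContinuousLinearMap.id ℝ ℂ).smulRight c := by
      filter_upwards [hcU.eventually_nhds] with g hg
      rw [Filter.EventuallyEq.fderiv_eq hg]
      exact (hDaff _ _ _ _).fderiv
    rw [h1.fderiv_eq]
    simp
  obtain ⟨f', hf', -, c, hc, hcΛ, hcU⟩ := hline (pr a) (Metric.mem_ball_self hU.pos) univ univ_mem
  have hconst : ∀ f ∈ B, fderiv ℝ U f = (ContinuousLinearMap.id ℝ ℂ).smulRight c := by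
    intro f hf
    have h1 := hBo.is_const_of_fderiv_eq_zero (convex_ball (pr a) r).isPreconnected
      (hd1.differentiableOn one_ne_zero) hzero hf hf'
    rw [h1, hcU.fderiv_eq]
    exact (hDaff _ _ _ _).fderiv
  have haff : ∀ f ∈ B, U f = U f' + (f - f') • c := by
    intro f hf
    have h1 := hBo.is_const_of_fderiv_eq_zero (𝕜 := ℝ)
      (f := fun g => U g - (U f' + (g - f') • c)) (convex_ball (pr a) r).isPreconnected ?_ ?_ hf hf'
    · simpa [sub_eq_zero] using h1
    · intro g hg
      exact ((((hU.contDiffOn.contDiffAt (hBo.mem_nhds hg)).differentiableAt (by simp)).sub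
        (hDaff (U f') f' c g).differentiableAt)).differentiableWithinAt
    · intro g hg
      have h2 : HasFDerivAt U ((ContinuousLinearMap.id ℝ ℂ).smulRight c) g := by
        rw [← hconst g hg]
        exact ((hU.contDiffOn.contDiffAt (hBo.mem_nhds hg)).differentiableAt (by simp)).hasFDerivAt
      have h3 := (h2.sub (hDaff (U f') f' c g)).fderiv
      rw [sub_self] at h3
      exact h3
  have ha' := haff (pr a) (Metric.mem_ball_self hU.pos)
  rw [hU.map_center] at ha'
  refine ⟨c, hc, fun t => ?_, ?_⟩
  · rw [ha', add_assoc, ← add_smul]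
    exact hcΛ _
  · have h1 := hU.eventually_eq (pr a) (Metric.mem_ball_self hU.pos)
    rw [hU.map_center] at h1
    filter_upwards [h1, pr.continuous.continuousAt (hBo.mem_nhds (Metric.mem_ball_self hU.pos))]
      with y hy hyB hyS
    have h2 := haff (pr y) hyB
    rw [hy hyS] at h2
    refine ⟨pr y - pr a, ?_⟩
    calc y = U f' + (pr y - f') • c := h2
      _ = (U f' + (pr a - f') • c) + (pr y - pr a) • c := by
        rw [add_assoc, ← add_smul]
        congr 2
        ring
      _ = a + (pr y - pr a) • c := by rw [← ha']

end Graphs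

end CP3

namespace CP3

open Filter Module

/-! ### Linear coordinates adapted to a three-dimensional submanifold. -/

section Coordinates

/-- The real-linear map `ζ ↦ (ζ, Re (κ ζ))`. -/
noncomputable def slope (κ : ℂ) : ℂ →L[ℝ] ℂ × ℝ :=
  (ContinuousLinearMap.id ℝ ℂ).prod (Complex.reCLM.comp (ContinuousLinearMap.mul ℝ ℂ κ))

@[simp] theorem slope_apply (κ ζ : ℂ) : slope κ ζ = (ζ, (κ * ζ).re) := rfl

theorem slope_sub (κ κ' ζ : ℂ) : slope κ ζ = slope κ' ζ + (0, ((κ - κ') * ζ).re) := by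
  simp [sub_mul]

/-- The projection of `ℂ³` to `ℂ × ℝ` in the linear coordinates `A`. -/
noncomputable def realProj (A : C3 ≃L[ℂ] C3) : C3 →L[ℝ] ℂ × ℝ :=
  ((ContinuousLinearMap.proj (R := ℝ) (φ := fun _ : Fin 3 => ℂ) 0).prod
    (Complex.reCLM.comp (ContinuousLinearMap.proj (R := ℝ) (φ := fun _ : Fin 3 => ℂ) 1))).comp
      ((A : C3 →L[ℂ] C3).restrictScalars ℝ)

@[simp] theorem realProj_apply (A : C3 ≃L[ℂ] C3) (v : C3) :
    realProj A v = (A v 0, (A v 1).re) := rfl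

theorem realProj_smul (A : C3 ≃L[ℂ] C3) {c : C3} (hc : A c 0 = 1) (t : ℂ) :
    realProj A (t • c) = slope (A c 1) t := by
  simp [hc, mul_comm]

variable {S Λ : Set C3} {a : C3} {e : OpenPartialHomeomorph C3 C3} {W : Submodule ℝ C3}

/-- The tangent space is ℂb ⊕ ℝc for a tangent vector `c` outside ℂb. In a complex basis beginning
with b and c it projects isomorphically to the first coordinate and the real part of the second. -/
theorem IsSlice.exists_coordinates (h : IsSlice S a e W) (hW : finrank ℝ W = 3) {b : C3}
    (hb : b ≠ 0) (hbW : ∀ μ : ℂ, fderiv ℝ e a (μ • b) ∈ W) :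
    ∃ A : C3 ≃L[ℂ] C3, ∀ v, fderiv ℝ e a v ∈ W → realProj A v = 0 → v = 0 := by
  obtain ⟨c, hcW, hcb⟩ : ∃ c : C3, fderiv ℝ e a c ∈ W ∧ ∀ μ : ℂ, c ≠ μ • b := by
    by_contra! hcon
    let T : ℂ →ₗ[ℝ] W :=
      { toFun := fun μ => ⟨fderiv ℝ e a (μ • b), hbW μ⟩
        map_add' := fun x y => Subtype.ext (by simp [add_smul])
        map_smul' := fun s x => Subtype.ext (by
          simp only [RingHom.id_apply, Submodule.coe_smul, smul_assoc]
          exact (fderiv ℝ e a).map_smul s (x • b)) }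
    have hT : Function.Surjective T := by
      rintro ⟨w, hw⟩
      have h1 := h.fderiv_fderiv_symm h.mem_source w
      obtain ⟨μ, hμ⟩ := hcon (fderiv ℝ e.symm (e a) w) (by rwa [h1])
      exact ⟨μ, Subtype.ext (by change fderiv ℝ e a (μ • b) = w; rw [← hμ, h1])⟩
    have := LinearMap.finrank_le_finrank_of_surjective hT
    rw [hW, Complex.finrank_real_complex] at this
    omega
  have hli : LinearIndependent ℂ ![b, c] := by
    rw [LinearIndependent.pair_iff' hb]
    exact fun μ hμ => hcb μ hμ.symm
  obtain ⟨d, hd⟩ : ∃ d : C3, d ∉ Submodule.span ℂ (range ![b, c]) := by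
    by_contra! hcon
    have h1 := finrank_range_le_card (R := ℂ) ![b, c]
    have h2 : Submodule.span ℂ (range ![b, c]) = ⊤ := Submodule.eq_top_iff'.2 hcon
    rw [Set.finrank, h2, finrank_top] at h1
    simp at h1
  have hli3 : LinearIndependent ℂ (Fin.snoc ![b, c] d : Fin 3 → C3) :=
    linearIndependent_finSnoc.2 ⟨hli, hd⟩
  let B := basisOfLinearIndependentOfCardEqFinrank hli3 (by simp)
  have hB0 : B 0 = b := by
    simp only [B, coe_basisOfLinearIndependentOfCardEqFinrank]
    rfl
  have hB1 : B 1 = c := by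
    simp only [B, coe_basisOfLinearIndependentOfCardEqFinrank]
    rfl
  let A : C3 ≃L[ℂ] C3 := B.equivFun.toContinuousLinearEquiv
  have hAb : A b = Pi.single 0 1 := by
    change B.equivFun b = _
    rw [← hB0]
    ext j
    simp [Basis.equivFun_self, Pi.single_apply, eq_comm]
  have hAc : A c = Pi.single 1 1 := by
    change B.equivFun c = _
    rw [← hB1]
    ext j
    simp [Basis.equivFun_self, Pi.single_apply, eq_comm]
  refine ⟨A, ?_⟩
  have hproj : ∀ (μ : ℂ) (s : ℝ), realProj A (μ • b + s • c) = (μ, s) := by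
    intro μ s
    rw [map_add, (realProj A).map_smul s c]
    simp [hAb, hAc]
  let T : ℂ × ℝ →ₗ[ℝ] W :=
    { toFun := fun x => ⟨fderiv ℝ e a (x.1 • b + x.2 • c), by
        rw [map_add, (fderiv ℝ e a).map_smul x.2 c]
        exact W.add_mem (hbW _) (W.smul_mem _ hcW)⟩
      map_add' := fun x y => by
        apply Subtype.ext
        simp only [Prod.fst_add, Prod.snd_add, add_smul, map_add, Submodule.coe_add]
        abel
      map_smul' := fun s x => by
        apply Subtype.ext
        simp only [Prod.smul_fst, Prod.smul_snd, smul_assoc, ← smul_add, map_smul, RingHom.id_apply,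
          Submodule.coe_smul] }
  have hT : Function.Injective T := by
    rw [← LinearMap.ker_eq_bot, LinearMap.ker_eq_bot']
    rintro ⟨μ, s⟩ hx
    have h1 : fderiv ℝ e a (μ • b + s • c) = 0 := congrArg Subtype.val hx
    have h2 : μ • b + s • c = 0 := h.fderiv_injective (h1.trans (map_zero _).symm)
    rw [← hproj, h2, map_zero]
  have hTs : Function.Surjective T :=
    (LinearMap.injective_iff_surjective_of_finrank_eq_finrank (by
      rw [hW, Module.finrank_prod, Complex.finrank_real_complex]; simp)).1 hT
  intro v hv hv0
  obtain ⟨⟨μ, s⟩, hx⟩ := hTs ⟨_, hv⟩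
  have h1 : fderiv ℝ e a (μ • b + s • c) = fderiv ℝ e a v := congrArg Subtype.val hx
  have h2 := h.fderiv_injective h1
  rw [← h2, hproj] at hv0
  rw [← h2, show μ = 0 from congrArg Prod.fst hv0, show s = 0 from congrArg Prod.snd hv0]
  simp

end Coordinates

/-! ### The field of line directions on a three-dimensional graph. -/

section Directions

variable {S Λ : Set C3} {a : C3} {A : C3 ≃L[ℂ] C3} {U : ℂ × ℝ → C3} {r : ℝ}

/-- The first slope of the only possible complex tangent of the graph `U`. -/
noncomputable def tangentSlope (A : C3 ≃L[ℂ] C3) (L : ℂ × ℝ →L[ℝ] C3) : ℂ :=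
  let p := (A (L (1, 0)) 1).im
  let q := (A (L (Complex.I, 0)) 1).im
  let s := (A (L (0, 1)) 1).im
  (((q - s * p) / (1 + s ^ 2) : ℝ) : ℂ) + (((p + s * q) / (1 + s ^ 2) : ℝ) : ℂ) * Complex.I

/-- The only possible complex tangent direction of the graph `U`. -/
noncomputable def tangentDir (A : C3 ≃L[ℂ] C3) (L : ℂ × ℝ →L[ℝ] C3) : C3 :=
  L (slope (tangentSlope A L) 1)

/-- Comparing imaginary parts of the second coordinate at ζ = 1 and ζ = i gives p + s Re κ = Im κ
and q − s Im κ = Re κ. The determinant 1 + s² never vanishes, so κ is a smooth function of the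
derivative. -/
theorem eq_tangentDir {L : ℂ × ℝ →L[ℝ] C3} {c : C3}
    (h : ∀ ζ : ℂ, L (slope (A c 1) ζ) = ζ • c) : A c 1 = tangentSlope A L ∧ c = tangentDir A L := by
  set κ := A c 1 with hκ
  have hdec : ∀ ζ : ℂ, L (slope κ ζ) = ζ.re • L (1, 0) + ζ.im • L (Complex.I, 0) +
      (κ * ζ).re • L (0, 1) := by
    intro ζ
    rw [← map_smul, ← map_smul, ← map_smul, ← map_add, ← map_add]
    congr 1
    ext <;> simp
  have hAr : ∀ (s : ℝ) (v : C3), A (s • v) = s • A v := fun s v =>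
    ((A : C3 →L[ℂ] C3).restrictScalars ℝ).map_smul s v
  have h1 : (A (L (1, 0)) 1).im + κ.re * (A (L (0, 1)) 1).im = κ.im := by
    have h2 := congrArg (fun v => (A v 1).im) (h 1)
    rw [hdec] at h2
    simpa [hAr] using h2
  have h2 : (A (L (Complex.I, 0)) 1).im - κ.im * (A (L (0, 1)) 1).im = κ.re := by
    have h2 := congrArg (fun v => (A v 1).im) (h Complex.I)
    rw [hdec] at h2
    simpa [hAr, ← hκ, sub_eq_add_neg] using h2
  have hκ' : κ = tangentSlope A L := by
    simp only [tangentSlope]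
    set p := (A (L (1, 0)) 1).im
    set q := (A (L (Complex.I, 0)) 1).im
    set s := (A (L (0, 1)) 1).im
    have hs : (1 + s ^ 2) ≠ 0 := by positivity
    apply Complex.ext
    · simp only [Complex.add_re, Complex.ofReal_re, Complex.mul_re, Complex.I_re, mul_zero,
        Complex.ofReal_im, Complex.I_im, mul_one, sub_self, add_zero]
      rw [eq_div_iff hs]
      linear_combination (-1 : ℝ) * h2 + s * h1
    · simp only [Complex.add_im, Complex.ofReal_im, Complex.mul_im, Complex.ofReal_re, Complex.I_im,
        mul_one, Complex.I_re, mul_zero, add_zero, zero_add]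
      rw [eq_div_iff hs]
      linear_combination (-1 : ℝ) * h1 - s * h2
  refine ⟨hκ', ?_⟩
  have h3 := h 1
  rw [one_smul] at h3
  rw [tangentDir, ← hκ', h3]

/-- A direction field along a graph over `ℂ × ℝ`: it spans the complex tangent, it is constant
along itself, and the lines in its directions lie in `Λ`. -/
structure IsLineField (Λ : Set C3) (A : C3 ≃L[ℂ] C3) (U β : ℂ × ℝ → C3) (B : Set (ℂ × ℝ)) :
    Prop where
  contDiffOn : ContDiffOn ℝ ∞ β B
  coord : ∀ f ∈ B, A (β f) 0 = 1
  tangent : ∀ f ∈ B, ∀ ζ : ℂ, fderiv ℝ U f (slope (A (β f) 1) ζ) = ζ • β f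
  const : ∀ f ∈ B, ∀ ζ : ℂ, fderiv ℝ β f (slope (A (β f) 1) ζ) = 0
  mem : ∀ f ∈ B, ∀ t : ℂ, U f + t • β f ∈ Λ
  eq_smul : ∀ f ∈ B, ∀ c : C3, c ≠ 0 →
    (∀ᶠ t : ℂ in 𝓝 0, U (f + realProj A (t • c)) = U f + t • c) → ∃ t : ℂ, t ≠ 0 ∧ c = t • β f

/-- If the first coordinate vanished, some real direction on the line would have zero projection, so
that the graph would take several values over one point. -/
theorem coord_ne_zero_of_line {f : ℂ × ℝ} {c : C3} (hc : c ≠ 0)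
    (h : ∀ᶠ t : ℂ in 𝓝 0, U (f + realProj A (t • c)) = U f + t • c) : A c 0 ≠ 0 := by
  intro h0
  obtain ⟨m, hm, hmc⟩ : ∃ m : ℂ, m ≠ 0 ∧ (m * A c 1).re = 0 := by
    by_cases h1 : A c 1 = 0
    · exact ⟨1, one_ne_zero, by simp [h1]⟩
    · refine ⟨Complex.I * (A c 1)⁻¹, mul_ne_zero Complex.I_ne_zero (inv_ne_zero h1), ?_⟩
      rw [mul_assoc, inv_mul_cancel₀ h1]
      simp
  have h2 : Tendsto (fun s : ℝ => (s : ℂ) * m) (𝓝 0) (𝓝 0) := by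
    have : Continuous fun s : ℝ => (s : ℂ) * m := by fun_prop
    simpa using this.tendsto 0
  have h3 : ∀ᶠ s : ℝ in 𝓝 0, s = 0 := by
    filter_upwards [h2.eventually h] with s hs
    have h4 : realProj A (((s : ℂ) * m) • c) = 0 := by
      simp [h0, mul_assoc, hmc]
    rw [h4, add_zero, left_eq_add, smul_eq_zero, mul_eq_zero] at hs
    rcases hs with (h5 | h5) | h5
    · exact_mod_cast h5
    · exact absurd h5 hm
    · exact absurd h5 hc
  obtain ⟨t, ht, ht0⟩ := ((frequently_nhdsWithin_iff (s := {(0 : ℝ)}ᶜ)).1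
    ((h3.filter_mono nhdsWithin_le_nhds).frequently)).exists
  exact ht0 ht

theorem line_normalize {f : ℂ × ℝ} {c : C3} (hc : A c 0 ≠ 0)
    (h : ∀ᶠ t : ℂ in 𝓝 0, U (f + realProj A (t • c)) = U f + t • c) :
    A ((A c 0)⁻¹ • c) 0 = 1 ∧ ∀ᶠ t : ℂ in 𝓝 0,
      U (f + slope (A ((A c 0)⁻¹ • c) 1) t) = U f + t • ((A c 0)⁻¹ • c) := by
  have h0 : A ((A c 0)⁻¹ • c) 0 = 1 := by simp [hc]
  refine ⟨h0, ?_⟩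
  have h1 : Tendsto (fun t : ℂ => t * (A c 0)⁻¹) (𝓝 0) (𝓝 0) := by
    have : Continuous fun t : ℂ => t * (A c 0)⁻¹ := by fun_prop
    simpa using this.tendsto 0
  filter_upwards [h1.eventually h] with t ht
  rw [← realProj_smul A h0, smul_smul]
  exact ht

theorem fderiv_of_line {f : ℂ × ℝ} {c : C3} {κ : ℂ} (hU : DifferentiableAt ℝ U f)
    (h : ∀ᶠ t : ℂ in 𝓝 0, U (f + slope κ t) = U f + t • c) (ζ : ℂ) :
    fderiv ℝ U f (slope κ ζ) = ζ • c := by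
  have h1 : HasFDerivAt (fun t : ℂ => U (f + slope κ t)) ((fderiv ℝ U f).comp (slope κ)) 0 := by
    have h2 : HasFDerivAt (fun t : ℂ => f + slope κ t) (slope κ) 0 :=
      (slope κ).hasFDerivAt.const_add f
    have h3 : HasFDerivAt U (fderiv ℝ U f) (f + slope κ 0) := by
      rw [map_zero, add_zero]
      exact hU.hasFDerivAt
    exact h3.comp (0 : ℂ) h2
  have h4 : HasFDerivAt (fun t : ℂ => U f + t • c) ((ContinuousLinearMap.id ℝ ℂ).smulRight c) 0 :=
    (((ContinuousLinearMap.id ℝ ℂ).smulRight c).hasFDerivAt).const_add (U f)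
  exact DFunLike.congr_fun (h1.unique (h4.congr_of_eventuallyEq h)) ζ

theorem tendsto_add_slope (f : ℂ × ℝ) (κ : ℂ) :
    Tendsto (fun t : ℂ => f + slope κ t) (𝓝 0) (𝓝 f) := by
  have : Continuous fun t : ℂ => f + slope κ t := by fun_prop
  have h := this.tendsto 0
  rwa [map_zero, add_zero] at h

/-- The formula `tangentDir` defines a smooth field on the whole ball. At the dense points it is the
direction of a genuine line, and every required property is a closed condition. -/
theorem IsLinedGraph.exists_lineField (h : IsLinedGraph S Λ a (realProj A) U r)
    (hΛ : IsClosed Λ) :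
    ∃ β, IsLineField Λ A U β (Metric.ball (realProj A a) r) := by
  set B := Metric.ball (realProj A a) r with hB
  have hBo : IsOpen B := Metric.isOpen_ball
  have hUd : ∀ f ∈ B, DifferentiableAt ℝ U f := fun f hf =>
    (h.contDiffOn.contDiffAt (hBo.mem_nhds hf)).differentiableAt (by simp)
  set β : ℂ × ℝ → C3 := fun f => tangentDir A (fderiv ℝ U f) with hβ
  have hd1 : ContDiffOn ℝ ∞ (fderiv ℝ U) B := h.contDiffOn.fderiv_of_isOpen hBo (by simp)
  have hsm : ContDiffOn ℝ ∞ β B := by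
    have h1 : ∀ v : ℂ × ℝ, ContDiffOn ℝ ∞ (fun f => (A (fderiv ℝ U f v) 1).im) B := by
      intro v
      have h2 : ContDiffOn ℝ ∞ (fun f => fderiv ℝ U f v) B := hd1.clm_apply contDiffOn_const
      exact ((Complex.imCLM.comp (ContinuousLinearMap.proj (R := ℝ) (φ := fun _ : Fin 3 => ℂ)
        1)).comp ((A : C3 →L[ℂ] C3).restrictScalars ℝ)).contDiff.comp_contDiffOn h2
    have h2 : ContDiffOn ℝ ∞ (fun f => tangentSlope A (fderiv ℝ U f)) B := by
      have h0 : ∀ f ∈ B, (1 + (A (fderiv ℝ U f (0, 1)) 1).im ^ 2) ≠ 0 := by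
        intro f _
        positivity
      have hre := ((h1 (Complex.I, 0)).sub ((h1 (0, 1)).mul (h1 (1, 0)))).div
        (contDiffOn_const.add ((h1 (0, 1)).pow 2)) h0
      have him := ((h1 (1, 0)).add ((h1 (0, 1)).mul (h1 (Complex.I, 0)))).div
        (contDiffOn_const.add ((h1 (0, 1)).pow 2)) h0
      exact (Complex.ofRealCLM.contDiff.comp_contDiffOn hre).add
        ((Complex.ofRealCLM.contDiff.comp_contDiffOn him).mul contDiffOn_const)
    have h3 : ContDiffOn ℝ ∞ (fun f => slope (tangentSlope A (fderiv ℝ U f)) 1) B := by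
      simp only [slope_apply, mul_one]
      exact contDiffOn_const.prodMk (Complex.reCLM.contDiff.comp_contDiffOn h2)
    exact hd1.clm_apply h3
  have hdir : ∀ {f : ℂ × ℝ} {c : C3}, f ∈ B →
      (∀ᶠ t : ℂ in 𝓝 0, U (f + slope (A c 1) t) = U f + t • c) → c = β f :=
    fun hf hc => (eq_tangentDir (fderiv_of_line (hUd _ hf) hc)).2
  have heq : ∀ f ∈ B, ∀ c : C3, c ≠ 0 →
      (∀ᶠ t : ℂ in 𝓝 0, U (f + realProj A (t • c)) = U f + t • c) →
      ∃ t : ℂ, t ≠ 0 ∧ c = t • β f := by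
    intro f hf c hc hcU
    have h0 := coord_ne_zero_of_line hc hcU
    refine ⟨A c 0, h0, ?_⟩
    rw [← hdir hf (line_normalize h0 hcU).2, smul_inv_smul₀ h0]
  have hgen : ∀ f ∈ B, ∀ N ∈ 𝓝 f, ∃ f' ∈ B, f' ∈ N ∧ A (β f') 0 = 1 ∧
      (∀ ζ : ℂ, fderiv ℝ U f' (slope (A (β f') 1) ζ) = ζ • β f') ∧
      (∀ ζ : ℂ, fderiv ℝ β f' (slope (A (β f') 1) ζ) = 0) ∧ ∀ t : ℂ, U f' + t • β f' ∈ Λ := by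
    intro f hf N hN
    obtain ⟨f', hf', hfN, c, hc, hcΛ, hcU⟩ := h.dense f hf N hN
    have h0 := coord_ne_zero_of_line hc hcU
    obtain ⟨h1, h2⟩ := line_normalize h0 hcU
    have h3 := hdir hf' h2
    have h4 : ∀ᶠ t : ℂ in 𝓝 0, U (f' + slope (A (β f') 1) t) = U f' + t • β f' := by rwa [← h3]
    refine ⟨f', hf', hfN, by rw [← h3]; exact h1, fderiv_of_line (hUd _ hf') h4, ?_, fun t => ?_⟩
    · have h5 : ∀ᶠ t : ℂ in 𝓝 0, β (f' + slope (A (β f') 1) t) = β f' + t • (0 : C3) := by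
        filter_upwards [h4.eventually_nhds,
          (tendsto_add_slope f' (A (β f') 1)).eventually (hBo.mem_nhds hf')] with t ht htB
        rw [smul_zero, add_zero]
        refine (hdir htB ?_).symm
        have h6 : Tendsto (fun s : ℂ => t + s) (𝓝 0) (𝓝 t) := by
          have : Continuous fun s : ℂ => t + s := by fun_prop
          simpa using this.tendsto 0
        filter_upwards [h6.eventually ht] with s hs
        rw [add_assoc, ← map_add, hs, ht.self_of_nhds, add_smul, add_assoc]
      intro ζ
      have h6 := fderiv_of_line
        ((hsm.contDiffAt (hBo.mem_nhds hf')).differentiableAt (by simp)) h5 ζ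
      rwa [smul_zero] at h6
    · rw [← h3, smul_smul]
      exact hcΛ _
  have hUc : ContinuousOn U B := h.contDiffOn.continuousOn
  have hβc : ContinuousOn β B := hsm.continuousOn
  have hAc : ∀ j : Fin 3, ContinuousOn (fun f => A (β f) j) B := fun j =>
    ((continuous_apply j).comp A.continuous).comp_continuousOn hβc
  have hslope : ∀ ζ : ℂ, ContinuousOn (fun f => slope (A (β f) 1) ζ) B := by
    intro ζ
    simp only [slope_apply]
    exact continuousOn_const.prodMk
      (Complex.continuous_re.comp_continuousOn ((hAc 1).mul continuousOn_const))
  refine ⟨β, hsm, ?_, ?_, ?_, ?_, heq⟩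
  · intro f hf
    refine sub_eq_zero.1 (eq_zero_of_dense (f := fun f => A (β f) 0 - 1) hBo
      ((hAc 0).sub continuousOn_const) (fun f hf N hN => ?_) f hf)
    obtain ⟨f', h1, h2, h3, -⟩ := hgen f hf N hN
    exact ⟨f', h1, h2, sub_eq_zero.2 h3⟩
  · intro f hf ζ
    refine sub_eq_zero.1 (eq_zero_of_dense
      (f := fun f => fderiv ℝ U f (slope (A (β f) 1) ζ) - ζ • β f) hBo
      ((hd1.continuousOn.clm_apply (hslope ζ)).sub (hβc.const_smul ζ)) (fun f hf N hN => ?_) f hf)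
    obtain ⟨f', h1, h2, -, h3, -⟩ := hgen f hf N hN
    exact ⟨f', h1, h2, sub_eq_zero.2 (h3 ζ)⟩
  · intro f hf ζ
    refine eq_zero_of_dense (f := fun f => fderiv ℝ β f (slope (A (β f) 1) ζ)) hBo
      ((hsm.continuousOn_fderiv_of_isOpen hBo (by simp)).clm_apply (hslope ζ))
      (fun f hf N hN => ?_) f hf
    obtain ⟨f', h1, h2, -, -, h3, -⟩ := hgen f hf N hN
    exact ⟨f', h1, h2, h3 ζ⟩
  · intro f hf t
    by_contra hnot
    have h1 : ContinuousAt (fun f => U f + t • β f) f :=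
      ((hUc.add (hβc.const_smul t)).continuousAt (hBo.mem_nhds hf))
    obtain ⟨f', -, h3, -, -, -, h4⟩ := hgen f hf _ (h1.eventually (hΛ.isOpen_compl.mem_nhds hnot))
    exact h3 (h4 t)

/-- The line field is constant along its lines, which stay in the graph. -/
theorem IsLineField.along_line {β : ℂ × ℝ → C3} {B : Set (ℂ × ℝ)}
    (h : IsLineField Λ A U β B) (hBo : IsOpen B) (hBc : Convex ℝ B) (hU : ContDiffOn ℝ ∞ U B)
    {f : ℂ × ℝ} (hf : f ∈ B) {ζ : ℂ} (hζ : f + slope (A (β f) 1) ζ ∈ B) :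
    β (f + slope (A (β f) 1) ζ) = β f ∧ U (f + slope (A (β f) 1) ζ) = U f + ζ • β f := by
  set κ := A (β f) 1 with hκ
  set c : ℝ → ℂ × ℝ := fun s => f + s • slope κ ζ with hc
  have hcB : ∀ s ∈ Icc (0 : ℝ) 1, c s ∈ B := fun s hs => hBc.add_smul_mem hf hζ hs
  have hcd : ∀ s, HasDerivAt c (slope κ ζ) s := by
    intro s
    have := ((hasDerivAt_id s).smul_const (slope κ ζ)).const_add f
    rw [one_smul] at this
    exact this
  have hcc : Continuous c := by
    rw [hc]
    fun_prop
  have hβd : ∀ f ∈ B, HasFDerivAt β (fderiv ℝ β f) f := fun f hf =>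
    ((h.contDiffOn.contDiffAt (hBo.mem_nhds hf)).differentiableAt (by simp)).hasFDerivAt
  have hUd : ∀ f ∈ B, HasFDerivAt U (fderiv ℝ U f) f := fun f hf =>
    ((hU.contDiffAt (hBo.mem_nhds hf)).differentiableAt (by simp)).hasFDerivAt
  have hcont : ContinuousOn (fun s => ‖fderiv ℝ β (c s)‖) (Icc 0 1) :=
    ((h.contDiffOn.continuousOn_fderiv_of_isOpen hBo (by simp)).comp hcc.continuousOn hcB).norm
  obtain ⟨K, hK⟩ := isCompact_Icc.bddAbove_image hcont
  have hK' : ∀ s ∈ Icc (0 : ℝ) 1, ‖fderiv ℝ β (c s)‖ ≤ K := fun s hs =>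
    hK (mem_image_of_mem _ hs)
  have hK0 : 0 ≤ K := (norm_nonneg _).trans (hK' 0 (by simp))
  -- Grönwall along the straight segment with initial slope κ: β has zero derivative along its own
  -- slope at `c s`, and the two slopes differ by at most a multiple of ‖β (c s) − β f‖.
  have hφ : ∀ s ∈ Icc (0 : ℝ) 1, β (c s) - β f = 0 := by
    refine eq_zero_of_abs_deriv_le_mul_abs_self_of_eq_zero_right
      (f' := fun s => fderiv ℝ β (c s) (slope κ ζ))
      (K := K * (‖(A : C3 →L[ℂ] C3)‖ * ‖ζ‖)) ?_ ?_ ?_ ?_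
    · exact ((h.contDiffOn.continuousOn.comp hcc.continuousOn hcB).sub continuousOn_const)
    · intro s hs
      exact (((hβd _ (hcB s (Ico_subset_Icc_self hs))).comp_hasDerivAt s
        (hcd s)).sub_const _).hasDerivWithinAt
    · simp only [hc, zero_smul, add_zero, sub_self]
    · intro s hs
      have hs' := Ico_subset_Icc_self hs
      rw [slope_sub κ (A (β (c s)) 1), map_add, h.const _ (hcB s hs'), zero_add]
      have h1 : ‖((0, ((κ - A (β (c s)) 1) * ζ).re) : ℂ × ℝ)‖ ≤
          ‖(A : C3 →L[ℂ] C3)‖ * ‖β (c s) - β f‖ * ‖ζ‖ := by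
        rw [Prod.norm_mk, norm_zero, max_eq_right (norm_nonneg _), Real.norm_eq_abs]
        refine (Complex.abs_re_le_norm _).trans ?_
        rw [norm_mul]
        refine mul_le_mul_of_nonneg_right ?_ (norm_nonneg _)
        have h2 : κ - A (β (c s)) 1 = -(A (β (c s) - β f) 1) := by
          rw [map_sub, Pi.sub_apply, hκ]
          ring
        rw [h2, norm_neg]
        exact (norm_le_pi_norm _ 1).trans ((A : C3 →L[ℂ] C3).le_opNorm _)
      calc ‖fderiv ℝ β (c s) (0, ((κ - A (β (c s)) 1) * ζ).re)‖
          ≤ ‖fderiv ℝ β (c s)‖ * ‖((0, ((κ - A (β (c s)) 1) * ζ).re) : ℂ × ℝ)‖ :=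
            ContinuousLinearMap.le_opNorm _ _
        _ ≤ K * (‖(A : C3 →L[ℂ] C3)‖ * ‖β (c s) - β f‖ * ‖ζ‖) := by
            gcongr
            exact hK' s hs'
        _ = K * (‖(A : C3 →L[ℂ] C3)‖ * ‖ζ‖) * ‖β (c s) - β f‖ := by ring
  have hφ' : ∀ s ∈ Icc (0 : ℝ) 1, β (c s) = β f := fun s hs => sub_eq_zero.1 (hφ s hs)
  have hψ : ∀ s ∈ Icc (0 : ℝ) 1, U (c s) - s • ζ • β f = U (c 0) - (0 : ℝ) • ζ • β f := by
    refine constant_of_has_deriv_right_zero ?_ fun s hs => ?_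
    · exact (hU.continuousOn.comp hcc.continuousOn hcB).sub (by fun_prop)
    · have hs' := Ico_subset_Icc_self hs
      have h1 := (hUd _ (hcB s hs')).comp_hasDerivAt s (hcd s)
      have h2 : fderiv ℝ U (c s) (slope κ ζ) = ζ • β f := by
        have := h.tangent _ (hcB s hs') ζ
        rwa [hφ' s hs', ← hκ] at this
      rw [h2] at h1
      have h3 : HasDerivAt (fun s : ℝ => s • ζ • β f) (ζ • β f) s := by
        simpa using (hasDerivAt_id s).smul_const (ζ • β f)
      have h4 := h1.sub h3
      rw [sub_self] at h4
      exact h4.hasDerivWithinAt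
  have h1c : c 1 = f + slope κ ζ := by simp only [hc, one_smul]
  have h0c : c 0 = f := by simp only [hc, zero_smul, add_zero]
  refine ⟨by rw [← h1c]; exact hφ' 1 (by simp), ?_⟩
  have := hψ 1 (by simp)
  rw [h1c, h0c, one_smul, zero_smul, sub_zero] at this
  rw [← this, sub_add_cancel]

end Directions

end CP3

namespace CP3

open Filter Module

/-! ### The foliated chart. -/

section Foliation

variable {S Λ : Set C3} {a : C3} {A : C3 ≃L[ℂ] C3} {U β : ℂ × ℝ → C3} {r : ℝ}

/-- The subspace `ℂ × ℝ × 0` of `ℂ³`. -/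
noncomputable def leafSpace : Submodule ℝ C3 :=
  LinearMap.ker ((Complex.imLm ∘ₗ LinearMap.proj (R := ℝ) (φ := fun _ : Fin 3 => ℂ) 1).prod
    (LinearMap.proj (R := ℝ) (φ := fun _ : Fin 3 => ℂ) 2))

/-- The subspace `ℂ × 0 × 0` of `ℂ³`. -/
noncomputable def plaqueSpace : Submodule ℝ C3 :=
  LinearMap.ker ((LinearMap.proj (R := ℝ) (φ := fun _ : Fin 3 => ℂ) 1).prod
    (LinearMap.proj (R := ℝ) (φ := fun _ : Fin 3 => ℂ) 2))

theorem mem_leafSpace {q : C3} : q ∈ leafSpace ↔ (q 1).im = 0 ∧ q 2 = 0 := by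
  simp [leafSpace]

theorem mem_plaqueSpace {q : C3} : q ∈ plaqueSpace ↔ q 1 = 0 ∧ q 2 = 0 := by
  simp [plaqueSpace]

theorem plaqueSpace_le_leafSpace : plaqueSpace ≤ leafSpace := by
  intro q hq
  rw [mem_plaqueSpace] at hq
  rw [mem_leafSpace, hq.1]
  exact ⟨rfl, hq.2⟩

theorem finrank_C3 : finrank ℝ C3 = 6 := by
  rw [finrank_pi_fintype]
  simp

theorem finrank_leafSpace : finrank ℝ leafSpace = 3 := by
  have h := LinearMap.finrank_range_add_finrank_ker
    ((Complex.imLm ∘ₗ LinearMap.proj (R := ℝ) (φ := fun _ : Fin 3 => ℂ) 1).prod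
    (LinearMap.proj (R := ℝ) (φ := fun _ : Fin 3 => ℂ) 2))
  rw [LinearMap.range_eq_top.2 (fun x => ⟨![0, x.1 * Complex.I, x.2], by ext <;> simp⟩), finrank_top,
    finrank_prod, finrank_C3, Complex.finrank_real_complex, finrank_self] at h
  have h' : 2 + 1 + finrank ℝ leafSpace = 6 := h
  omega

theorem finrank_plaqueSpace : finrank ℝ plaqueSpace = 2 := by
  have h := LinearMap.finrank_range_add_finrank_ker
    ((LinearMap.proj (R := ℝ) (φ := fun _ : Fin 3 => ℂ) 1).prod
    (LinearMap.proj (R := ℝ) (φ := fun _ : Fin 3 => ℂ) 2))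
  rw [LinearMap.range_eq_top.2 (fun x => ⟨![0, x.1, x.2], by ext <;> simp⟩), finrank_top,
    finrank_prod, finrank_C3, Complex.finrank_real_complex] at h
  have h' : 2 + 2 + finrank ℝ plaqueSpace = 6 := h
  omega

/-- The point of the transversal `{z₀} × ℝ` that belongs to `q`. -/
noncomputable def transversal (z₀ : ℂ) (q : C3) : ℂ × ℝ := (z₀, (q 1).re)

/-- The coordinates adapted to the lines that start on the transversal `{z₀} × ℝ`. -/
noncomputable def lineCoord (A : C3 ≃L[ℂ] C3) (U β : ℂ × ℝ → C3) (z₀ : ℂ) (q : C3) : C3 :=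
  U (transversal z₀ q) + q 0 • β (transversal z₀ q) +
    A.symm ![0, ((q 1).im : ℂ) * Complex.I, q 2]

theorem contDiff_transversal (z₀ : ℂ) : ContDiff ℝ ∞ (transversal z₀) := by
  have h : ContDiff ℝ ∞ fun q : C3 => (q 1).re :=
    Complex.reCLM.contDiff.comp (contDiff_apply ℝ ℂ (1 : Fin 3))
  exact contDiff_const.prodMk h

theorem contDiffOn_lineCoord {B : Set (ℂ × ℝ)} (hU : ContDiffOn ℝ ∞ U B) (hβ : ContDiffOn ℝ ∞ β B)
    (z₀ : ℂ) : ContDiffOn ℝ ∞ (lineCoord A U β z₀) (transversal z₀ ⁻¹' B) := by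
  have h1 := (contDiff_transversal z₀).contDiffOn (s := transversal z₀ ⁻¹' B)
  have h2 : ContDiff ℝ ∞ fun q : C3 => (![0, ((q 1).im : ℂ) * Complex.I, q 2] : C3) := by
    refine contDiff_pi.2 fun j => ?_
    fin_cases j
    · exact contDiff_const
    · exact (Complex.ofRealCLM.contDiff.comp (Complex.imCLM.contDiff.comp
        (contDiff_apply ℝ ℂ (1 : Fin 3)))).mul contDiff_const
    · exact contDiff_apply ℝ ℂ (2 : Fin 3)
  refine ((hU.comp h1 fun q hq => hq).add ?_).add ?_
  · exact (contDiff_apply ℝ ℂ (0 : Fin 3)).contDiffOn.smul (hβ.comp h1 fun q hq => hq)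
  · exact (((A.symm : C3 →L[ℂ] C3).restrictScalars ℝ).contDiff.comp h2).contDiffOn

theorem realProj_lineCoord {B : Set (ℂ × ℝ)} (hpr : ∀ f ∈ B, realProj A (U f) = f)
    (hβ : ∀ f ∈ B, A (β f) 0 = 1) {z₀ : ℂ} {q : C3} (hq : transversal z₀ q ∈ B) :
    realProj A (lineCoord A U β z₀ q) =
      transversal z₀ q + slope (A (β (transversal z₀ q)) 1) (q 0) := by
  rw [lineCoord, map_add, map_add, hpr _ hq, realProj_smul A (hβ _ hq)]
  simp

/-- Along s ↦ q + s v the projection `realProj` detects v 0 and Re (v 1). Once these vanish the map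
is affine in s, and the remaining components enter through the injective `A.symm`. -/
theorem fderiv_lineCoord_injective {B : Set (ℂ × ℝ)} (hB : IsOpen B) (hU : ContDiffOn ℝ ∞ U B)
    (hβ : ContDiffOn ℝ ∞ β B) (hpr : ∀ f ∈ B, realProj A (U f) = f)
    (hβ0 : ∀ f ∈ B, A (β f) 0 = 1) {z₀ : ℂ} {q : C3} (hq : transversal z₀ q ∈ B) (hq0 : q 0 = 0)
    {v : C3} (hv : fderiv ℝ (lineCoord A U β z₀) q v = 0) : v = 0 := by
  have hO : IsOpen (transversal z₀ ⁻¹' B) := hB.preimage (contDiff_transversal z₀).continuous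
  have hline : HasDerivAt (fun s : ℝ => q + s • v) v 0 := by
    have := ((hasDerivAt_id (0 : ℝ)).smul_const v).const_add q
    rwa [one_smul] at this
  have hd : HasDerivAt (fun s : ℝ => lineCoord A U β z₀ (q + s • v)) 0 0 := by
    have h1 : HasFDerivAt (lineCoord A U β z₀) (fderiv ℝ (lineCoord A U β z₀) q)
        (q + (0 : ℝ) • v) := by
      rw [zero_smul, add_zero]
      exact (((contDiffOn_lineCoord hU hβ z₀).contDiffAt (hO.mem_nhds hq)).differentiableAt
        (by simp)).hasFDerivAt
    have h2 := h1.comp_hasDerivAt (0 : ℝ) hline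
    rwa [hv] at h2
  have hnear : ∀ᶠ s : ℝ in 𝓝 0, transversal z₀ (q + s • v) ∈ B := by
    have h1 : Continuous fun s : ℝ => q + s • v := by fun_prop
    have h2 := h1.tendsto 0
    rw [zero_smul, add_zero] at h2
    exact h2.eventually (hO.mem_nhds hq)
  have hproj := (realProj A).hasFDerivAt.comp_hasDerivAt (0 : ℝ) hd
  rw [map_zero] at hproj
  have h0 : v 0 = 0 := by
    have h1 : HasDerivAt (fun s : ℝ => z₀ + (s : ℂ) * v 0) 0 0 := by
      refine ((ContinuousLinearMap.fst ℝ ℂ ℝ).hasFDerivAt.comp_hasDerivAt (0 : ℝ)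
        hproj).congr_of_eventuallyEq ?_
      filter_upwards [hnear] with s hs
      simp only [Function.comp, realProj_lineCoord hpr hβ0 hs]
      simp [transversal, hq0]
    have h2 : HasDerivAt (fun s : ℝ => z₀ + (s : ℂ) * v 0) (1 * v 0) 0 :=
      ((Complex.ofRealCLM.hasDerivAt (x := (0 : ℝ))).mul_const (v 0)).const_add z₀
    simpa using h2.unique h1
  have hs0 : ∀ s : ℝ, (q + s • v) 0 = 0 := fun s => by simp [hq0, h0]
  have h1r : (v 1).re = 0 := by
    have h1 : HasDerivAt (fun s : ℝ => (q 1).re + s * (v 1).re) 0 0 := by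
      refine ((ContinuousLinearMap.snd ℝ ℂ ℝ).hasFDerivAt.comp_hasDerivAt (0 : ℝ)
        hproj).congr_of_eventuallyEq ?_
      filter_upwards [hnear] with s hs
      simp only [Function.comp, realProj_lineCoord hpr hβ0 hs]
      rw [hs0, map_zero, add_zero]
      simp [transversal]
    have h2 : HasDerivAt (fun s : ℝ => (q 1).re + s * (v 1).re) (1 * (v 1).re) 0 :=
      ((hasDerivAt_id (0 : ℝ)).mul_const _).const_add _
    simpa using h2.unique h1
  set w : C3 := ![0, ((v 1).im : ℂ) * Complex.I, v 2] with hw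
  have hw0 : A.symm w = 0 := by
    have h2 : HasDerivAt (fun s : ℝ => lineCoord A U β z₀ q + s • A.symm w)
        ((1 : ℝ) • A.symm w) 0 :=
      ((hasDerivAt_id (0 : ℝ)).smul_const _).const_add _
    rw [one_smul] at h2
    refine h2.unique (hd.congr_of_eventuallyEq (Eventually.of_forall fun s => ?_))
    have h3 : transversal z₀ (q + s • v) = transversal z₀ q := by simp [transversal, h1r]
    have h4 : (![0, (((q + s • v) 1).im : ℂ) * Complex.I, (q + s • v) 2] : C3) =
        ![0, ((q 1).im : ℂ) * Complex.I, q 2] + (s : ℂ) • w := by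
      ext j
      fin_cases j <;> simp [hw, add_mul, mul_assoc]
    simp only [lineCoord, h3, h4, hs0, hq0, map_add, map_smul, zero_smul, add_zero]
    rw [add_assoc]
    rfl
  have hw1 : w = 0 := by rwa [map_eq_zero_iff _ A.symm.injective] at hw0
  have h1i : (v 1).im = 0 := by simpa [hw] using congrFun hw1 1
  have h2 : v 2 = 0 := by simpa [hw] using congrFun hw1 2
  ext j
  fin_cases j
  · exact h0
  · exact Complex.ext h1r h1i
  · exact h2

/-- The chart inverts `lineCoord`: the first coordinate moves along a line, the real part of the
second selects its starting point on the transversal, and the remaining ones leave S. -/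
theorem IsLinedGraph.exists_foliated_slice (h : IsLinedGraph S Λ a (realProj A) U r)
    (hβ : IsLineField Λ A U β (Metric.ball (realProj A a) r)) :
    ∃ e W T, IsSlice S a e W ∧ finrank ℝ W = 3 ∧ T ≤ W ∧ finrank ℝ T = 2 ∧
      ∀ y ∈ S ∩ e.source, ∃ c : C3, c ≠ 0 ∧ (∀ t : ℂ, y + t • c ∈ Λ) ∧
        ∀ z ∈ S ∩ e.source, e z - e y ∈ T → ∃ t : ℂ, z = y + t • c := by
  set B := Metric.ball (realProj A a) r with hB
  have hBo : IsOpen B := Metric.isOpen_ball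
  set z₀ : ℂ := A a 0 with hz₀
  set q₀ : C3 := ![0, ((A a 1).re : ℂ), 0] with hq₀
  have hq₀t : transversal z₀ q₀ = realProj A a := by simp [transversal, hq₀, hz₀]
  have hcB : realProj A a ∈ B := Metric.mem_ball_self h.pos
  have hq₀a : lineCoord A U β z₀ q₀ = a := by
    rw [lineCoord, hq₀t, h.map_center]
    have : (![0, ((q₀ 1).im : ℂ) * Complex.I, q₀ 2] : C3) = 0 := by
      ext j
      fin_cases j <;> simp [hq₀]
    rw [this, map_zero]
    simp [hq₀]
  obtain ⟨Φ, hΦa, hΦs, hΦ, hΦd, hΦd'⟩ := exists_smooth_openPartialHomeomorph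
    (hBo.preimage (contDiff_transversal z₀).continuous) (a := q₀)
    (by rw [mem_preimage, hq₀t]; exact hcB) (contDiffOn_lineCoord (A := A) h.contDiffOn hβ.contDiffOn z₀)
    (fun v hv => fderiv_lineCoord_injective hBo h.contDiffOn hβ.contDiffOn h.pr_eq hβ.coord
      (by rw [hq₀t]; exact hcB) (by simp [hq₀]) hv) rfl
  have hpc : ContinuousAt (realProj A) a := (realProj A).continuous.continuousAt
  have hslope : ContinuousAt (fun y => realProj A y +
      slope (A (β (realProj A y)) 1) (z₀ - (realProj A y).1)) a := by
    have h1 : ContinuousAt (fun y => β (realProj A y)) a :=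
      ContinuousAt.comp (hβ.contDiffOn.continuousOn.continuousAt (hBo.mem_nhds hcB)) hpc
    have h2 : ContinuousAt (fun y => A (β (realProj A y)) 1) a :=
      ContinuousAt.comp ((continuous_apply (1 : Fin 3)).comp A.continuous).continuousAt h1
    have h3 : ContinuousAt (fun y => z₀ - (realProj A y).1) a :=
      continuousAt_const.sub (continuousAt_fst.comp hpc)
    refine hpc.add ?_
    simp only [slope_apply]
    exact h3.prodMk (Complex.continuous_re.continuousAt.comp (h2.mul h3))
  have hslope_a : realProj A a + slope (A (β (realProj A a)) 1) (z₀ - (realProj A a).1) =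
      realProj A a := by
    rw [show z₀ - (realProj A a).1 = 0 from sub_self _, map_zero, add_zero]
  -- The expected coordinates of a point of S: slide it back along its own line until the base
  -- coordinate is `z₀`. Constancy of β along that line makes the two slopes agree.
  set χ : C3 → C3 := fun y => ![(realProj A y).1 - z₀, (((realProj A y +
      slope (A (β (realProj A y)) 1) (z₀ - (realProj A y).1)).2 : ℝ) : ℂ), 0] with hχ
  have hχa : χ a = q₀ := by
    simp only [hχ, hslope_a, hq₀]
    rw [show (realProj A a).1 - z₀ = 0 from sub_self _]
    rfl
  have hχc : ContinuousAt χ a := by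
    refine continuousAt_pi.2 fun j => ?_
    fin_cases j
    · exact (continuousAt_fst.comp hpc).sub continuousAt_const
    · exact Complex.continuous_ofReal.continuousAt.comp (continuousAt_snd.comp hslope)
    · exact continuousAt_const
  have hev : ∀ᶠ y in 𝓝 a, realProj A y ∈ B ∧ (y ∈ S → U (realProj A y) = y) ∧
      realProj A y + slope (A (β (realProj A y)) 1) (z₀ - (realProj A y).1) ∈ B ∧
      χ y ∈ Φ.source := by
    have h1 := h.eventually_eq _ hcB
    rw [h.map_center] at h1
    refine (hpc.eventually (hBo.mem_nhds hcB)).and (h1.and ((hslope.eventually ?_).and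
      (hχc.eventually ?_)))
    · beta_reduce
      rw [hslope_a]
      exact hBo.mem_nhds hcB
    · rw [hχa]
      exact Φ.open_source.mem_nhds hΦa
  obtain ⟨G, hG, hGo, haG⟩ := eventually_nhds_iff.1 hev
  set e := Φ.symm.restrOpen G hGo
  have hcoord : ∀ y ∈ e.source, lineCoord A U β z₀ (e y) = y ∧ transversal z₀ (e y) ∈ B := by
    rintro y ⟨hy, -⟩
    refine ⟨?_, hΦs (Φ.map_target hy)⟩
    rw [← hΦ]
    exact Φ.right_inv hy
  have hmem : ∀ y ∈ e.source, y ∈ S ↔ e y ∈ leafSpace := by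
    intro y hy
    obtain ⟨g1, g2, g3, g4⟩ := hG y hy.2
    obtain ⟨hy1, hy2⟩ := hcoord y hy
    rw [mem_leafSpace]
    constructor
    · intro hyS
      have h1 := hβ.along_line hBo (convex_ball _ _) h.contDiffOn g1 g3
      have h2 : lineCoord A U β z₀ (χ y) = y := by
        have h3 : transversal z₀ (χ y) = realProj A y +
            slope (A (β (realProj A y)) 1) (z₀ - (realProj A y).1) := by
          ext <;> simp [transversal, hχ]
        have h4 : (![0, ((χ y 1).im : ℂ) * Complex.I, χ y 2] : C3) = 0 := by
          ext j
          fin_cases j <;> simp [hχ]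
        have h5 : χ y 0 = (realProj A y).1 - z₀ := rfl
        rw [lineCoord, h3, h4, h1.1, h1.2, map_zero, add_zero, g2 hyS, h5, add_assoc, ← add_smul]
        simp
      have h3 : e y = χ y := by
        rw [← hΦ] at h2
        change Φ.symm y = _
        conv_lhs => rw [← h2, Φ.left_inv g4]
      rw [h3]
      simp [hχ]
    · rintro ⟨h1, h2⟩
      have h3 := realProj_lineCoord h.pr_eq hβ.coord hy2
      rw [hy1] at h3
      have h4 := hβ.along_line hBo (convex_ball _ _) h.contDiffOn hy2 (ζ := e y 0) (h3 ▸ g1)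
      have h5 : (![0, ((e y 1).im : ℂ) * Complex.I, e y 2] : C3) = 0 := by
        ext j
        fin_cases j <;> simp [h1, h2]
      rw [lineCoord, h5, map_zero, add_zero, ← h4.2, ← h3] at hy1
      rw [← hy1]
      exact h.mem _ g1
  have hexp : ∀ y ∈ S ∩ e.source,
      y = U (transversal z₀ (e y)) + e y 0 • β (transversal z₀ (e y)) := by
    rintro y ⟨hyS, hy⟩
    obtain ⟨h1, h2⟩ := mem_leafSpace.1 ((hmem y hy).1 hyS)
    have h5 : (![0, ((e y 1).im : ℂ) * Complex.I, e y 2] : C3) = 0 := by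
      ext j
      fin_cases j <;> simp [h1, h2]
    have := (hcoord y hy).1
    rw [lineCoord, h5, map_zero, add_zero] at this
    exact this.symm
  refine ⟨e, leafSpace, plaqueSpace, ⟨?_, ?_, ?_, hmem⟩, finrank_leafSpace,
    plaqueSpace_le_leafSpace, finrank_plaqueSpace, ?_⟩
  · exact hΦd'.mono fun y hy => hy.1
  · exact hΦd.mono fun y hy => hy.1
  · refine ⟨?_, haG⟩
    have := Φ.map_source hΦa
    rwa [hΦ, hq₀a] at this
  · intro y hy
    have hyB := (hcoord y hy.2).2
    refine ⟨β (transversal z₀ (e y)), fun h0 => ?_, fun t => ?_, fun z hz hT => ⟨e z 0 - e y 0, ?_⟩⟩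
    · have := hβ.coord _ hyB
      rw [h0] at this
      simp at this
    · have := hβ.mem _ hyB (e y 0 + t)
      rwa [add_smul, ← add_assoc, ← hexp y hy] at this
    · have h1 : transversal z₀ (e z) = transversal z₀ (e y) := by
        have h2 := (mem_plaqueSpace.1 hT).1
        rw [Pi.sub_apply, sub_eq_zero] at h2
        simp [transversal, h2]
      have h3 := hexp z hz
      have h4 := hexp y hy
      rw [h1] at h3
      calc z = U (transversal z₀ (e y)) + e z 0 • β (transversal z₀ (e y)) := h3
        _ = U (transversal z₀ (e y)) + e y 0 • β (transversal z₀ (e y)) +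
            (e z 0 - e y 0) • β (transversal z₀ (e y)) := by
          rw [add_assoc, ← add_smul, add_sub_cancel]
        _ = y + (e z 0 - e y 0) • β (transversal z₀ (e y)) := by rw [← h4]

/-- A three-dimensional submanifold with dense lines is foliated by lines. -/
theorem IsSubmanifold.exists_foliation (hS : IsSubmanifold 3 S) (hΛ : IsClosed Λ)
    (hL : HasDenseLines S Λ) (ha : a ∈ S) :
    (∃ b : C3, b ≠ 0 ∧ (∀ t : ℂ, a + t • b ∈ Λ) ∧ (∀ᶠ t : ℂ in 𝓝 0, a + t • b ∈ S) ∧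
      ∀ c : C3, c ≠ 0 → (∀ᶠ t : ℂ in 𝓝 0, a + t • c ∈ S) → ∃ t : ℂ, t ≠ 0 ∧ c = t • b) ∧
    ∃ e W T, IsSlice S a e W ∧ finrank ℝ W = 3 ∧ T ≤ W ∧ finrank ℝ T = 2 ∧
      ∀ y ∈ S ∩ e.source, ∃ c : C3, c ≠ 0 ∧ (∀ t : ℂ, y + t • c ∈ Λ) ∧
        ∀ z ∈ S ∩ e.source, e z - e y ∈ T → ∃ t : ℂ, z = y + t • c := by
  obtain ⟨e, W, h, hW⟩ := hS a ha
  obtain ⟨b, hb, hbW⟩ := h.exists_complex_tangent ha hL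
  obtain ⟨A, hA⟩ := h.exists_coordinates hW hb hbW
  obtain ⟨U, r, hU⟩ := h.exists_isLinedGraph ha hL (realProj A) hA (by
    rw [hW, finrank_prod, Complex.finrank_real_complex, finrank_self])
  obtain ⟨β, hβ⟩ := hU.exists_lineField hΛ
  refine ⟨?_, hU.exists_foliated_slice hβ⟩
  have hcB : realProj A a ∈ Metric.ball (realProj A a) r := Metric.mem_ball_self hU.pos
  have hmem := hβ.mem _ hcB
  rw [hU.map_center] at hmem
  refine ⟨β (realProj A a), fun h0 => ?_, hmem, ?_, fun c hc hcS => ?_⟩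
  · have := hβ.coord _ hcB
    rw [h0] at this
    simp at this
  · filter_upwards [(tendsto_add_slope (realProj A a) (A (β (realProj A a)) 1)).eventually
      (Metric.isOpen_ball.mem_nhds hcB)] with t ht
    have h1 := (hβ.along_line Metric.isOpen_ball (convex_ball _ _) hU.contDiffOn hcB ht).2
    rw [hU.map_center] at h1
    rw [← h1]
    exact hU.mem _ ht
  · refine hβ.eq_smul _ hcB c hc (hU.eventually_line hcB ?_)
    rwa [hU.map_center]

end Foliation

end CP3

namespace CP3

open Filter Module

/-! ### Projective lines in affine charts and compactness of ℂℙ³. -/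

section Lines

/-- The projective line through the affine point `a` in the direction `b`. -/
def projLine (i : Fin 4) (a b : C3) : Set CP3 :=
  {p | p.submodule ≤ Submodule.span ℂ
    {(i.insertNth (1 : ℂ) a : C4), (i.insertNth (0 : ℂ) b : C4)}}

theorem submodule_pt_le_iff {v : C4} (hv : v ≠ 0) {W : Submodule ℂ C4} :
    (pt v).submodule ≤ W ↔ v ∈ W := by
  rw [pt_of_ne hv, Projectivization.submodule_mk, Submodule.span_singleton_le_iff_mem]

variable {i : Fin 4} {a b : C3}

theorem smul_add_smul_insertNth (α β : ℂ) :
    α • (i.insertNth (1 : ℂ) a : C4) + β • (i.insertNth (0 : ℂ) b : C4) =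
      i.insertNth α (α • a + β • b) := by
  funext k
  refine Fin.succAboveCases i ?_ (fun l => ?_) k <;> simp

theorem finrank_span_insertNth (hb : b ≠ 0) : finrank ℂ (Submodule.span ℂ
    {(i.insertNth (1 : ℂ) a : C4), (i.insertNth (0 : ℂ) b : C4)}) = 2 := by
  have h : LinearIndependent ℂ
      ![(i.insertNth (1 : ℂ) a : C4), (i.insertNth (0 : ℂ) b : C4)] := by
    rw [LinearIndependent.pair_iff]
    intro α β h
    rw [smul_add_smul_insertNth] at h
    have h0 : α = 0 := by simpa using congrFun h i
    refine ⟨h0, ?_⟩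
    obtain ⟨l, hl⟩ := Function.ne_iff.1 hb
    have h1 := congrFun h (i.succAbove l)
    rw [Fin.insertNth_apply_succAbove, h0] at h1
    simpa [show b l ≠ 0 from hl] using h1
  have h2 := finrank_span_eq_card h
  rwa [Matrix.range_cons, Matrix.range_cons, Matrix.range_empty, union_empty, singleton_union,
    Fintype.card_fin] at h2

theorem isLine_projLine (hb : b ≠ 0) : IsLine (projLine i a b) :=
  ⟨_, finrank_span_insertNth hb, rfl⟩

theorem affinePoint_mem_projLine {y : C3} :
    affinePoint i y ∈ projLine i a b ↔ ∃ t : ℂ, y = a + t • b := by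
  rw [affinePoint_eq_pt]
  change (pt _).submodule ≤ _ ↔ _
  rw [submodule_pt_le_iff (insertNth_one_ne_zero i y), Submodule.mem_span_pair]
  constructor
  · rintro ⟨α, β, h⟩
    rw [smul_add_smul_insertNth] at h
    have h0 : α = 1 := by simpa using congrFun h i
    refine ⟨β, funext fun l => ?_⟩
    have h1 := congrFun h (i.succAbove l)
    rw [Fin.insertNth_apply_succAbove, Fin.insertNth_apply_succAbove, h0, one_smul] at h1
    exact h1.symm
  · rintro ⟨t, rfl⟩
    exact ⟨1, t, by rw [smul_add_smul_insertNth, one_smul]⟩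

theorem mem_projLine_affineCoord {x : CP3} (hx : x ∈ chartDomain i) :
    x ∈ projLine i (affineCoord i x) b := by
  have h : affinePoint i (affineCoord i x) ∈ projLine i (affineCoord i x) b :=
    affinePoint_mem_projLine.2 ⟨0, by simp⟩
  rwa [affinePoint_affineCoord i hx] at h

/-- A second vector of the plane is corrected by a multiple of the first to have zero `i`-th entry;
its other entries are the direction. -/
theorem IsLine.exists_eq_projLine {L : Set CP3} (hL : IsLine L) (ha : affinePoint i a ∈ L) :
    ∃ b : C3, b ≠ 0 ∧ L = projLine i a b := by
  obtain ⟨W, hW, rfl⟩ := hL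
  rw [affinePoint_eq_pt] at ha
  replace ha := (submodule_pt_le_iff (insertNth_one_ne_zero i a)).1 ha
  obtain ⟨w, hwW, hw⟩ : ∃ w ∈ W, w ∉ Submodule.span ℂ {(i.insertNth (1 : ℂ) a : C4)} := by
    by_contra! hcon
    have h1 := (Submodule.finrank_mono (show W ≤ _ from hcon)).trans
      (finrank_span_singleton (K := ℂ) (insertNth_one_ne_zero i a)).le
    omega
  set b : C3 := fun l => w (i.succAbove l) - w i * a l with hb
  have hwb : (i.insertNth (0 : ℂ) b : C4) = w - w i • (i.insertNth (1 : ℂ) a : C4) := by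
    funext k
    refine Fin.succAboveCases i ?_ (fun l => ?_) k <;> simp [hb]
  have hb0 : b ≠ 0 := by
    intro h0
    apply hw
    rw [Submodule.mem_span_singleton]
    refine ⟨w i, ?_⟩
    have h1 : (i.insertNth (0 : ℂ) b : C4) = 0 := by
      rw [h0]
      funext k
      refine Fin.succAboveCases i ?_ (fun l => ?_) k <;> simp
    rw [h1] at hwb
    exact (sub_eq_zero.1 hwb.symm).symm
  refine ⟨b, hb0, ?_⟩
  have hle : Submodule.span ℂ
      {(i.insertNth (1 : ℂ) a : C4), (i.insertNth (0 : ℂ) b : C4)} ≤ W := by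
    rw [Submodule.span_le, insert_subset_iff, singleton_subset_iff]
    refine ⟨ha, ?_⟩
    rw [hwb]
    exact W.sub_mem hwW (W.smul_mem _ ha)
  rw [← Submodule.eq_of_le_of_finrank_eq hle (by rw [hW, finrank_span_insertNth hb0])]
  rfl

theorem projLine_smul (hb : b ≠ 0) {t : ℂ} (ht : t ≠ 0) :
    projLine i a (t • b) = projLine i a b := by
  have h : (i.insertNth (0 : ℂ) (t • b) : C4) = t • (i.insertNth (0 : ℂ) b : C4) := by
    funext k
    refine Fin.succAboveCases i ?_ (fun l => ?_) k <;> simp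
  have hle : Submodule.span ℂ {(i.insertNth (1 : ℂ) a : C4), (i.insertNth (0 : ℂ) (t • b) : C4)} ≤
      Submodule.span ℂ {(i.insertNth (1 : ℂ) a : C4), (i.insertNth (0 : ℂ) b : C4)} := by
    rw [Submodule.span_le, insert_subset_iff, singleton_subset_iff, h]
    exact ⟨Submodule.subset_span (by simp),
      Submodule.smul_mem _ _ (Submodule.subset_span (by simp))⟩
  rw [projLine, Submodule.eq_of_le_of_finrank_eq hle (by
    rw [finrank_span_insertNth hb, finrank_span_insertNth (smul_ne_zero ht hb)])]
  rfl

theorem projLine_subset {Λ : Set CP3} (hΛ : IsClosed Λ) (h : ∀ t : ℂ, affinePoint i (a + t • b) ∈ Λ) :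
    projLine i a b ⊆ Λ := by
  have key : ∀ α β : ℂ, α ≠ 0 →
      pt (α • (i.insertNth (1 : ℂ) a : C4) + β • (i.insertNth (0 : ℂ) b : C4)) ∈ Λ := by
    intro α β hα
    have h1 : α • (i.insertNth (1 : ℂ) a : C4) + β • (i.insertNth (0 : ℂ) b : C4) =
        α • (i.insertNth (1 : ℂ) (a + (α⁻¹ * β) • b) : C4) := by
      rw [smul_add_smul_insertNth]
      funext k
      refine Fin.succAboveCases i ?_ (fun l => ?_) k
      · simp
      · simp [mul_add, mul_assoc, mul_inv_cancel_left₀ hα]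
    rw [h1, pt_smul hα, ← affinePoint_eq_pt]
    exact h _
  intro p hp
  obtain ⟨v, hv, rfl⟩ := exists_pt_eq p
  obtain ⟨α, β, rfl⟩ := Submodule.mem_span_pair.1 ((submodule_pt_le_iff hv).1 hp)
  by_cases hα : α = 0
  -- The point at infinity is a limit of affine points of the line, and Λ is closed.
  · subst hα
    have hcont : Continuous fun s : ℂ =>
        s • (i.insertNth (1 : ℂ) a : C4) + β • (i.insertNth (0 : ℂ) b : C4) := by fun_prop
    have hlim : Tendsto (fun s : ℂ =>
        pt (s • (i.insertNth (1 : ℂ) a : C4) + β • (i.insertNth (0 : ℂ) b : C4))) (𝓝[≠] 0)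
        (𝓝 (pt ((0 : ℂ) • (i.insertNth (1 : ℂ) a : C4) + β • (i.insertNth (0 : ℂ) b : C4)))) :=
      ((continuousAt_pt hv).tendsto.comp (hcont.tendsto 0)).mono_left nhdsWithin_le_nhds
    refine hΛ.mem_of_tendsto hlim ?_
    filter_upwards [self_mem_nhdsWithin] with s hs using key s β hs
  · exact key α β hα

instance instCompactSpace : CompactSpace CP3 := by
  have h : IsCompact (pt '' Metric.sphere (0 : C4) 1) := by
    refine (isCompact_sphere _ _).image_of_continuousOn (continuousOn_pt.mono fun v hv h0 => ?_)
    rw [mem_singleton_iff.1 h0, mem_sphere_zero_iff_norm, norm_zero] at hv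
    exact zero_ne_one hv
  refine ⟨h.of_isClosed_subset isClosed_univ fun p _ => ?_⟩
  obtain ⟨v, hv, rfl⟩ := exists_pt_eq p
  have hn : ((‖v‖⁻¹ : ℝ) : ℂ) ≠ 0 := by simpa using hv
  refine ⟨((‖v‖⁻¹ : ℝ) : ℂ) • v, ?_, pt_smul hn v⟩
  rw [mem_sphere_zero_iff_norm, norm_smul, Complex.norm_real, norm_inv, norm_norm,
    inv_mul_cancel₀ (norm_ne_zero_iff.2 hv)]

theorem tendsto_affineCoord {x : CP3} (hx : x ∈ chartDomain i) :
    Tendsto (affineCoord i) (𝓝 x) (𝓝 (affineCoord i x)) :=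
  (affineChart i).continuousAt hx

end Lines

/-! ### From affine charts to ℂℙ³. -/

section Globalization

variable {Λ : Set CP3}

/-- Every point of `Λ` lies on a line contained in `Λ`, in terms of the affine charts. -/
def HasLines (Λ : Set CP3) : Prop :=
  ∀ (i : Fin 4) (y : C3), affinePoint i y ∈ Λ →
    ∃ c : C3, c ≠ 0 ∧ ∀ t : ℂ, affinePoint i (y + t • c) ∈ Λ

theorem HasLines.exists_isLine (h : HasLines Λ) (hΛ : IsClosed Λ) {x : CP3} (hx : x ∈ Λ) :
    ∃ L, IsLine L ∧ x ∈ L ∧ L ⊆ Λ := by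
  obtain ⟨i, hi⟩ := exists_mem_chartDomain x
  have hxa := affinePoint_affineCoord i hi
  obtain ⟨c, hc, hcΛ⟩ := h i (affineCoord i x) (by rwa [hxa])
  refine ⟨_, isLine_projLine hc, mem_projLine_affineCoord hi, projLine_subset hΛ hcΛ⟩

theorem HasLines.hasDenseLines (h : HasLines Λ) {k : ℕ}
    (hk : IsLocallyFiniteUnionOfSubmanifolds k Λ) {M : Set CP3} (hM : IsRealSubmanifold k M)
    (hMΛ : M ⊆ Λ) (i : Fin 4) : HasDenseLines (affinePoint i ⁻¹' M) (affinePoint i ⁻¹' Λ) :=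
  (hk.preimage i).hasDenseLines (fun a ha => h i a ha) (hM.preimage i) (preimage_mono hMΛ)

theorem HasLines.exists_line_of_dim_two (h : HasLines Λ) (hΛ : IsClosed Λ)
    (hk : IsLocallyFiniteUnionOfSubmanifolds 2 Λ) {M : Set CP3} (hM : IsRealSubmanifold 2 M)
    (hMΛ : M ⊆ Λ) {x : CP3} (hx : x ∈ M) :
    ∃ L, (IsLine L ∧ L ⊆ Λ) ∧ ∀ᶠ y in 𝓝 x, y ∈ M → y ∈ L := by
  obtain ⟨i, hi⟩ := exists_mem_chartDomain x
  have hxa := affinePoint_affineCoord i hi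
  obtain ⟨c, hc, hcΛ, hev⟩ := (hM.preimage i).exists_line_of_dim_two
    (h.hasDenseLines hk hM hMΛ i) (a := affineCoord i x) (by rwa [mem_preimage, hxa])
  refine ⟨_, ⟨isLine_projLine hc, projLine_subset hΛ hcΛ⟩, ?_⟩
  filter_upwards [(tendsto_affineCoord hi).eventually hev,
    (isOpen_chartDomain i).mem_nhds hi] with y hy hyi hyM
  have hya := affinePoint_affineCoord i hyi
  rw [← hya]
  exact affinePoint_mem_projLine.2 (hy (by rwa [mem_preimage, hya]))

/-- Near each point every piece of Λ lies on one line, so finitely many lines of Λ cover Λ locally;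
compactness makes this global. -/
theorem HasLines.exists_finite_lines (h : HasLines Λ) (hΛ : IsClosed Λ)
    (hk : IsLocallyFiniteUnionOfSubmanifolds 2 Λ) :
    ∃ F : Set (Set CP3), F.Finite ∧ (∀ L ∈ F, IsLine L) ∧ Λ = ⋃₀ F := by
  obtain ⟨F, hF, hFL, hsub⟩ : ∃ F : Set (Set CP3), F.Finite ∧ (∀ L ∈ F, IsLine L ∧ L ⊆ Λ) ∧
      Λ ⊆ ⋃₀ F := by
    refine hΛ.isCompact.induction_on
      (p := fun s => ∃ F : Set (Set CP3), F.Finite ∧ (∀ L ∈ F, IsLine L ∧ L ⊆ Λ) ∧ s ⊆ ⋃₀ F)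
      ⟨∅, finite_empty, by simp, by simp⟩ ?_ ?_ ?_
    · rintro s t hst ⟨F, h1, h2, h3⟩
      exact ⟨F, h1, h2, hst.trans h3⟩
    · rintro s t ⟨F, h1, h2, h3⟩ ⟨F', h1', h2', h3'⟩
      refine ⟨F ∪ F', h1.union h1', fun L hL => hL.elim (h2 L) (h2' L), ?_⟩
      rw [sUnion_union]
      exact union_subset_union h3 h3'
    · intro x hx
      obtain ⟨U, hU, hxU, 𝓜, h𝓜, hM, hUΛ⟩ := hk x hx
      have hloc : ∀ M ∈ 𝓜, ∃ L, (IsLine L ∧ L ⊆ Λ) ∧ ∀ᶠ y in 𝓝 x, y ∈ M → y ∈ L := by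
        intro M hMm
        obtain ⟨hM1, -, hM3⟩ := hM M hMm
        by_cases hxM : x ∈ M
        · exact h.exists_line_of_dim_two hΛ hk hM1
            (((subset_sUnion_of_mem hMm).trans hUΛ.superset).trans inter_subset_left) hxM
        -- A piece that misses `x` is absent near `x`, so any line in Λ can be assigned to it.
        · obtain ⟨L, hL, -, hLΛ⟩ := h.exists_isLine hΛ hx
          refine ⟨L, ⟨hL, hLΛ⟩, ?_⟩
          filter_upwards [isClosed_closure.isOpen_compl.mem_nhds fun hc => hxM (hM3 ⟨hc, hxU⟩)]
            with y hy hyM using absurd (subset_closure hyM) hy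
      choose! L hL hev using hloc
      have hev' := (eventually_all_finite h𝓜).2 hev
      refine ⟨{y | y ∈ Λ → y ∈ ⋃₀ (L '' 𝓜)} ∩ Λ, inter_mem (mem_nhdsWithin_of_mem_nhds ?_)
        self_mem_nhdsWithin, L '' 𝓜, h𝓜.image _, ?_, fun y hy => hy.1 hy.2⟩
      · filter_upwards [hev', hU.mem_nhds hxU] with y hy hyU hyΛ
        obtain ⟨M, hMm, hyM⟩ := hUΛ.subset ⟨hyΛ, hyU⟩
        exact ⟨L M, mem_image_of_mem _ hMm, hy M hMm hyM⟩
      · rintro _ ⟨M, hMm, rfl⟩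
        exact hL M hMm
  exact ⟨F, hF, fun L hL => (hFL L hL).1, hsub.antisymm (sUnion_subset fun L hL => (hFL L hL).2)⟩

theorem IsSlice.isSliceChart {M : Set CP3} {i : Fin 4} {x : CP3} (hx : x ∈ chartDomain i)
    {e : OpenPartialHomeomorph C3 C3} {W : Submodule ℝ C3}
    (h : IsSlice (affinePoint i ⁻¹' M) (affineCoord i x) e W) :
    IsSliceChart M x (affineChart i ≫ₕ e) W := by
  have hi := contMDiffOn_of_mem_maximalAtlas (affineChart_mem_maximalAtlas i)
  have hi' := contMDiffOn_symm_of_mem_maximalAtlas (affineChart_mem_maximalAtlas i)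
  have he := contMDiffOn_iff_contDiffOn.2 h.contDiffOn
  have he' := contMDiffOn_iff_contDiffOn.2 h.contDiffOn_symm
  refine ⟨OpenPartialHomeomorph.mem_maximalAtlas_of_contMDiffOn _ ?_ ?_, ⟨hx, h.mem_source⟩, ?_⟩
  · exact he.comp (hi.mono fun y hy => hy.1) fun y hy => hy.2
  · exact hi'.comp (he'.mono fun y hy => hy.1) fun y hy => hy.2
  · intro y hy
    have h1 : affinePoint i (affineCoord i y) ∈ M ↔ e (affineCoord i y) ∈ W := h.mem_iff _ hy.2
    rwa [affinePoint_affineCoord i hy.1] at h1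

theorem eventually_mem_projLine_iff {M : Set CP3} {i : Fin 4} {x : CP3} (hx : x ∈ chartDomain i)
    {b : C3} (hb : b ≠ 0) : (∀ᶠ y in 𝓝 x, y ∈ projLine i (affineCoord i x) b → y ∈ M) ↔
      ∀ᶠ t : ℂ in 𝓝 0, affineCoord i x + t • b ∈ affinePoint i ⁻¹' M := by
  have hxa := affinePoint_affineCoord i hx
  constructor
  · intro h
    have h1 : Tendsto (fun t : ℂ => affinePoint i (affineCoord i x + t • b)) (𝓝 0) (𝓝 x) := by
      have := ((continuous_affinePoint i).tendsto _).comp (tendsto_add_smul (affineCoord i x) b)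
      rwa [hxa] at this
    filter_upwards [h1.eventually h] with t ht using ht (affinePoint_mem_projLine.2 ⟨t, rfl⟩)
  · intro h
    obtain ⟨l, hl⟩ := Function.ne_iff.1 hb
    -- A coordinate with b l ≠ 0 recovers the parameter of a point of the line continuously.
    have h1 : Tendsto (fun y => (affineCoord i y l - affineCoord i x l) / b l) (𝓝 x) (𝓝 0) := by
      have h2 := ((((continuous_apply l).tendsto _).comp (tendsto_affineCoord hx)).sub_const
        (affineCoord i x l)).div_const (b l)
      rwa [sub_self, zero_div] at h2
    filter_upwards [h1.eventually h, (isOpen_chartDomain i).mem_nhds hx] with y hy hyi hyL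
    have hya := affinePoint_affineCoord i hyi
    rw [← hya] at hyL
    obtain ⟨t, ht⟩ := affinePoint_mem_projLine.1 hyL
    have h3 : (affineCoord i y l - affineCoord i x l) / b l = t := by
      rw [ht]
      simp only [Pi.add_apply, Pi.smul_apply, smul_eq_mul, add_sub_cancel_left]
      exact mul_div_cancel_right₀ t hl
    rw [h3, ← ht, mem_preimage, hya] at hy
    exact hy

theorem HasLines.isFoliatedByLines (h : HasLines Λ) (hΛ : IsClosed Λ)
    (hk : IsLocallyFiniteUnionOfSubmanifolds 3 Λ) : IsFoliatedByLines Λ := by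
  refine ⟨fun x hx => h.exists_isLine hΛ hx, fun M hM hMΛ x hx => ?_⟩
  obtain ⟨i, hi⟩ := exists_mem_chartDomain x
  have hxa := affinePoint_affineCoord i hi
  obtain ⟨⟨b, hb, hbΛ, hbM, huniq⟩, e, W, T, he, hW, hTW, hT, hfol⟩ :=
    (hM.preimage i).exists_foliation (hΛ.preimage (continuous_affinePoint i))
      (h.hasDenseLines hk hM hMΛ i) (a := affineCoord i x) (by rwa [mem_preimage, hxa])
  refine ⟨⟨projLine i (affineCoord i x) b, ⟨isLine_projLine hb, projLine_subset hΛ hbΛ,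
    mem_projLine_affineCoord hi, (eventually_mem_projLine_iff hi hb).2 hbM⟩, ?_⟩, _, W, T, he.isSliceChart hi, hW, hTW, hT, ?_⟩
  · rintro L ⟨hL, -, hxL, hev⟩
    obtain ⟨c, hc, rfl⟩ := hL.exists_eq_projLine (i := i) (a := affineCoord i x) (by rwa [hxa])
    obtain ⟨t, ht, rfl⟩ := huniq c hc ((eventually_mem_projLine_iff hi hc).1 hev)
    exact projLine_smul hb ht
  · rintro y ⟨hyM, hyi, hye⟩
    have hmem : ∀ {z : CP3}, z ∈ M → z ∈ chartDomain i → affineCoord i z ∈ affinePoint i ⁻¹' M := by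
      intro z hz hzi
      rwa [mem_preimage, affinePoint_affineCoord i hzi]
    obtain ⟨c, hc, hcΛ, hpl⟩ := hfol (affineCoord i y) ⟨hmem hyM hyi, hye⟩
    refine ⟨_, isLine_projLine hc, projLine_subset hΛ hcΛ, ?_⟩
    rintro z ⟨hzM, hzi, hze⟩ hz
    rw [← affinePoint_affineCoord i hzi]
    exact affinePoint_mem_projLine.2 (hpl (affineCoord i z) ⟨hmem hzM hzi, hze⟩ hz)

end Globalization

end CP3
theorem proposition5p1 (D : TopologicalSpace.Opens CP3) (hD : IsConnected (D : Set CP3))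
    (X : Type*) [TopologicalSpace X] [T2Space X] [CompactSpace X]
    [ChartedSpace C3 X] [IsManifold 𝓘(ℂ, C3) ω X] (hX : CP3.Covers D X) :
    (CP3.IsLocallyFiniteUnionOfSubmanifolds 2 (D : Set CP3)ᶜ →
      ∃ F : Set (Set CP3), F.Finite ∧ (∀ L ∈ F, CP3.IsLine L) ∧ (D : Set CP3)ᶜ = ⋃₀ F) ∧
    (CP3.IsLocallyFiniteUnionOfSubmanifolds 3 (D : Set CP3)ᶜ →
      CP3.IsFoliatedByLines (D : Set CP3)ᶜ) := by
  -- Both cases share this: the existence of lines needs only real codimension greater than two.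
  have hlines : ∀ k < 4, CP3.IsLocallyFiniteUnionOfSubmanifolds k (D : Set CP3)ᶜ →
      CP3.HasLines (D : Set CP3)ᶜ := fun k hk h i y hy =>
    CP3.exists_direction_of_covers hk hD.nonempty hX h hy
  have hclosed : IsClosed (D : Set CP3)ᶜ := D.isOpen.isClosed_compl
  exact ⟨fun h => (hlines 2 (by norm_num) h).exists_finite_lines hclosed h,
    fun h => (hlines 3 (by norm_num) h).isFoliatedByLines hclosed h⟩
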